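/- Let $\gamma\in C_0^\infty((-1,1))$ be real valued with $\|\gamma\|_{L^\infty}<1$. Put $E=(0,\infty)\times(0,1)$ and $V=(-1,1)\times(0,1)$, with points $(s,u)$, and for $0<\delta\le\varepsilon$ let $$\tilde{\mathbb H}_\varepsilon=L^2(E)\oplus L^2(E)\oplus L^2(V,\varepsilon\,ds\,du),\qquad \|\Psi\|_{\tilde{\mathbb H}_\varepsilon}^2=\|\psi_1\|_{L^2(E)}^2+\|\psi_2\|_{L^2(E)}^2+\varepsilon\|\psi_v\|_{L^2(V)}^2 .$$ Let $\tilde H_{\delta,\varepsilon}$ be the operator in $\tilde{\mathbb H}_\varepsilon$ whose domain $D(\tilde H_{\delta,\varepsilon})$ consists of all $\Psi=(\psi_1,\psi_2,\psi_v)\in\tilde{\mathbb H}_\varepsilon$ such that $\partial_s\psi,\partial_u\psi,\partial_s^2\psi,\partial_u^2\psi$ are in $L^2$ for each component $\psi$, with (in the sense of traces) $\psi_1=\psi_2=\psi_v=0$ at $u=0,1$ and $$\psi_1|_{s=0}=\psi_v|_{s=-1},\quad \psi_2|_{s=0}=\psi_v|_{s=1},\quad \partial_s\psi_1|_{s=0}=-\tfrac1\varepsilon\partial_s\psi_v|_{s=-1},\quad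 \partial_s\psi_2|_{s=0}=\tfrac1\varepsilon\partial_s\psi_v|_{s=1},$$ and which acts as $$\tilde H_{\delta,\varepsilon}\Psi=\Big(\big[-\partial_s^2-\tfrac1{\delta^2}\partial_u^2\big]\psi_1,\ \big[-\partial_s^2-\tfrac1{\delta^2}\partial_u^2\big]\psi_2,\ \tfrac1{\varepsilon^2}\tilde L_{\delta/\varepsilon}\psi_v\Big),$$ where, with $\beta=\delta/\varepsilon$ and $g_\beta(s,u)=(1+u\beta\gamma(s))^2$, $$\tilde L_\beta=-\frac1{g_\beta}\partial_s^2-\Big[\partial_s\frac1{g_\beta}\Big]\partial_s+W_\beta-\frac1{\beta^2}\partial_u^2,\qquad W_\beta=-\frac14\frac{\gamma^2}{(1+u\beta\gamma)^2}+\frac12\frac{u\beta\gamma''}{(1+u\beta\gamma)^3}-\frac54\frac{(u\beta\gamma')^2}{(1+u\beta\gamma)^4}.$$ Let $h_v=-\frac{d^2}{ds^2}-\frac{\gamma^2}{4}$ in $L^2((-1,1))$ with domain $\{y\in H^2((-1,1)) : y'(\pm1)=0\}$, and let $r_v(w;s,s')$ be the integral kernel, continuous on $[-1,1]^2$, of $(h_v-w)^{-1}$.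 For $z\in\mathbb C\setminus\mathbb R$ let $\sqrt z$ be the square root with $\operatorname{Im}\sqrt z>0$ and, for $f\in L^2((0,\infty))$, let $$(r_0(z)f)(s)=\int_0^\infty\frac{i}{2\sqrt z}\Big(e^{i\sqrt z|s-s'|}-e^{i\sqrt z s}e^{i\sqrt z s'}\Big)f(s')\,ds'$$ (the resolvent $(-d^2/ds^2-z)^{-1}$ of the Dirichlet Laplacian on $(0,\infty)$). For an integer $n\ge1$ put $\chi_n(u)=\sqrt2\sin(n\pi u)$, and for $f_1,f_2\in L^2((0,\infty))$ put $\tilde\Xi_n=(f_1\chi_n,f_2\chi_n,0)$ and $p_j=(r_0(z)f_j)'(0)$, $j=1,2$. Consider constants $q_1,q_2\in\mathbb C$, $\xi_j=p_j+i\sqrt z\,q_j$, fixed by the relations $$q_1=\varepsilon r_v(\varepsilon^2z;-1,-1)\xi_1+\varepsilon r_v(\varepsilon^2z;-1,1)\xi_2,\qquad q_2=\varepsilon r_v(\varepsilon^2z;1,-1)\xi_1+\varepsilon r_v(\varepsilon^2z;1,1)\xi_2,$$ and the vector $\hat\Psi_\varepsilon=(\hat\psi_1,\hat\psi_2,\hat\psi_v)$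 with $$\hat\psi_j(s,u)=\big[(r_0(z)f_j)(s)+q_je^{i\sqrt z s}\big]\chi_n(u)\ (j=1,2),\qquad \hat\psi_v(s,u)=\varepsilon\big[\xi_1r_v(\varepsilon^2z;s,-1)+\xi_2r_v(\varepsilon^2z;s,1)\big]\chi_n(u).$$ **Theorem.** For all $z\in\mathbb C\setminus\mathbb R$, $0<\delta\le\varepsilon$, $n\ge1$ and $f_1,f_2\in L^2((0,\infty))$ the relations above determine $(q_1,q_2)$ uniquely, and $\hat\Psi_\varepsilon\in D(\tilde H_{\delta,\varepsilon})$. Moreover, for each $z\in\mathbb C\setminus\mathbb R$ there are $\varepsilon_0>0$ and $c>0$, depending only on $\gamma$ and $z$, such that for all $0<\varepsilon<\varepsilon_0$, all $0<\delta\le\varepsilon$, all $n\ge1$ and all $f_1,f_2\in L^2((0,\infty))$: * Case 1: if $0$ is not an eigenvalue of $h_v$, then $$\Big\|\Big[\tilde H_{\delta,\varepsilon}-\frac{n^2\pi^2}{\delta^2}-z\Big]\hat\Psi_\varepsilon-\tilde\Xi_n\Big\|_{\tilde{\mathbb H}_\varepsilon}\le c\,\frac{\delta}{\varepsilon^{3/2}}\,\|\tilde\Xi_n\|_{\tilde{\mathbb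 H}_\varepsilon};$$ * Case 2: if $0$ is an eigenvalue of $h_v$, then $$\Big\|\Big[\tilde H_{\delta,\varepsilon}-\frac{n^2\pi^2}{\delta^2}-z\Big]\hat\Psi_\varepsilon-\tilde\Xi_n\Big\|_{\tilde{\mathbb H}_\varepsilon}\le c\Big(\frac{\delta}{\varepsilon^{3/2}}+\frac{\delta}{\varepsilon^{5/2}}\Big)\|\tilde\Xi_n\|_{\tilde{\mathbb H}_\varepsilon}.$$ -/

import Mathlib

open Set Filter Topology MeasureTheory
open scoped ContDiff ENNReal

noncomputable section

namespace Waveguide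

/-! ### Weak derivatives, square-integrable Sobolev functions and traces on rectangles -/

/-- `p` is the weak derivative, in the constant direction `d`, of `ψ` on the open set `Ω`, and both
functions are square integrable on `Ω`. Points of `ℝ × ℝ` are written `(s, u)`. -/
structure HasWeakDeriv (d : ℝ × ℝ) (Ω : Set (ℝ × ℝ)) (ψ p : ℝ × ℝ → ℂ) : Prop where
  memLp : MemLp ψ 2 (volume.restrict Ω)
  memLp_deriv : MemLp p 2 (volume.restrict Ω)
  integral_eq : ∀ φ : ℝ × ℝ → ℝ, ContDiff ℝ ∞ φ → HasCompactSupport φ → tsupport φ ⊆ Ω →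
    ∫ x in Ω, fderiv ℝ φ x d • ψ x = - ∫ x in Ω, φ x • p x

/-- On an open set the weak derivative is unique almost everywhere. -/
theorem HasWeakDeriv.ae_eq {d : ℝ × ℝ} {Ω : Set (ℝ × ℝ)} (hΩ : IsOpen Ω)
    {ψ p q : ℝ × ℝ → ℂ} (hp : HasWeakDeriv d Ω ψ p) (hq : HasWeakDeriv d Ω ψ q) :
    p =ᵐ[volume.restrict Ω] q := by
  have hpl : LocallyIntegrable p (volume.restrict Ω) :=
    hp.memLp_deriv.locallyIntegrable (by norm_num)
  have hql : LocallyIntegrable q (volume.restrict Ω) :=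
    hq.memLp_deriv.locallyIntegrable (by norm_num)
  have key := hΩ.ae_eq_zero_of_integral_contDiff_smul_eq_zero (μ := volume.restrict Ω)
    ((hpl.sub hql).locallyIntegrableOn Ω) (by
      intro g hg hc hs
      have h1 := hp.integral_eq g hg hc hs
      have h2 := hq.integral_eq g hg hc hs
      have h3 : ∫ x in Ω, g x • p x = ∫ x in Ω, g x • q x := by
        rw [h1] at h2; exact neg_injective h2
      have hip : Integrable (fun x => g x • p x) (volume.restrict Ω) :=
        hpl.integrable_smul_left_of_hasCompactSupport hg.continuous hc
      have hiq : Integrable (fun x => g x • q x) (volume.restrict Ω) :=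
        hql.integrable_smul_left_of_hasCompactSupport hg.continuous hc
      simp only [Pi.sub_apply, smul_sub]
      rw [integral_sub hip hiq, h3, sub_self])
  filter_upwards [key, ae_restrict_mem hΩ.measurableSet] with x hx hxΩ
  exact sub_eq_zero.mp (hx hxΩ)

open Classical in
/-- The weak derivative of `ψ` on `Ω` in direction `d` (a chosen representative; the value `0` is
used only if there is no square-integrable weak derivative). -/
def weakDeriv (d : ℝ × ℝ) (Ω : Set (ℝ × ℝ)) (ψ : ℝ × ℝ → ℂ) : ℝ × ℝ → ℂ :=
  if h : ∃ p, HasWeakDeriv d Ω ψ p then h.choose else 0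

/-- The weak partial derivative `∂ψ/∂s` on `Ω`. -/
def dS (Ω : Set (ℝ × ℝ)) (ψ : ℝ × ℝ → ℂ) : ℝ × ℝ → ℂ := weakDeriv (1, 0) Ω ψ

/-- The weak partial derivative `∂ψ/∂u` on `Ω`. -/
def dU (Ω : Set (ℝ × ℝ)) (ψ : ℝ × ℝ → ℂ) : ℝ × ℝ → ℂ := weakDeriv (0, 1) Ω ψ

/-- `ψ`, `∂ψ/∂s`, `∂ψ/∂u`, `∂²ψ/∂s²` and `∂²ψ/∂u²` exist weakly and belong to `L²(Ω)`. -/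
structure MemH2 (Ω : Set (ℝ × ℝ)) (ψ : ℝ × ℝ → ℂ) : Prop where
  ds : ∃ p, HasWeakDeriv (1, 0) Ω ψ p
  du : ∃ p, HasWeakDeriv (0, 1) Ω ψ p
  dss : ∃ p, HasWeakDeriv (1, 0) Ω (dS Ω ψ) p
  duu : ∃ p, HasWeakDeriv (0, 1) Ω (dU Ω ψ) p

/-- `ψ` has the trace `g ∈ L²((0,1))` on the vertical side `{s = a} × (0,1)`, approached from
`s > a` if `σ = 1` and from `s < a` if `σ = -1`: the mean over `t ∈ (0,h)` of
`‖ψ(a + σ t, ·) - g‖²` in `L²((0,1))` tends to `0` as `h → 0+`. -/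
def HasTraceS (a σ : ℝ) (ψ : ℝ × ℝ → ℂ) (g : ℝ → ℂ) : Prop :=
  MemLp g 2 (volume.restrict (Ioo 0 1)) ∧
  Tendsto (fun h : ℝ => (ENNReal.ofReal h)⁻¹ *
    ∫⁻ t in Ioo 0 h, ∫⁻ u in Ioo (0 : ℝ) 1, ‖ψ (a + σ * t, u) - g u‖ₑ ^ 2) (𝓝[>] 0) (𝓝 0)

/-- `ψ` has the trace `g ∈ L²(I)` on the horizontal side `I × {u = b}`, approached from
`u > b` if `σ = 1` and from `u < b` if `σ = -1`. -/
def HasTraceU (I : Set ℝ) (b σ : ℝ) (ψ : ℝ × ℝ → ℂ) (g : ℝ → ℂ) : Prop :=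
  MemLp g 2 (volume.restrict I) ∧
  Tendsto (fun h : ℝ => (ENNReal.ofReal h)⁻¹ *
    ∫⁻ t in Ioo 0 h, ∫⁻ s in I, ‖ψ (s, b + σ * t) - g s‖ₑ ^ 2) (𝓝[>] 0) (𝓝 0)

/-! ### The Hilbert space and the Hamiltonian -/

/-- The edge `E = (0,∞) × (0,1)`. -/
def E : Set (ℝ × ℝ) := Ioi 0 ×ˢ Ioo 0 1

/-- The vertex region `V = (-1,1) × (0,1)`. -/
def V : Set (ℝ × ℝ) := Ioo (-1) 1 ×ˢ Ioo 0 1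

/-- Vectors `Ψ = (ψ₁, ψ₂, ψ_v)`: two functions on the edges and one on the vertex region (only
their classes up to null sets in `E`, `E` and `V` matter). -/
abbrev Vec : Type := (ℝ × ℝ → ℂ) × (ℝ × ℝ → ℂ) × (ℝ × ℝ → ℂ)

/-- The norm of `L²(E) ⊕ L²(E) ⊕ L²(V, ε ds du)`, with values in `[0, ∞]`. -/
def normH (ε : ℝ) (Ψ : Vec) : ℝ≥0∞ :=
  (eLpNorm Ψ.1 2 (volume.restrict E) ^ 2 + eLpNorm Ψ.2.1 2 (volume.restrict E) ^ 2 +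
    ENNReal.ofReal ε * eLpNorm Ψ.2.2 2 (volume.restrict V) ^ 2) ^ (1 / 2 : ℝ)

/-- The function `g_β(s,u) = (1 + u β γ(s))²`, where `β = δ/ε`. -/
def metricG (γ : ℝ → ℝ) (β : ℝ) (x : ℝ × ℝ) : ℝ := (1 + x.2 * β * γ x.1) ^ 2

/-- The effective potential `W_β`, where `β = δ/ε`. -/
def potW (γ : ℝ → ℝ) (β : ℝ) (x : ℝ × ℝ) : ℝ :=
  -(1 / 4) * (γ x.1 ^ 2 / (1 + x.2 * β * γ x.1) ^ 2)
    + (1 / 2) * (x.2 * β * deriv (deriv γ) x.1 / (1 + x.2 * β * γ x.1) ^ 3)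
    - (5 / 4) * ((x.2 * β * deriv γ x.1) ^ 2 / (1 + x.2 * β * γ x.1) ^ 4)

/-- The differential operator
`L_β ψ = -g⁻¹ ∂²ψ/∂s² - (∂g⁻¹/∂s) ∂ψ/∂s + W ψ - β⁻² ∂²ψ/∂u²` on `V`, where `β = δ/ε`. -/
def opL (γ : ℝ → ℝ) (β : ℝ) (ψ : ℝ × ℝ → ℂ) : ℝ × ℝ → ℂ := fun x =>
  -((1 / metricG γ β x : ℝ) : ℂ) * dS V (dS V ψ) x
    - ((deriv (fun t => 1 / metricG γ β (t, x.2)) x.1 : ℝ) : ℂ) * dS V ψ x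
    + ((potW γ β x : ℝ) : ℂ) * ψ x
    - ((1 / β ^ 2 : ℝ) : ℂ) * dU V (dU V ψ) x

/-- The domain of the Hamiltonian: square-integrable second derivatives, Dirichlet conditions on
the sides `u = 0, 1`, and matching of the traces and of the normal derivatives where the edges meet
the vertex region (`s = 0` on the first edge with `s = -1`, `s = 0` on the second edge with
`s = 1`). -/
structure MemDomain (ε : ℝ) (Ψ : Vec) : Prop where
  memH2_one : MemH2 E Ψ.1
  memH2_two : MemH2 E Ψ.2.1
  memH2_vertex : MemH2 V Ψ.2.2
  dirichlet_one : HasTraceU (Ioi 0) 0 1 Ψ.1 0 ∧ HasTraceU (Ioi 0) 1 (-1) Ψ.1 0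
  dirichlet_two : HasTraceU (Ioi 0) 0 1 Ψ.2.1 0 ∧ HasTraceU (Ioi 0) 1 (-1) Ψ.2.1 0
  dirichlet_vertex : HasTraceU (Ioo (-1) 1) 0 1 Ψ.2.2 0 ∧ HasTraceU (Ioo (-1) 1) 1 (-1) Ψ.2.2 0
  match_one : ∃ g, HasTraceS 0 1 Ψ.1 g ∧ HasTraceS (-1) 1 Ψ.2.2 g
  match_two : ∃ g, HasTraceS 0 1 Ψ.2.1 g ∧ HasTraceS 1 (-1) Ψ.2.2 g
  match_deriv_one : ∃ g, HasTraceS (-1) 1 (dS V Ψ.2.2) g ∧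
    HasTraceS 0 1 (dS E Ψ.1) (fun u => -(1 / (ε : ℂ)) * g u)
  match_deriv_two : ∃ g, HasTraceS 1 (-1) (dS V Ψ.2.2) g ∧
    HasTraceS 0 1 (dS E Ψ.2.1) (fun u => (1 / (ε : ℂ)) * g u)

/-- The action of the Hamiltonian (meaningful on its domain `MemDomain ε`). -/
def hamiltonian (γ : ℝ → ℝ) (δ ε : ℝ) (Ψ : Vec) : Vec :=
  (fun x => -dS E (dS E Ψ.1) x - (1 / (δ : ℂ) ^ 2) * dU E (dU E Ψ.1) x,
   fun x => -dS E (dS E Ψ.2.1) x - (1 / (δ : ℂ) ^ 2) * dU E (dU E Ψ.2.1) x,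
   fun x => (1 / (ε : ℂ) ^ 2) * opL γ (δ / ε) Ψ.2.2 x)

/-! ### The one-dimensional Neumann operator and its resolvent kernel -/

/-- `y` (taken as its continuous representative on `[-1,1]`) belongs to the domain
`{y ∈ H²((-1,1)) | y'(-1) = y'(1) = 0}` of `h_v = -d²/ds² - γ²/4`, and `h_v y = k`. Membership in
`H²` is expressed by `y` being `C¹` with absolutely continuous derivative `y₁` and second
derivative `y₂ ∈ L²`. -/
def NeumannMaps (γ : ℝ → ℝ) (y k : ℝ → ℂ) : Prop :=
  ∃ y₁ y₂ : ℝ → ℂ, ContinuousOn y₁ (Icc (-1) 1) ∧ MemLp y₂ 2 (volume.restrict (Ioo (-1) 1)) ∧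
    (∀ s ∈ Icc (-1 : ℝ) 1, y s = y (-1) + ∫ t in (-1)..s, y₁ t) ∧
    (∀ s ∈ Icc (-1 : ℝ) 1, y₁ s = y₁ (-1) + ∫ t in (-1)..s, y₂ t) ∧
    y₁ (-1) = 0 ∧ y₁ 1 = 0 ∧
    ∀ᵐ s ∂(volume.restrict (Ioo (-1) 1)), k s = -y₂ s - ((γ s ^ 2 / 4 : ℝ) : ℂ) * y s

/-- `μ` is an eigenvalue of `h_v`. -/
def IsNeumannEigenvalue (γ : ℝ → ℝ) (μ : ℂ) : Prop :=
  ∃ y : ℝ → ℂ, (∃ s ∈ Icc (-1 : ℝ) 1, y s ≠ 0) ∧ NeumannMaps γ y (fun s => μ * y s)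

/-- `r` is the (continuous) integral kernel of the resolvent `(h_v - w)⁻¹`: for each `f ∈ L²`, the
function `y(s) = ∫ r(s,s') f(s') ds'` lies in the domain of `h_v` and satisfies
`h_v y = f + w y`. -/
def IsResolventKernel (γ : ℝ → ℝ) (w : ℂ) (r : ℝ → ℝ → ℂ) : Prop :=
  ContinuousOn (fun x : ℝ × ℝ => r x.1 x.2) (Icc (-1) 1 ×ˢ Icc (-1) 1) ∧
  ∀ f : ℝ → ℂ, MemLp f 2 (volume.restrict (Ioo (-1) 1)) →
    NeumannMaps γ (fun s => ∫ s' in Ioo (-1) 1, r s s' * f s')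
      (fun s => f s + w * ∫ s' in Ioo (-1) 1, r s s' * f s')

open Classical in
/-- The integral kernel `r_v(w; s, s')` of `(h_v - w)⁻¹`; it is determined on `[-1,1]²` when `w` is
not an eigenvalue of `h_v`. -/
def rV (γ : ℝ → ℝ) (w : ℂ) : ℝ → ℝ → ℂ :=
  if h : ∃ r, IsResolventKernel γ w r then h.choose else 0

/-! ### The approximate solution -/

/-- The square root with positive imaginary part, for `z ∉ [0, ∞)`. -/
def sqrtUp (z : ℂ) : ℂ := Complex.I * (-z) ^ (1 / 2 : ℂ)

theorem sqrtUp_sq (z : ℂ) : sqrtUp z ^ 2 = z := by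
  have h : ((-z) ^ (1 / 2 : ℂ)) ^ 2 = -z := by
    simp
  rw [sqrtUp, mul_pow, h, Complex.I_sq]; ring

theorem sqrtUp_im_pos {z : ℂ} (hz : z.im ≠ 0) : 0 < (sqrtUp z).im := by
  have hz0 : -z ≠ 0 := by
    intro h; apply hz; have := congrArg Complex.im h; simpa using this
  have harg : |(-z).arg| < Real.pi := by
    rw [abs_lt]
    refine ⟨Complex.neg_pi_lt_arg _, lt_of_le_of_ne (Complex.arg_le_pi _) ?_⟩
    intro h
    rw [Complex.arg_eq_pi_iff] at h
    apply hz; simpa using h.2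
  have : 0 < ((-z) ^ (1 / 2 : ℂ)).re := by
    rw [Complex.cpow_def_of_ne_zero hz0, Complex.exp_re]
    have him : (Complex.log (-z) * (1 / 2)).im = (-z).arg / 2 := by
      simp [Complex.mul_im, Complex.log_im]; ring
    rw [him]
    refine mul_pos (Real.exp_pos _) (Real.cos_pos_of_mem_Ioo ⟨?_, ?_⟩)
    · linarith [(abs_lt.mp harg).1]
    · linarith [(abs_lt.mp harg).2]
  simpa [sqrtUp] using this

/-- The transverse modes `χ_n(u) = √2 sin(nπu)`. -/
def chi (n : ℕ) (u : ℝ) : ℂ := ((Real.sqrt 2 * Real.sin (n * Real.pi * u) : ℝ) : ℂ)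

/-- The resolvent `r₀(z) = (-d²/ds² - z)⁻¹` of the Dirichlet Laplacian on `(0,∞)`, through its
explicit kernel. -/
def r0 (z : ℂ) (f : ℝ → ℂ) (s : ℝ) : ℂ :=
  ∫ s' in Ioi (0 : ℝ), (Complex.I / (2 * sqrtUp z)) *
    (Complex.exp (Complex.I * sqrtUp z * ((|s - s'| : ℝ) : ℂ))
      - Complex.exp (Complex.I * sqrtUp z * (s : ℂ)) * Complex.exp (Complex.I * sqrtUp z * (s' : ℂ)))
    * f s'

/-- The constant `p = (r₀(z) f)'(0)` (derivative from the right). -/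
def pConst (z : ℂ) (f : ℝ → ℂ) : ℂ := derivWithin (r0 z f) (Ici 0) 0

/-- The constant `ξ = p + i √z q`. -/
def xiConst (z : ℂ) (f : ℝ → ℂ) (q : ℂ) : ℂ := pConst z f + Complex.I * sqrtUp z * q

/-- The linear relations that fix the constants `q = (q₁, q₂)`. -/
def IsCoupling (γ : ℝ → ℝ) (ε : ℝ) (z : ℂ) (f₁ f₂ : ℝ → ℂ) (q : ℂ × ℂ) : Prop :=
  q.1 = ε * rV γ (ε ^ 2 * z) (-1) (-1) * xiConst z f₁ q.1
      + ε * rV γ (ε ^ 2 * z) (-1) 1 * xiConst z f₂ q.2 ∧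
  q.2 = ε * rV γ (ε ^ 2 * z) 1 (-1) * xiConst z f₁ q.1
      + ε * rV γ (ε ^ 2 * z) 1 1 * xiConst z f₂ q.2

/-- The approximate solution `(ψ₁, ψ₂, ψ_v)` built with the constants `q = (q₁, q₂)`. -/
def hatPsi (γ : ℝ → ℝ) (ε : ℝ) (z : ℂ) (n : ℕ) (f₁ f₂ : ℝ → ℂ) (q : ℂ × ℂ) : Vec :=
  (fun x => (r0 z f₁ x.1 + q.1 * Complex.exp (Complex.I * sqrtUp z * (x.1 : ℂ))) * chi n x.2,
   fun x => (r0 z f₂ x.1 + q.2 * Complex.exp (Complex.I * sqrtUp z * (x.1 : ℂ))) * chi n x.2,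
   fun x => ε * (xiConst z f₁ q.1 * rV γ (ε ^ 2 * z) x.1 (-1)
      + xiConst z f₂ q.2 * rV γ (ε ^ 2 * z) x.1 1) * chi n x.2)

/-- The data `Ξ_n = (f₁ χ_n, f₂ χ_n, 0)`. -/
def dataXi (n : ℕ) (f₁ f₂ : ℝ → ℂ) : Vec :=
  (fun x => f₁ x.1 * chi n x.2, fun x => f₂ x.1 * chi n x.2, 0)

/-- The error `(H - n²π²/δ² - z) Ψ - Ξ_n` for the approximate solution `Ψ`. -/
def resolventError (γ : ℝ → ℝ) (δ ε : ℝ) (z : ℂ) (n : ℕ) (f₁ f₂ : ℝ → ℂ) (q : ℂ × ℂ) : Vec :=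
  hamiltonian γ δ ε (hatPsi γ ε z n f₁ f₂ q)
    - (((n ^ 2 * Real.pi ^ 2 / δ ^ 2 : ℝ) : ℂ) + z) • hatPsi γ ε z n f₁ f₂ q
    - dataXi n f₁ f₂

end Waveguide

end

open Waveguide

/-!
On the edges `ψ̂_j = (r₀(z) f_j + q_j e^{i√z s}) χ_n` solves the resolvent equation exactly, so the
error lives on the vertex region. There `ψ̂_v = y χ_n`, where `y` solves `h_v y = ε² z y` with
boundary derivatives `y'(-1) = -ε ξ₁` and `y'(1) = ε ξ₂`, and the error is
`ε⁻² (L_β - L_0) (y χ_n)` for `L_0 = h_v - β⁻² ∂_u²`. The coefficients of `L_β - L_0` are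
`O(β) = O(δ/ε)` and `‖·‖` carries a factor `√ε`, so the error is `O(δ ε^{-5/2})` times the size of
`y` and `y'`.

To bound `y` by the data `p₁, p₂`, integrate the imaginary part of the equation against `ȳ`: the
flux of `y` through the boundary has the sign of `-Im z`, which makes the boundary relations
between `p` and `q` dissipative and bounds `q` by `p` uniformly in `ε`. Since `q` and `ε ξ` are the
Cauchy data of `y`, Gronwall gives `y = O(‖p₁‖ + ‖p₂‖)`. If `0` is not an eigenvalue of `h_v`, the
solution `a` of `h_v a = 0` with `a(-1) = 1`, `a'(-1) = 0` has `a'(1) ≠ 0`, and comparing `y` with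
`y(-1) a` improves this to `y = O(ε (‖p₁‖ + ‖p₂‖))`.
-/

noncomputable section

namespace Waveguide

/-! ### Linear differential equations on the line -/

section Existence

variable {F : Type*} [NormedAddCommGroup F] [NormedSpace ℝ F]

theorem abs_integral_mul_exp_abs_integral {a : ℝ → ℝ} (ha : Continuous a) (ha0 : ∀ t, 0 ≤ a t)
    (t₀ t : ℝ) :
    |∫ τ in t₀..t, a τ * Real.exp (|∫ x in t₀..τ, a x|)| = Real.exp |∫ x in t₀..t, a x| - 1 := by
  obtain ⟨σ, hσ, habs⟩ : ∃ σ : ℝ, |σ| = 1 ∧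
      ∀ τ ∈ uIcc t₀ t, |∫ x in t₀..τ, a x| = σ * ∫ x in t₀..τ, a x := by
    rcases le_total t₀ t with h | h
    · refine ⟨1, abs_one, fun τ hτ => ?_⟩
      rw [uIcc_of_le h] at hτ
      rw [one_mul, abs_of_nonneg (intervalIntegral.integral_nonneg hτ.1 fun x _ => ha0 x)]
    · refine ⟨-1, by norm_num, fun τ hτ => ?_⟩
      rw [uIcc_of_ge h] at hτ
      rw [intervalIntegral.integral_symm, abs_neg, neg_one_mul, neg_neg,
        abs_of_nonneg (intervalIntegral.integral_nonneg hτ.2 fun x _ => ha0 x)]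
  have hσ2 : σ * σ = 1 := by rw [← abs_mul_abs_self, hσ, one_mul]
  have hderiv : ∀ τ, HasDerivAt (fun τ => σ * Real.exp (σ * ∫ x in t₀..τ, a x))
      (a τ * Real.exp (σ * ∫ x in t₀..τ, a x)) τ := fun τ =>
    ((((ha.integral_hasStrictDerivAt t₀ τ).hasDerivAt.const_mul σ).exp).const_mul σ).congr_deriv
      (by linear_combination (a τ * Real.exp (σ * ∫ x in t₀..τ, a x)) * hσ2)
  have : Continuous fun τ => ∫ x in t₀..τ, a x :=
    intervalIntegral.continuous_primitive (fun _ _ => ha.intervalIntegrable _ _) t₀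
  have hint : ∫ τ in t₀..t, a τ * Real.exp |∫ x in t₀..τ, a x|
      = σ * (Real.exp |∫ x in t₀..t, a x| - 1) := by
    rw [intervalIntegral.integral_congr (g := fun τ => a τ * Real.exp (σ * ∫ x in t₀..τ, a x))
        fun τ hτ => by simp only [habs τ hτ],
      intervalIntegral.integral_eq_sub_of_hasDerivAt (fun τ _ => hderiv τ)
        (Continuous.intervalIntegrable (by fun_prop) _ _), habs t right_mem_uIcc]
    simp [mul_sub]
  rw [hint, abs_mul, hσ, one_mul, abs_of_nonneg]
  linarith [Real.one_le_exp (abs_nonneg (∫ x in t₀..t, a x))]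

/-- The exponent `Λ` of Bielecki's weight `e^{-Λ(t)}`, in which the Volterra operator
`x ↦ ∫_{t₀}^t A(τ) x(τ) dτ` has norm at most `1/2` on the whole line. -/
def bieleckiExponent (A : ℝ → F →L[ℝ] F) (t₀ t : ℝ) : ℝ := |∫ τ in t₀..t, 2 * ‖A τ‖|

variable {A : ℝ → F →L[ℝ] F}

theorem continuous_bieleckiExponent (hA : Continuous A) (t₀ : ℝ) :
    Continuous (bieleckiExponent A t₀) :=
  (intervalIntegral.continuous_primitive
    (fun _ _ => (by fun_prop : Continuous fun τ => 2 * ‖A τ‖).intervalIntegrable _ _) t₀).abs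

theorem continuous_bieleckiIntegrand (hA : Continuous A) (t₀ : ℝ)
    (u : BoundedContinuousFunction ℝ F) :
    Continuous fun τ => Real.exp (bieleckiExponent A t₀ τ) • A τ (u τ) :=
  (continuous_bieleckiExponent hA t₀).rexp.smul (hA.clm_apply u.continuous)

theorem norm_bielecki_integral_le (hA : Continuous A) (t₀ t : ℝ)
    (u : BoundedContinuousFunction ℝ F) :
    ‖Real.exp (-bieleckiExponent A t₀ t) •
        ∫ τ in t₀..t, Real.exp (bieleckiExponent A t₀ τ) • A τ (u τ)‖ ≤ 1 / 2 * ‖u‖ := by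
  have hΛ := continuous_bieleckiExponent hA t₀
  have hweight : |∫ τ in t₀..t, 2 * ‖A τ‖ * Real.exp (bieleckiExponent A t₀ τ)|
      = Real.exp (bieleckiExponent A t₀ t) - 1 :=
    abs_integral_mul_exp_abs_integral (by fun_prop : Continuous fun τ => 2 * ‖A τ‖)
      (fun _ => by positivity) t₀ t
  have hle : ‖∫ τ in t₀..t, Real.exp (bieleckiExponent A t₀ τ) • A τ (u τ)‖
      ≤ |∫ τ in t₀..t, 2 * ‖A τ‖ * Real.exp (bieleckiExponent A t₀ τ) * (‖u‖ / 2)| := by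
    refine intervalIntegral.norm_integral_le_abs_of_norm_le (.of_forall fun τ => ?_)
      (Continuous.intervalIntegrable (by fun_prop) _ _)
    rw [norm_smul, Real.norm_of_nonneg (Real.exp_pos _).le]
    calc Real.exp (bieleckiExponent A t₀ τ) * ‖A τ (u τ)‖
        ≤ Real.exp (bieleckiExponent A t₀ τ) * (‖A τ‖ * ‖u‖) := by
          gcongr; exact (A τ).le_opNorm_of_le (u.norm_coe_le_norm τ)
      _ = 2 * ‖A τ‖ * Real.exp (bieleckiExponent A t₀ τ) * (‖u‖ / 2) := by ring
  rw [intervalIntegral.integral_mul_const, abs_mul, hweight,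
    abs_of_nonneg (by positivity : 0 ≤ ‖u‖ / 2)] at hle
  rw [norm_smul, Real.norm_of_nonneg (Real.exp_pos _).le]
  calc Real.exp (-bieleckiExponent A t₀ t) *
        ‖∫ τ in t₀..t, Real.exp (bieleckiExponent A t₀ τ) • A τ (u τ)‖
      ≤ Real.exp (-bieleckiExponent A t₀ t) *
          (Real.exp (bieleckiExponent A t₀ t) * (‖u‖ / 2)) := by
        gcongr; exact hle.trans (by gcongr; linarith)
    _ = 1 / 2 * ‖u‖ := by rw [Real.exp_neg]; field_simp

/-- The Volterra operator `x ↦ ∫_{t₀}^t A(τ) x(τ) dτ`, conjugated by Bielecki's weight so that it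
acts on bounded functions. -/
def bieleckiOperator (hA : Continuous A) (t₀ : ℝ) :
    BoundedContinuousFunction ℝ F →L[ℝ] BoundedContinuousFunction ℝ F :=
  LinearMap.mkContinuous
    { toFun := fun u => BoundedContinuousFunction.ofNormedAddCommGroup
        (fun t => Real.exp (-bieleckiExponent A t₀ t) •
          ∫ τ in t₀..t, Real.exp (bieleckiExponent A t₀ τ) • A τ (u τ))
        ((continuous_bieleckiExponent hA t₀).neg.rexp.smul (intervalIntegral.continuous_primitive
          (fun _ _ => (continuous_bieleckiIntegrand hA t₀ u).intervalIntegrable _ _) t₀))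
        (1 / 2 * ‖u‖) (norm_bielecki_integral_le hA t₀ · u)
      map_add' := fun u v => by
        ext t
        simp [intervalIntegral.integral_add
          ((continuous_bieleckiIntegrand hA t₀ u).intervalIntegrable _ _)
          ((continuous_bieleckiIntegrand hA t₀ v).intervalIntegrable _ _)]
      map_smul' := fun c u => by
        ext t
        simp [smul_comm _ c] }
    (1 / 2) fun u => BoundedContinuousFunction.norm_ofNormedAddCommGroup_le _ (by positivity)
      (norm_bielecki_integral_le hA t₀ · u)

theorem norm_bieleckiOperator_lt_one (hA : Continuous A) (t₀ : ℝ) : ‖bieleckiOperator hA t₀‖ < 1 :=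
  (LinearMap.mkContinuous_norm_le _ (by norm_num) _).trans_lt (by norm_num)

theorem exists_eq_add_integral_clm [CompleteSpace F] (hA : Continuous A) (t₀ : ℝ) (x₀ : F) :
    ∃ x : ℝ → F, Continuous x ∧ ∀ t, x t = x₀ + ∫ τ in t₀..t, A τ (x τ) := by
  have hΛ := continuous_bieleckiExponent hA t₀
  let b : BoundedContinuousFunction ℝ F := BoundedContinuousFunction.ofNormedAddCommGroup
    (fun t => Real.exp (-bieleckiExponent A t₀ t) • x₀) (by fun_prop) ‖x₀‖ fun t => by
      rw [norm_smul, Real.norm_of_nonneg (Real.exp_pos _).le]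
      exact mul_le_of_le_one_left (norm_nonneg _)
        (Real.exp_le_one_iff.2 (neg_nonpos.2 (abs_nonneg _)))
  obtain ⟨u, hu⟩ : ∃ u, u - bieleckiOperator hA t₀ u = b := by
    obtain ⟨R, hR⟩ :=
      (isUnit_one_sub_of_norm_lt_one (norm_bieleckiOperator_lt_one hA t₀)).exists_right_inv
    exact ⟨R b, DFunLike.congr_fun hR b⟩
  refine ⟨fun t => Real.exp (bieleckiExponent A t₀ t) • u t, by fun_prop, fun t => ?_⟩
  have hut : u t = Real.exp (-bieleckiExponent A t₀ t) • x₀ +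
      Real.exp (-bieleckiExponent A t₀ t) •
        ∫ τ in t₀..t, Real.exp (bieleckiExponent A t₀ τ) • A τ (u τ) :=
    sub_eq_iff_eq_add.1 (DFunLike.congr_fun hu t)
  calc Real.exp (bieleckiExponent A t₀ t) • u t
      = x₀ + ∫ τ in t₀..t, Real.exp (bieleckiExponent A t₀ τ) • A τ (u τ) := by
        rw [hut, smul_add, smul_smul, smul_smul, ← Real.exp_add, add_neg_cancel, Real.exp_zero,
          one_smul, one_smul]
    _ = _ := by simp only [map_smul]

theorem exists_hasDerivAt_clm [CompleteSpace F] (hA : Continuous A) (t₀ : ℝ) (x₀ : F) :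
    ∃ x : ℝ → F, x t₀ = x₀ ∧ ∀ t, HasDerivAt x (A t (x t)) t := by
  obtain ⟨x, hxc, hx⟩ := exists_eq_add_integral_clm hA t₀ x₀
  refine ⟨x, by simp [hx t₀], fun t => ?_⟩
  rw [show x = fun t => x₀ + ∫ τ in t₀..t, A τ (x τ) from funext hx]
  exact (((hA.clm_apply hxc).integral_hasStrictDerivAt t₀ t).hasDerivAt.const_add x₀).congr_deriv
    (congrArg (A t) (hx t))

end Existence

/-- `(y, y₁)` solves `y'' + q y = 0` on the line, written as the first-order system `y' = y₁`,
`y₁' = -q y`. -/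
structure SolvesODE (q y y₁ : ℝ → ℂ) : Prop where
  deriv_fst : ∀ t, HasDerivAt y (y₁ t) t
  deriv_snd : ∀ t, HasDerivAt y₁ (-(q t * y t)) t

namespace SolvesODE

variable {q y y₁ w w₁ : ℝ → ℂ}

theorem exists_of_continuous (hq : Continuous q) (t₀ : ℝ) (α β : ℂ) :
    ∃ y y₁ : ℝ → ℂ, SolvesODE q y y₁ ∧ y t₀ = α ∧ y₁ t₀ = β := by
  let A : ℝ → ℂ × ℂ →L[ℝ] ℂ × ℂ := fun t =>
    (ContinuousLinearMap.inl ℝ ℂ ℂ).comp (ContinuousLinearMap.snd ℝ ℂ ℂ) -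
      (ContinuousLinearMap.inr ℝ ℂ ℂ).comp
        ((ContinuousLinearMap.mul ℝ ℂ (q t)).comp (ContinuousLinearMap.fst ℝ ℂ ℂ))
  have hA : Continuous A := by fun_prop
  obtain ⟨x, hx₀, hx⟩ := exists_hasDerivAt_clm hA t₀ (α, β)
  refine ⟨fun t => (x t).1, fun t => (x t).2, ⟨fun t => ?_, fun t => ?_⟩, by simp [hx₀],
    by simp [hx₀]⟩
  · exact ((ContinuousLinearMap.fst ℝ ℂ ℂ).hasFDerivAt.comp_hasDerivAt t (hx t)).congr_deriv
      (by simp [A])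
  · exact ((ContinuousLinearMap.snd ℝ ℂ ℂ).hasFDerivAt.comp_hasDerivAt t (hx t)).congr_deriv
      (by simp [A])

theorem continuous_fst (h : SolvesODE q y y₁) : Continuous y :=
  continuous_iff_continuousAt.2 fun t => (h.deriv_fst t).continuousAt

theorem continuous_snd (h : SolvesODE q y y₁) : Continuous y₁ :=
  continuous_iff_continuousAt.2 fun t => (h.deriv_snd t).continuousAt

theorem const_mul (h : SolvesODE q y y₁) (c : ℂ) :
    SolvesODE q (fun t => c * y t) (fun t => c * y₁ t) :=
  ⟨fun t => (h.deriv_fst t).const_mul c,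
    fun t => ((h.deriv_snd t).const_mul c).congr_deriv (by ring)⟩

theorem add (h : SolvesODE q y y₁) (h' : SolvesODE q w w₁) :
    SolvesODE q (fun t => y t + w t) (fun t => y₁ t + w₁ t) :=
  ⟨fun t => (h.deriv_fst t).add (h'.deriv_fst t),
    fun t => ((h.deriv_snd t).add (h'.deriv_snd t)).congr_deriv (by ring)⟩

theorem wronskian_const (h : SolvesODE q y y₁) (h' : SolvesODE q w w₁) (s t : ℝ) :
    y s * w₁ s - y₁ s * w s = y t * w₁ t - y₁ t * w t := by
  have hd : ∀ t, HasDerivAt (fun t => y t * w₁ t - y₁ t * w t) 0 t := fun t =>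
    (((h.deriv_fst t).mul (h'.deriv_snd t)).sub
      ((h.deriv_snd t).mul (h'.deriv_fst t))).congr_deriv (by ring)
  exact is_const_of_deriv_eq_zero (fun t => (hd t).differentiableAt) (fun t => (hd t).deriv) s t

end SolvesODE

theorem gronwallBound_le {M K G x : ℝ} (hK : 1 ≤ K) (hG : 0 ≤ G) (hx : 0 ≤ x) :
    gronwallBound M K G x ≤ (M + G) * Real.exp (K * x) := by
  simp only [gronwallBound_of_K_ne_0 (by positivity : K ≠ 0), add_mul]
  gcongr
  · exact sub_nonneg.2 (Real.one_le_exp (by positivity))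
  · exact div_le_self hG hK
  · linarith

theorem norm_le_of_cauchyData {y y₁ q g : ℝ → ℂ} {a b K M G : ℝ}
    (hy : ∀ t, HasDerivAt y (y₁ t) t) (hy₁ : ∀ t, HasDerivAt y₁ (-(q t * y t) + g t) t)
    (hK : 1 ≤ K) (hq : ∀ t ∈ Icc a b, ‖q t‖ ≤ K) (hg : ∀ t ∈ Icc a b, ‖g t‖ ≤ G)
    (h0 : ‖y a‖ ≤ M) (h1 : ‖y₁ a‖ ≤ M) {t : ℝ} (ht : t ∈ Icc a b) :
    ‖y t‖ ≤ (M + G) * Real.exp (K * (b - a)) ∧ ‖y₁ t‖ ≤ (M + G) * Real.exp (K * (b - a)) := by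
  have hG : 0 ≤ G := (norm_nonneg _).trans (hg t ht)
  have hM : 0 ≤ M := (norm_nonneg _).trans h0
  have hd : ∀ t, HasDerivAt (fun t => (y t, y₁ t)) (y₁ t, -(q t * y t) + g t) t := fun t =>
    (hy t).prodMk (hy₁ t)
  have hderiv : ∀ t ∈ Ico a b, ‖(y₁ t, -(q t * y t) + g t)‖ ≤ K * ‖(y t, y₁ t)‖ + G := by
    intro t ht
    have hy_le : ‖y t‖ ≤ ‖(y t, y₁ t)‖ := le_max_left _ _
    have hy₁_le : ‖y₁ t‖ ≤ ‖(y t, y₁ t)‖ := le_max_right _ _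
    refine max_le (by nlinarith [norm_nonneg (y t, y₁ t)])
      ((norm_add_le _ _).trans (add_le_add ?_ (hg t (Ico_subset_Icc_self ht))))
    rw [norm_neg, norm_mul]
    exact mul_le_mul (hq t (Ico_subset_Icc_self ht)) hy_le (norm_nonneg _) (by linarith)
  have hpair : ‖(y t, y₁ t)‖ ≤ (M + G) * Real.exp (K * (b - a)) :=
    calc ‖(y t, y₁ t)‖
        ≤ gronwallBound M K G (t - a) :=
          norm_le_gronwallBound_of_norm_deriv_right_le
            (fun t _ => (hd t).continuousAt.continuousWithinAt) (fun t _ => (hd t).hasDerivWithinAt)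
            (max_le h0 h1) hderiv t ht
      _ ≤ (M + G) * Real.exp (K * (t - a)) := gronwallBound_le hK hG (sub_nonneg.2 ht.1)
      _ ≤ (M + G) * Real.exp (K * (b - a)) := by gcongr; exact ht.2
  exact max_le_iff.1 hpair

theorem hasDerivAt_im_deriv_mul_conj {y y₁ : ℝ → ℂ} {q : ℂ} {t : ℝ} (hy : HasDerivAt y (y₁ t) t)
    (hy₁ : HasDerivAt y₁ (-(q * y t)) t) :
    HasDerivAt (fun s => (y₁ s * (starRingEnd ℂ) (y s)).im) (-q.im * Complex.normSq (y t)) t := by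
  have hconj : HasDerivAt (fun s => (starRingEnd ℂ) (y s)) ((starRingEnd ℂ) (y₁ t)) t :=
    Complex.conjCLE.toContinuousLinearMap.hasFDerivAt.comp_hasDerivAt t hy
  refine (Complex.imCLM.hasFDerivAt.comp_hasDerivAt t (hy₁.mul hconj)).congr_deriv ?_
  simp only [Complex.imCLM_apply, Complex.add_im, Complex.mul_im, Complex.mul_re, Complex.neg_re,
    Complex.neg_im, Complex.conj_re, Complex.conj_im, Complex.normSq_apply]
  ring

theorem eqOn_zero_of_im_deriv_mul_conj_eq {y y₁ q : ℝ → ℂ} {a b c : ℝ} (hc : c ≠ 0) (hab : a < b)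
    (hyc : ContinuousOn y (Icc a b)) (hy₁c : ContinuousOn y₁ (Icc a b))
    (hy : ∀ t ∈ Ioo a b, HasDerivAt y (y₁ t) t)
    (hy₁ : ∀ t ∈ Ioo a b, HasDerivAt y₁ (-(q t * y t)) t) (hq : ∀ t ∈ Ioo a b, (q t).im = c)
    (hflux : (y₁ a * (starRingEnd ℂ) (y a)).im = (y₁ b * (starRingEnd ℂ) (y b)).im) :
    EqOn y 0 (Icc a b) := by
  have hcont : ContinuousOn (fun s => (y₁ s * (starRingEnd ℂ) (y s)).im) (Icc a b) :=
    Complex.continuous_im.comp_continuousOn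
      (hy₁c.mul (Complex.continuous_conj.comp_continuousOn hyc))
  have hsq : ContinuousOn (fun s => Complex.normSq (y s)) (Icc a b) :=
    Complex.continuous_normSq.comp_continuousOn hyc
  have hint : IntervalIntegrable (fun t => -c * Complex.normSq (y t)) volume a b :=
    ContinuousOn.intervalIntegrable (by rw [uIcc_of_le hab.le]; exact continuousOn_const.mul hsq)
  have hzero : -c * ∫ t in a..b, Complex.normSq (y t) = 0 := by
    rw [← intervalIntegral.integral_const_mul,
      intervalIntegral.integral_eq_sub_of_hasDeriv_right_of_le hab.le hcont (fun t ht =>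
        (hq t ht ▸ hasDerivAt_im_deriv_mul_conj (hy t ht) (hy₁ t ht)).hasDerivWithinAt) hint,
      ← hflux, sub_self]
  by_contra hcon
  obtain ⟨t, ht, hne⟩ : ∃ t ∈ Icc a b, y t ≠ 0 := by
    simpa only [EqOn, not_forall, exists_prop, Pi.zero_apply] using hcon
  have hpos := intervalIntegral.integral_pos hab hsq (fun x _ => Complex.normSq_nonneg _)
    ⟨t, ht, Complex.normSq_pos.2 hne⟩
  exact mul_ne_zero (neg_ne_zero.2 hc) hpos.ne' hzero

theorem SolvesODE.im_deriv_mul_conj_antitone {q y y₁ : ℝ → ℂ} (h : SolvesODE q y y₁) {σ : ℝ}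
    (hq : ∀ t, 0 ≤ σ * (q t).im) :
    Antitone fun t => σ * (y₁ t * (starRingEnd ℂ) (y t)).im := by
  have hd := fun t =>
    (hasDerivAt_im_deriv_mul_conj (h.deriv_fst t) (h.deriv_snd t)).const_mul σ
  refine antitone_of_deriv_nonpos (fun t => (hd t).differentiableAt) fun t => ?_
  rw [(hd t).deriv, neg_mul, mul_neg, ← mul_assoc, neg_nonpos]
  exact mul_nonneg (hq t) (Complex.normSq_nonneg _)

/-! ### Primitives of integrable functions and weak derivatives on the line -/

theorem absolutelyContinuousOnInterval_congr {X : Type*} [PseudoMetricSpace X] {f g : ℝ → X}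
    {a b : ℝ} (hf : AbsolutelyContinuousOnInterval f a b) (hfg : EqOn f g (uIcc a b)) :
    AbsolutelyContinuousOnInterval g a b := by
  rw [absolutelyContinuousOnInterval_iff] at hf ⊢
  intro ε hε
  obtain ⟨δ, hδ, hsmall⟩ := hf ε hε
  refine ⟨δ, hδ, fun F hF hlen => ?_⟩
  convert hsmall F hF hlen using 1
  exact Finset.sum_congr rfl fun i hi => by rw [hfg (hF.1 i hi).1, hfg (hF.1 i hi).2]

theorem absolutelyContinuousOnInterval_integral {a b : ℝ} {h : ℝ → ℂ}
    (hh : IntervalIntegrable h volume a b) :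
    AbsolutelyContinuousOnInterval (fun s => ∫ t in a..s, h t) a b := by
  have hre : IntervalIntegrable (fun t => (h t).re) volume a b := ⟨hh.1.re, hh.2.re⟩
  have him : IntervalIntegrable (fun t => (h t).im) volume a b := ⟨hh.1.im, hh.2.im⟩
  have hconst : ∀ c : ℂ, AbsolutelyContinuousOnInterval (fun _ => c) a b := fun c =>
    (LipschitzWith.const c).lipschitzOnWith.absolutelyContinuousOnInterval
  have hsum := ((hre.absolutelyContinuousOnInterval_intervalIntegral left_mem_uIcc).smul
    (hconst 1)).add ((him.absolutelyContinuousOnInterval_intervalIntegral left_mem_uIcc).smul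
    (hconst Complex.I))
  refine absolutelyContinuousOnInterval_congr hsum fun s hs => ?_
  have hhs : IntervalIntegrable h volume a s := hh.mono_set (uIcc_subset_uIcc_left hs)
  refine Complex.ext ?_ ?_
  · simpa using (Complex.reCLM.intervalIntegral_comp_comm hhs)
  · simpa using (Complex.imCLM.intervalIntegral_comp_comm hhs)

/-- `H` is a primitive on `[a, b]` of the integrable function `h`; equivalently, `H` is absolutely
continuous there with derivative `h` almost everywhere. -/
structure IsPrimitiveOn (a b : ℝ) (H h : ℝ → ℂ) : Prop where
  integrable : IntervalIntegrable h volume a b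
  eq_add_integral : ∀ s ∈ Icc a b, H s = H a + ∫ t in a..s, h t

theorem isPrimitiveOn_of_ae_hasDerivAt {a b : ℝ} (hab : a ≤ b) {H h : ℝ → ℂ}
    (hH : AbsolutelyContinuousOnInterval H a b) (hh : IntervalIntegrable h volume a b)
    (hderiv : ∀ᵐ s, s ∈ uIcc a b → HasDerivAt H (h s) s) : IsPrimitiveOn a b H h := by
  refine ⟨hh, fun s hs => ?_⟩
  obtain ⟨c, hc⟩ := (hH.sub
    (absolutelyContinuousOnInterval_integral hh)).const_of_ae_hasDerivAt_zero (by
      filter_upwards [hderiv, hh.ae_hasDerivAt_integral] with t hHt hht ht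
      simpa using! (hHt ht).sub (hht ht a left_mem_uIcc))
  have hs' := hc s (by rwa [uIcc_of_le hab])
  have ha := hc a left_mem_uIcc
  simp only [Pi.sub_apply, intervalIntegral.integral_same, sub_zero] at hs' ha
  rw [ha, ← hs', sub_add_cancel]

namespace IsPrimitiveOn

variable {a b : ℝ} {H h G g : ℝ → ℂ}

theorem mono (hH : IsPrimitiveOn a b H h) {s : ℝ} (hs : s ∈ Icc a b) : IsPrimitiveOn a s H h :=
  ⟨hH.integrable.mono_set (by
    rw [uIcc_of_le hs.1, uIcc_of_le (hs.1.trans hs.2)]; exact Icc_subset_Icc_right hs.2),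
    fun t ht => hH.eq_add_integral t ⟨ht.1, ht.2.trans hs.2⟩⟩

theorem continuousOn (hH : IsPrimitiveOn a b H h) : ContinuousOn H (Icc a b) := by
  rcases lt_or_ge b a with hab | hab
  · simp [Icc_eq_empty_of_lt hab]
  · have hcont := (absolutelyContinuousOnInterval_integral hH.integrable).continuousOn
    rw [uIcc_of_le hab] at hcont
    exact (continuousOn_const.add hcont).congr hH.eq_add_integral

theorem congr (hH : IsPrimitiveOn a b H h) (hab : a ≤ b) (hHG : EqOn G H (Icc a b))
    (hhg : g =ᵐ[volume.restrict (Ioo a b)] h) : IsPrimitiveOn a b G g := by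
  have hIoc : g =ᵐ[volume.restrict (Ioc a b)] h := by
    rwa [← Measure.restrict_congr_set Ioo_ae_eq_Ioc]
  refine ⟨hH.integrable.congr_ae (by rw [uIoc_of_le hab]; exact hIoc.symm), fun s hs => ?_⟩
  rw [hHG hs, hHG (left_mem_Icc.2 hab), hH.eq_add_integral s hs]
  congr 1
  refine intervalIntegral.integral_congr_ae_restrict ?_
  rw [uIoc_of_le hs.1]
  exact Filter.EventuallyEq.symm
    (ae_restrict_of_ae_restrict_of_subset (Ioc_subset_Ioc_right hs.2) hIoc)

theorem add (hH : IsPrimitiveOn a b H h) (hG : IsPrimitiveOn a b G g) :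
    IsPrimitiveOn a b (fun t => H t + G t) fun t => h t + g t :=
  ⟨hH.integrable.add hG.integrable, fun s hs => by
    rw [intervalIntegral.integral_add (hH.mono hs).integrable (hG.mono hs).integrable,
      hH.eq_add_integral s hs, hG.eq_add_integral s hs]
    ring⟩

theorem const_mul (hH : IsPrimitiveOn a b H h) (c : ℂ) :
    IsPrimitiveOn a b (fun t => c * H t) fun t => c * h t :=
  ⟨hH.integrable.const_mul c, fun s hs => by
    rw [intervalIntegral.integral_const_mul, hH.eq_add_integral s hs, mul_add]⟩

theorem sub (hH : IsPrimitiveOn a b H h) (hG : IsPrimitiveOn a b G g) :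
    IsPrimitiveOn a b (fun t => H t - G t) fun t => h t - g t := by
  simpa only [neg_one_mul, ← sub_eq_add_neg] using hH.add (hG.const_mul (-1))

theorem of_integrable (hg : IntervalIntegrable g volume a b) :
    IsPrimitiveOn a b (fun s => ∫ t in a..s, g t) g :=
  ⟨hg, fun s _ => by simp⟩

theorem of_integrable_right (hg : IntervalIntegrable g volume a b) :
    IsPrimitiveOn a b (fun s => ∫ t in s..b, g t) fun t => -g t :=
  ⟨hg.neg, fun s hs => by
    have hs' : s ∈ uIcc a b := Icc_subset_uIcc hs
    rw [intervalIntegral.integral_neg, ← intervalIntegral.integral_add_adjacent_intervals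
      (hg.mono_set (uIcc_subset_uIcc_left hs')) (hg.mono_set (uIcc_subset_uIcc_right hs')),
      add_neg_cancel_comm]⟩

theorem of_hasDerivAt (hG : ∀ t, HasDerivAt G (g t) t) (hg : Continuous g) :
    IsPrimitiveOn a b G g :=
  ⟨hg.intervalIntegrable _ _, fun s _ => by
    rw [intervalIntegral.integral_eq_sub_of_hasDerivAt (fun t _ => hG t)
      (hg.intervalIntegrable a s), add_sub_cancel]⟩

theorem mul (hab : a ≤ b) (hH : IsPrimitiveOn a b H h) (hG : IsPrimitiveOn a b G g) :
    IsPrimitiveOn a b (fun t => H t * G t) fun t => h t * G t + H t * g t := by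
  have hac : ∀ {F f}, IsPrimitiveOn a b F f →
      AbsolutelyContinuousOnInterval ((fun _ => F a) + fun s => ∫ t in a..s, f t) a b :=
    fun hF => (LipschitzWith.const _).lipschitzOnWith.absolutelyContinuousOnInterval.add
      (absolutelyContinuousOnInterval_integral hF.integrable)
  have hprod := isPrimitiveOn_of_ae_hasDerivAt hab ((hac hH).smul (hac hG))
    (h := fun t => h t * (G a + ∫ r in a..t, g r) + (H a + ∫ r in a..t, h r) * g t)
    ((hH.integrable.mul_continuousOn (hac hG).continuousOn).add
      (hG.integrable.continuousOn_mul (hac hH).continuousOn)) (by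
      filter_upwards [hH.integrable.ae_hasDerivAt_integral, hG.integrable.ae_hasDerivAt_integral]
        with t hHt hGt ht
      exact ((hHt ht a left_mem_uIcc).const_add (H a)).mul
        ((hGt ht a left_mem_uIcc).const_add (G a)))
  refine hprod.congr hab (fun t ht => ?_) ?_
  · simp [hH.eq_add_integral t ht, hG.eq_add_integral t ht]
  · filter_upwards [ae_restrict_mem measurableSet_Ioo] with t ht
    rw [hH.eq_add_integral t (Ioo_subset_Icc_self ht),
      hG.eq_add_integral t (Ioo_subset_Icc_self ht)]

theorem hasDerivAt (hH : IsPrimitiveOn a b H h) (hh : ContinuousOn h (Icc a b)) {t : ℝ}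
    (ht : t ∈ Ioo a b) : HasDerivAt H (h t) t := by
  have hI : Icc a b ∈ 𝓝 t := Icc_mem_nhds ht.1 ht.2
  refine ((intervalIntegral.integral_hasDerivAt_right
    (hH.mono (Ioo_subset_Icc_self ht)).integrable
    (hh.stronglyMeasurableAtFilter_nhdsWithin measurableSet_Icc t |>.filter_mono
      (by rw [nhdsWithin_eq_nhds.2 hI]))
    (hh.continuousAt hI)).const_add (H a)).congr_of_eventuallyEq ?_
  filter_upwards [hI] with s hs using hH.eq_add_integral s hs

end IsPrimitiveOn

/-- `F'` is the weak derivative of `F` on `I ⊆ ℝ`: the one-dimensional counterpart of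
`HasWeakDeriv`, without its integrability requirements. -/
def HasWeakDerivLine (I : Set ℝ) (F F' : ℝ → ℂ) : Prop :=
  ∀ φ : ℝ → ℝ, ContDiff ℝ ∞ φ → HasCompactSupport φ → tsupport φ ⊆ I →
    ∫ t in I, deriv φ t • F t = - ∫ t in I, φ t • F' t

namespace IsPrimitiveOn

variable {a b : ℝ} {H h : ℝ → ℂ}

theorem integral_deriv_smul (hab : a ≤ b) (hH : IsPrimitiveOn a b H h) {φ : ℝ → ℝ}
    (hφ : ContDiff ℝ 1 φ) (ha : φ a = 0) (hb : φ b = 0) :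
    ∫ t in Ioo a b, deriv φ t • H t = - ∫ t in Ioo a b, φ t • h t := by
  have : Continuous (deriv φ) := hφ.continuous_deriv le_rfl
  have hφp : IsPrimitiveOn a b (fun t => (φ t : ℂ)) fun t => ((deriv φ t : ℝ) : ℂ) :=
    of_hasDerivAt (fun t => ((hφ.differentiable one_ne_zero) t).hasDerivAt.ofReal_comp)
      (by fun_prop)
  have hparts := (hφp.mul hab hH).eq_add_integral b (right_mem_Icc.2 hab)
  rw [intervalIntegral.integral_add
    (hφp.integrable.mul_continuousOn (by rw [uIcc_of_le hab]; exact hH.continuousOn))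
    (hH.integrable.continuousOn_mul (by rw [uIcc_of_le hab]; exact hφp.continuousOn))] at hparts
  simp only [ha, hb, Complex.ofReal_zero, zero_mul, zero_add] at hparts
  simp only [Complex.real_smul, ← integral_Ioc_eq_integral_Ioo,
    ← intervalIntegral.integral_of_le hab]
  linear_combination -hparts

theorem hasWeakDerivLine (hab : a ≤ b) (hH : IsPrimitiveOn a b H h) :
    HasWeakDerivLine (Ioo a b) H h := fun _ hφ _ hs =>
  hH.integral_deriv_smul hab (hφ.of_le (by norm_num))
    (image_eq_zero_of_notMem_tsupport fun h => left_notMem_Ioo (hs h))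
    (image_eq_zero_of_notMem_tsupport fun h => right_notMem_Ioo (hs h))

end IsPrimitiveOn

theorem hasWeakDerivLine_Ioi {a : ℝ} {H h : ℝ → ℂ} (hH : ∀ b, a ≤ b → IsPrimitiveOn a b H h) :
    HasWeakDerivLine (Ioi a) H h := by
  intro φ hφ hc hs
  obtain ⟨b, hab, hb⟩ : ∃ b, a ≤ b ∧ tsupport φ ⊆ Iio b := by
    obtain ⟨B, hB⟩ := hc.isCompact.bddAbove
    exact ⟨max a (B + 1), le_max_left _ _, fun t ht =>
      (hB ht).trans_lt ((lt_add_one B).trans_le (le_max_right _ _))⟩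
  have hreduce : ∀ {g : ℝ → ℂ}, (∀ t ∉ tsupport φ, g t = 0) →
      ∫ t in Ioi a, g t = ∫ t in Ioo a b, g t := fun hg =>
    setIntegral_eq_of_subset_of_forall_sdiff_eq_zero measurableSet_Ioi (fun t ht => ht.1)
      fun t ht => hg t fun hmem => ht.2 ⟨hs hmem, hb hmem⟩
  rw [hreduce fun t ht => by rw [image_eq_zero_of_notMem_tsupport
      fun h => ht (tsupport_deriv_subset h), zero_smul],
    hreduce fun t ht => by rw [image_eq_zero_of_notMem_tsupport ht, zero_smul]]
  exact (hH b hab).hasWeakDerivLine hab φ hφ hc fun t ht => ⟨hs ht, hb ht⟩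

/-! ### The resolvent kernel of the Neumann operator -/

theorem memLp_Ioo_of_continuousOn {a b : ℝ} {h : ℝ → ℂ} (hh : ContinuousOn h (Icc a b))
    (p : ℝ≥0∞) : MemLp h p (volume.restrict (Ioo a b)) := by
  obtain ⟨C, hC⟩ := isCompact_Icc.exists_bound_of_continuousOn hh
  refine MemLp.of_bound ((hh.mono Ioo_subset_Icc_self).aestronglyMeasurable measurableSet_Ioo) C ?_
  filter_upwards [ae_restrict_mem measurableSet_Ioo] with t ht using hC t (Ioo_subset_Icc_self ht)

theorem intervalIntegrable_of_memLp_Ioo {a b : ℝ} (hab : a ≤ b) {h : ℝ → ℂ} {p : ℝ≥0∞}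
    (hp : 1 ≤ p) (hh : MemLp h p (volume.restrict (Ioo a b))) :
    IntervalIntegrable h volume a b := by
  rw [intervalIntegrable_iff_integrableOn_Ioo_of_le hab]
  exact hh.integrable hp

theorem neumannMaps_iff {γ : ℝ → ℝ} {y k : ℝ → ℂ} :
    NeumannMaps γ y k ↔ ∃ y₁ y₂ : ℝ → ℂ,
      IsPrimitiveOn (-1) 1 y y₁ ∧ IsPrimitiveOn (-1) 1 y₁ y₂ ∧
      MemLp y₂ 2 (volume.restrict (Ioo (-1) 1)) ∧ y₁ (-1) = 0 ∧ y₁ 1 = 0 ∧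
      ∀ᵐ s ∂(volume.restrict (Ioo (-1) 1)), k s = -y₂ s - ((γ s ^ 2 / 4 : ℝ) : ℂ) * y s := by
  constructor
  · rintro ⟨y₁, y₂, hcont, hmem, hy, hy₁, hleft, hright, hk⟩
    exact ⟨y₁, y₂, ⟨hcont.intervalIntegrable_of_Icc (by norm_num), hy⟩,
      ⟨intervalIntegrable_of_memLp_Ioo (by norm_num) (by norm_num) hmem, hy₁⟩,
      hmem, hleft, hright, hk⟩
  · rintro ⟨y₁, y₂, hy, hy₁, hmem, hleft, hright, hk⟩
    exact ⟨y₁, y₂, hy₁.continuousOn, hmem, hy.eq_add_integral, hy₁.eq_add_integral,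
      hleft, hright, hk⟩

theorem NeumannMaps.sub {γ : ℝ → ℝ} {y k w l : ℝ → ℂ} (h : NeumannMaps γ y k)
    (h' : NeumannMaps γ w l) : NeumannMaps γ (fun s => y s - w s) (fun s => k s - l s) := by
  obtain ⟨y₁, y₂, hy, hy₁, hmem, hleft, hright, hk⟩ := neumannMaps_iff.1 h
  obtain ⟨w₁, w₂, hw, hw₁, hmem', hleft', hright', hl⟩ := neumannMaps_iff.1 h'
  refine neumannMaps_iff.2 ⟨_, _, hy.sub hw, hy₁.sub hw₁, hmem.sub hmem', by simp [hleft, hleft'],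
    by simp [hright, hright'], ?_⟩
  filter_upwards [hk, hl] with s hks hls
  rw [hks, hls]; ring

theorem eqOn_zero_of_forall_integral_mul_eq_zero {a b : ℝ} (hab : a < b) {d : ℝ → ℂ}
    (hd : ContinuousOn d (Icc a b))
    (h : ∀ f, MemLp f 2 (volume.restrict (Ioo a b)) → ∫ t in Ioo a b, d t * f t = 0) :
    EqOn d 0 (Icc a b) := by
  have hconj := h (fun t => (starRingEnd ℂ) (d t))
    (memLp_Ioo_of_continuousOn (Complex.continuous_conj.comp_continuousOn hd) 2)
  have hnorm : ∫ t in a..b, Complex.normSq (d t) = 0 := by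
    rw [intervalIntegral.integral_of_le hab.le, integral_Ioc_eq_integral_Ioo]
    simp only [Complex.mul_conj] at hconj
    rw [integral_complex_ofReal] at hconj
    exact_mod_cast hconj
  intro s hs
  by_contra hds
  exact (intervalIntegral.integral_pos hab (Complex.continuous_normSq.comp_continuousOn hd)
    (fun _ _ => Complex.normSq_nonneg _) ⟨s, hs, Complex.normSq_pos.2 hds⟩).ne' hnorm

/-- The coefficient `q = γ²/4 + w` for which `h_v y = w y` takes the form `y'' = -q y` of
`SolvesODE`. -/
def shiftedPot (γ : ℝ → ℝ) (w : ℂ) (t : ℝ) : ℂ := ((γ t ^ 2 / 4 : ℝ) : ℂ) + w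

/-- Solutions `a` and `b` of `h_v y = w y` with Neumann condition at `-1` and at `1` respectively,
normalized to `1` there; the resolvent kernel is built from them. -/
structure NeumannPair (γ : ℝ → ℝ) (w : ℂ) (a a₁ b b₁ : ℝ → ℂ) : Prop where
  left : SolvesODE (shiftedPot γ w) a a₁
  right : SolvesODE (shiftedPot γ w) b b₁
  left_val : a (-1) = 1
  left_deriv : a₁ (-1) = 0
  right_val : b 1 = 1
  right_deriv : b₁ 1 = 0

/-- The Green function `D⁻¹ a(min) b(max)` of a second-order equation with solutions `a` and `b`;
`D` stands for their Wronskian `a' b - a b'`. -/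
def green (a b : ℝ → ℂ) (D : ℂ) (s s' : ℝ) : ℂ := D⁻¹ * (a (min s s') * b (max s s'))

theorem integral_green_mul {a b f : ℝ → ℂ} (ha : Continuous a) (hb : Continuous b) (D : ℂ)
    {l r s : ℝ} (hf : IntervalIntegrable f volume l r) (hs : s ∈ Icc l r) :
    ∫ s' in Ioo l r, green a b D s s' * f s' =
      b s * (∫ t in l..s, a t * (D⁻¹ * f t)) + a s * ∫ t in s..r, b t * (D⁻¹ * f t) := by
  have hlr : l ≤ r := hs.1.trans hs.2
  have hleft : IntervalIntegrable f volume l s := hf.mono_set (by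
    rw [uIcc_of_le hs.1, uIcc_of_le hlr]; exact Icc_subset_Icc_right hs.2)
  have hright : IntervalIntegrable f volume s r := hf.mono_set (by
    rw [uIcc_of_le hs.2, uIcc_of_le hlr]; exact Icc_subset_Icc_left hs.1)
  have hgreen : Continuous fun s' => green a b D s s' := by unfold green; fun_prop
  rw [← integral_Ioc_eq_integral_Ioo, ← intervalIntegral.integral_of_le hlr,
    ← intervalIntegral.integral_add_adjacent_intervals
      (hleft.continuousOn_mul hgreen.continuousOn) (hright.continuousOn_mul hgreen.continuousOn),
    ← intervalIntegral.integral_const_mul, ← intervalIntegral.integral_const_mul]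
  congr 1
  · refine intervalIntegral.integral_congr fun t ht => ?_
    rw [uIcc_of_le hs.1] at ht
    simp only [green, min_eq_right ht.2, max_eq_left ht.2]; ring
  · refine intervalIntegral.integral_congr fun t ht => ?_
    rw [uIcc_of_le hs.2] at ht
    simp only [green, min_eq_left ht.1, max_eq_right ht.1]; ring

theorem SolvesODE.variation_of_constants {q a a₁ b b₁ f P Q : ℝ → ℂ} {D : ℂ} {l r : ℝ}
    (hq : Continuous q) (hlr : l ≤ r) (ha : SolvesODE q a a₁) (hb : SolvesODE q b b₁)
    (hD : ∀ t, a₁ t * b t - a t * b₁ t = D)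
    (hP : IsPrimitiveOn l r P fun t => a t * f t)
    (hQ : IsPrimitiveOn l r Q fun t => -(b t * f t)) :
    IsPrimitiveOn l r (fun t => b t * P t + a t * Q t) (fun t => b₁ t * P t + a₁ t * Q t) ∧
    IsPrimitiveOn l r (fun t => b₁ t * P t + a₁ t * Q t)
      (fun t => -(q t * (b t * P t + a t * Q t)) - D * f t) := by
  have hfst : ∀ {y y₁}, SolvesODE q y y₁ → IsPrimitiveOn l r y y₁ := fun h =>
    .of_hasDerivAt h.deriv_fst h.continuous_snd
  have hsnd : ∀ {y y₁}, SolvesODE q y y₁ → IsPrimitiveOn l r y₁ fun t => -(q t * y t) := fun h =>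
    .of_hasDerivAt h.deriv_snd (hq.mul h.continuous_fst).neg
  constructor
  · refine (((hfst hb).mul hlr hP).add ((hfst ha).mul hlr hQ)).congr hlr (fun _ _ => rfl)
      (Eventually.of_forall fun t => ?_)
    ring
  · refine (((hsnd hb).mul hlr hP).add ((hsnd ha).mul hlr hQ)).congr hlr (fun _ _ => rfl)
      (Eventually.of_forall fun t => ?_)
    linear_combination f t * hD t

section

variable {γ : ℝ → ℝ} {w : ℂ}

theorem continuous_shiftedPot (hγ : Continuous γ) (w : ℂ) : Continuous (shiftedPot γ w) := by
  unfold shiftedPot; fun_prop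

theorem shiftedPot_im (t : ℝ) : (shiftedPot γ w t).im = w.im := by
  rw [shiftedPot, Complex.add_im, Complex.ofReal_im, zero_add]

theorem exists_neumannPair (hγ : Continuous γ) (w : ℂ) :
    ∃ a a₁ b b₁ : ℝ → ℂ, NeumannPair γ w a a₁ b b₁ := by
  have hq := continuous_shiftedPot hγ w
  obtain ⟨a, a₁, ha, hval, hderiv⟩ := SolvesODE.exists_of_continuous hq (-1) 1 0
  obtain ⟨b, b₁, hb, hval', hderiv'⟩ := SolvesODE.exists_of_continuous hq 1 1 0
  exact ⟨a, a₁, b, b₁, ha, hb, hval, hderiv, hval', hderiv'⟩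

theorem not_isNeumannEigenvalue_of_im_ne_zero (hγ : Continuous γ) (hw : w.im ≠ 0) :
    ¬ IsNeumannEigenvalue γ w := by
  rintro ⟨y, ⟨s, hs, hne⟩, h⟩
  obtain ⟨y₁, y₂, hy, hy₁, -, hleft, hright, heq⟩ := neumannMaps_iff.1 h
  have hode : IsPrimitiveOn (-1) 1 y₁ fun t => -(shiftedPot γ w t * y t) := by
    refine hy₁.congr (by norm_num) (fun _ _ => rfl) ?_
    filter_upwards [heq] with t ht
    rw [shiftedPot, add_mul, ht]; ring
  have hq : ContinuousOn (fun t => -(shiftedPot γ w t * y t)) (Icc (-1) 1) :=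
    ((continuous_shiftedPot hγ w).continuousOn.mul hy.continuousOn).neg
  exact hne (eqOn_zero_of_im_deriv_mul_conj_eq hw (by norm_num) hy.continuousOn hy₁.continuousOn
    (fun t ht => hy.hasDerivAt hy₁.continuousOn ht) (fun t ht => hode.hasDerivAt hq ht)
    (fun t _ => shiftedPot_im t) (by simp [hleft, hright]) hs)

theorem SolvesODE.isNeumannEigenvalue {y y₁ : ℝ → ℂ} (hγ : Continuous γ)
    (hy : SolvesODE (shiftedPot γ w) y y₁) (hleft : y₁ (-1) = 0) (hright : y₁ 1 = 0)
    (hne : y (-1) ≠ 0) : IsNeumannEigenvalue γ w := by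
  have hc : Continuous fun t => -(shiftedPot γ w t * y t) :=
    ((continuous_shiftedPot hγ w).mul hy.continuous_fst).neg
  refine ⟨y, ⟨-1, by norm_num, hne⟩, neumannMaps_iff.2 ⟨y₁, _, .of_hasDerivAt hy.deriv_fst
    hy.continuous_snd, .of_hasDerivAt hy.deriv_snd hc, memLp_Ioo_of_continuousOn hc.continuousOn 2,
    hleft, hright, Eventually.of_forall fun s => ?_⟩⟩
  simp only [shiftedPot]; ring

namespace NeumannPair

variable {a a₁ b b₁ : ℝ → ℂ}

theorem deriv_ne_zero (h : NeumannPair γ w a a₁ b b₁) (hγ : Continuous γ)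
    (hw : ¬ IsNeumannEigenvalue γ w) : a₁ 1 ≠ 0 := fun h0 =>
  hw (h.left.isNeumannEigenvalue hγ h.left_deriv h0 (by simp [h.left_val]))

theorem wronskian (h : NeumannPair γ w a a₁ b b₁) (t : ℝ) : a₁ t * b t - a t * b₁ t = a₁ 1 := by
  have hconst := h.left.wronskian_const h.right t 1
  rw [h.right_val, h.right_deriv] at hconst
  linear_combination -hconst

theorem isResolventKernel (h : NeumannPair γ w a a₁ b b₁) (hγ : Continuous γ)
    (hw : ¬ IsNeumannEigenvalue γ w) : IsResolventKernel γ w (green a b (a₁ 1)) := by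
  have hac := h.left.continuous_fst
  have hbc := h.right.continuous_fst
  refine ⟨by unfold green; exact Continuous.continuousOn (by fun_prop), fun f hf => ?_⟩
  have hfi : IntervalIntegrable f volume (-1) 1 :=
    intervalIntegrable_of_memLp_Ioo (by norm_num) (by norm_num) hf
  have hD : a₁ 1 ≠ 0 := h.deriv_ne_zero hγ hw
  obtain ⟨hy, hy₁⟩ := SolvesODE.variation_of_constants (continuous_shiftedPot hγ w) (by norm_num)
    h.left h.right h.wronskian
    (.of_integrable ((hfi.const_mul (a₁ 1)⁻¹).continuousOn_mul hac.continuousOn))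
    (.of_integrable_right ((hfi.const_mul (a₁ 1)⁻¹).continuousOn_mul hbc.continuousOn))
  have hgreen := fun s hs => integral_green_mul hac hbc (a₁ 1) hfi (s := s) hs
  refine neumannMaps_iff.2 ⟨_, fun t => -(shiftedPot γ w t * _) - f t,
    hy.congr (by norm_num) hgreen (Eventually.of_forall fun _ => rfl),
    hy₁.congr (by norm_num) (fun _ _ => rfl) (Eventually.of_forall fun t => ?_),
    (memLp_Ioo_of_continuousOn
      ((continuous_shiftedPot hγ w).continuousOn.mul hy.continuousOn) 2).neg.sub hf,
    by simp [h.left_deriv], by simp [h.right_deriv], ?_⟩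
  · simp only [mul_inv_cancel_left₀ hD]
  · filter_upwards [ae_restrict_mem measurableSet_Ioo] with s hs
    simp only [hgreen s (Ioo_subset_Icc_self hs), shiftedPot]; ring

end NeumannPair

theorem IsResolventKernel.eq_of_mem_Icc {r r' : ℝ → ℝ → ℂ} (hw : ¬ IsNeumannEigenvalue γ w)
    (hr : IsResolventKernel γ w r) (hr' : IsResolventKernel γ w r') {s s' : ℝ}
    (hs : s ∈ Icc (-1 : ℝ) 1) (hs' : s' ∈ Icc (-1 : ℝ) 1) : r s s' = r' s s' := by
  have hslice : ∀ {r : ℝ → ℝ → ℂ}, IsResolventKernel γ w r → ContinuousOn (r s) (Icc (-1) 1) :=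
    fun h => h.1.comp (f := fun t => (s, t)) (by fun_prop) fun t ht => ⟨hs, ht⟩
  refine sub_eq_zero.1 (eqOn_zero_of_forall_integral_mul_eq_zero (by norm_num)
    ((hslice hr).sub (hslice hr')) (fun f hf => ?_) hs')
  have hint : ∀ {r : ℝ → ℝ → ℂ}, IsResolventKernel γ w r →
      Integrable (fun t => r s t * f t) (volume.restrict (Ioo (-1) 1)) := fun h =>
    (memLp_Ioo_of_continuousOn (hslice h) 2).integrable_mul hf
  have hdiff : NeumannMaps γ
      (fun s => (∫ t in Ioo (-1) 1, r s t * f t) - ∫ t in Ioo (-1) 1, r' s t * f t)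
      (fun s => w * ((∫ t in Ioo (-1) 1, r s t * f t) - ∫ t in Ioo (-1) 1, r' s t * f t)) := by
    convert (hr.2 f hf).sub (hr'.2 f hf) using 2; ring
  simp only [Pi.sub_apply, sub_mul]
  rw [integral_sub (hint hr) (hint hr')]
  by_contra hne
  exact hw ⟨_, ⟨s, hs, hne⟩, hdiff⟩

theorem NeumannPair.rV_eq {a a₁ b b₁ : ℝ → ℂ} (h : NeumannPair γ w a a₁ b b₁) (hγ : Continuous γ)
    (hw : ¬ IsNeumannEigenvalue γ w) {s s' : ℝ} (hs : s ∈ Icc (-1 : ℝ) 1)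
    (hs' : s' ∈ Icc (-1 : ℝ) 1) : rV γ w s s' = green a b (a₁ 1) s s' := by
  have hex : ∃ r, IsResolventKernel γ w r := ⟨_, h.isResolventKernel hγ hw⟩
  rw [rV, dif_pos hex]
  exact hex.choose_spec.eq_of_mem_Icc hw (h.isResolventKernel hγ hw) hs hs'

theorem exists_solvesODE_rV (hγ : Continuous γ) (hw : ¬ IsNeumannEigenvalue γ w) (ξ₁ ξ₂ : ℂ) :
    ∃ y y₁ : ℝ → ℂ, SolvesODE (shiftedPot γ w) y y₁ ∧
      (∀ s ∈ Icc (-1 : ℝ) 1, y s = ξ₁ * rV γ w s (-1) + ξ₂ * rV γ w s 1) ∧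
      y₁ (-1) = -ξ₁ ∧ y₁ 1 = ξ₂ := by
  obtain ⟨a, a₁, b, b₁, h⟩ := exists_neumannPair hγ w
  have hD : a₁ 1 ≠ 0 := h.deriv_ne_zero hγ hw
  refine ⟨_, _, (h.right.const_mul (ξ₁ * (a₁ 1)⁻¹)).add (h.left.const_mul (ξ₂ * (a₁ 1)⁻¹)),
    fun s hs => ?_, ?_, ?_⟩
  · rw [h.rV_eq hγ hw hs (by norm_num), h.rV_eq hγ hw hs (by norm_num), green, green,
      min_eq_right hs.1, max_eq_left hs.1, min_eq_left hs.2, max_eq_right hs.2, h.left_val,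
      h.right_val]
    ring
  · have hb₁ : b₁ (-1) = -a₁ 1 := by
      have hW := h.wronskian (-1)
      rw [h.left_val, h.left_deriv] at hW
      linear_combination -hW
    rw [h.left_deriv, hb₁]; field_simp; ring
  · rw [h.right_deriv]; field_simp; ring

end

/-! ### The resolvent of the Dirichlet Laplacian on the half-line -/

theorem sq_lintegral_mul_le {α : Type*} [MeasurableSpace α] {ν : Measure α} {k g : α → ℝ≥0∞}
    (hk : AEMeasurable k ν) (hg : AEMeasurable g ν) :
    (∫⁻ x, k x * g x ∂ν) ^ 2 ≤ (∫⁻ x, k x ∂ν) * ∫⁻ x, k x * g x ^ 2 ∂ν := by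
  have hsqrt : ∀ c : ℝ≥0∞, (c ^ (1 / 2 : ℝ)) ^ 2 = c := fun c => by
    rw [← ENNReal.rpow_natCast, ← ENNReal.rpow_mul]; norm_num
  have hholder := ENNReal.lintegral_mul_le_Lp_mul_Lq ν Real.HolderConjugate.two_two
    (hk.pow_const (1 / 2 : ℝ)) ((hk.pow_const (1 / 2 : ℝ)).mul hg)
  simp only [Pi.mul_apply, ← mul_assoc, ← sq, ENNReal.rpow_two, mul_pow] at hholder
  simp only [hsqrt] at hholder
  exact (pow_le_pow_left' hholder 2).trans_eq (by rw [mul_pow, hsqrt, hsqrt])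

theorem eLpNorm_two_sq {α : Type*} [MeasurableSpace α] (ν : Measure α) (f : α → ℂ) :
    eLpNorm f 2 ν ^ 2 = ∫⁻ x, ‖f x‖ₑ ^ 2 ∂ν := by
  simpa using eLpNorm_nnreal_pow_eq_lintegral (f := f) (μ := ν) (p := 2) (by norm_num)

-- Schur's test
theorem lintegral_sq_lintegral_mul_le {α β : Type*} [MeasurableSpace α] [MeasurableSpace β]
    {μ : Measure α} {ν : Measure β} [SFinite μ] [SFinite ν] {k : α → β → ℝ≥0∞} {g : β → ℝ≥0∞}
    {C : ℝ≥0∞} (hC : C ≠ ⊤) (hk : Measurable fun p : α × β => k p.1 p.2) (hg : AEMeasurable g ν)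
    (hrow : ∀ s, ∫⁻ t, k s t ∂ν ≤ C) (hcol : ∀ t, ∫⁻ s, k s t ∂μ ≤ C) :
    ∫⁻ s, (∫⁻ t, k s t * g t ∂ν) ^ 2 ∂μ ≤ C * (C * ∫⁻ t, g t ^ 2 ∂ν) := by
  have hks : ∀ s, Measurable (k s) := fun s => hk.comp measurable_prodMk_left
  have hkt : ∀ t, Measurable fun s => k s t := fun t => hk.comp measurable_prodMk_right
  calc ∫⁻ s, (∫⁻ t, k s t * g t ∂ν) ^ 2 ∂μ
      ≤ ∫⁻ s, C * ∫⁻ t, k s t * g t ^ 2 ∂ν ∂μ := by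
        gcongr with s
        exact (sq_lintegral_mul_le (hks s).aemeasurable hg).trans (by gcongr; exact hrow s)
    _ = C * ∫⁻ t, (∫⁻ s, k s t ∂μ) * g t ^ 2 ∂ν := by
        rw [lintegral_const_mul' _ _ hC, lintegral_lintegral_swap
          (hk.aemeasurable.mul ((hg.comp_snd).pow_const 2))]
        simp only [lintegral_mul_const _ (hkt _)]
    _ ≤ C * ∫⁻ t, C * g t ^ 2 ∂ν := by
        gcongr with t
        exact hcol t
    _ = C * (C * ∫⁻ t, g t ^ 2 ∂ν) := by rw [lintegral_const_mul' _ _ hC]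

theorem lintegral_exp_neg_mul_abs_ne_top {μ : ℝ} (hμ : 0 < μ) :
    ∫⁻ x : ℝ, ENNReal.ofReal (Real.exp (-(μ * |x|))) ≠ ⊤ := by
  have hpos : IntegrableOn (fun x : ℝ => Real.exp (-(μ * |x|))) (Ioi 0) := by
    refine (integrableOn_exp_mul_Ioi (neg_lt_zero.2 hμ) 0).congr_fun (fun x hx => ?_)
      measurableSet_Ioi
    simp only [abs_of_pos (mem_Ioi.1 hx), neg_mul]
  have hneg : IntegrableOn (fun x : ℝ => Real.exp (-(μ * |x|))) (Iic 0) := by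
    refine (integrableOn_exp_mul_Iic hμ 0).congr_fun (fun x hx => ?_) measurableSet_Iic
    simp only [abs_of_nonpos (mem_Iic.1 hx), mul_neg, neg_neg]
  have hint := hneg.union hpos
  rw [Iic_union_Ioi, integrableOn_univ] at hint
  exact hint.lintegral_lt_top.ne

theorem memLp_of_enorm_le_convolution {μ : ℝ} (hμ : 0 < μ) {I : Set ℝ} {f h : ℝ → ℂ}
    (hI : MeasurableSet I) (hf : MemLp f 2 (volume.restrict I))
    (hh : AEStronglyMeasurable h (volume.restrict I))
    (hb : ∀ s ∈ I, ‖h s‖ₑ ≤ ∫⁻ t in I, ENNReal.ofReal (Real.exp (-(μ * |s - t|))) * ‖f t‖ₑ) :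
    MemLp h 2 (volume.restrict I) := by
  have hf2 : ∫⁻ t in I, ‖f t‖ₑ ^ 2 < ⊤ := by
    rw [← eLpNorm_two_sq]; exact ENNReal.pow_lt_top hf.2
  have hC := lintegral_exp_neg_mul_abs_ne_top hμ
  refine ⟨hh, (ENNReal.pow_lt_top_iff.1 ?_).resolve_right two_ne_zero⟩
  rw [eLpNorm_two_sq]
  refine (setLIntegral_mono' hI fun s hs => pow_le_pow_left' (hb s hs) 2).trans_lt
    ((lintegral_sq_lintegral_mul_le hC (by fun_prop) hf.1.enorm (fun s => ?_)
      fun t => ?_).trans_lt (ENNReal.mul_lt_top hC.lt_top (ENNReal.mul_lt_top hC.lt_top hf2)))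
  · exact (setLIntegral_le_lintegral I _).trans_eq
      (lintegral_sub_left_eq_self (fun x => ENNReal.ofReal (Real.exp (-(μ * |x|)))) s)
  · exact (setLIntegral_le_lintegral I _).trans_eq
      (lintegral_sub_right_eq_self (fun x => ENNReal.ofReal (Real.exp (-(μ * |x|)))) t)

/-- The outgoing exponential `exp (i κ s)`, square integrable on `(0, ∞)` when `Im κ > 0`. -/
def expI (κ : ℂ) (s : ℝ) : ℂ := Complex.exp (Complex.I * κ * (s : ℂ))

theorem hasDerivAt_expI (κ : ℂ) (s : ℝ) :
    HasDerivAt (expI κ) (Complex.I * κ * expI κ s) s := by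
  have hlin : HasDerivAt (fun t : ℝ => Complex.I * κ * (t : ℂ)) (Complex.I * κ * 1) s :=
    (Complex.ofRealCLM.hasDerivAt (x := s)).const_mul (Complex.I * κ)
  exact hlin.cexp.congr_deriv (by rw [expI]; ring)

theorem continuous_expI (κ : ℂ) : Continuous (expI κ) := by
  unfold expI; fun_prop

theorem expI_zero (κ : ℂ) : expI κ 0 = 1 := by simp [expI]

theorem norm_expI (κ : ℂ) (s : ℝ) : ‖expI κ s‖ = Real.exp (-(κ.im * s)) := by
  rw [expI, Complex.norm_exp]
  congr 1
  simp [Complex.mul_re, Complex.mul_im]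

theorem expI_neg_mul (κ : ℂ) (s : ℝ) : expI (-κ) s * expI κ s = 1 := by
  rw [expI, expI, ← Complex.exp_add]
  simp

theorem expI_abs_sub_of_le (κ : ℂ) {s t : ℝ} (h : t ≤ s) :
    expI κ |s - t| = expI κ s * expI (-κ) t := by
  rw [abs_of_nonneg (sub_nonneg.2 h), expI, expI, expI, ← Complex.exp_add]
  congr 1; push_cast; ring

theorem memLp_expI {κ : ℂ} (hκ : 0 < κ.im) : MemLp (expI κ) 2 (volume.restrict (Ioi 0)) := by
  refine (memLp_two_iff_integrable_sq_norm (continuous_expI κ).aestronglyMeasurable).2 ?_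
  refine (integrableOn_exp_mul_Ioi (a := -(2 * κ.im)) (by linarith) 0).congr_fun (fun s _ => ?_)
    measurableSet_Ioi
  simp only [norm_expI]
  rw [← Real.exp_nat_mul]; congr 1; push_cast; ring

theorem intervalIntegrable_of_memLp_Ioi {f : ℝ → ℂ} (hf : MemLp f 2 (volume.restrict (Ioi 0)))
    {b : ℝ} (hb : 0 ≤ b) : IntervalIntegrable f volume 0 b :=
  intervalIntegrable_of_memLp_Ioo hb (by norm_num)
    (hf.mono_measure (Measure.restrict_mono_set _ Ioo_subset_Ioi_self))

theorem isPrimitiveOn_integral_Ioi {a b : ℝ} (hab : a ≤ b) {g : ℝ → ℂ}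
    (hg : IntegrableOn g (Ioi a)) :
    IsPrimitiveOn a b (fun s => ∫ t in Ioi s, g t) fun t => -g t :=
  ⟨((intervalIntegrable_iff_integrableOn_Ioc_of_le hab).2 (hg.mono_set Ioc_subset_Ioi_self)).neg,
    fun s hs => by
      rw [intervalIntegral.integral_neg, ← intervalIntegral.integral_Ioi_sub_Ioi hg hs.1]; ring⟩

theorem aestronglyMeasurable_Ioi_of_isPrimitiveOn {a : ℝ} {H h : ℝ → ℂ}
    (hH : ∀ b, a ≤ b → IsPrimitiveOn a b H h) :
    AEStronglyMeasurable H (volume.restrict (Ioi a)) := by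
  refine ContinuousOn.aestronglyMeasurable (fun t ht => ?_) measurableSet_Ioi
  have hat : a < t := ht
  exact ((hH (t + 1) (by linarith)).continuousOn.continuousAt
    (Icc_mem_nhds hat (by linarith))).continuousWithinAt

/-- The part over `t < s` of the integral operator with kernel `exp (i κ |s - t|)` on `(0, ∞)`. -/
def expLeft (κ : ℂ) (f : ℝ → ℂ) (s : ℝ) : ℂ := expI κ s * ∫ t in (0 : ℝ)..s, expI (-κ) t * f t

/-- The part over `t > s` of the integral operator with kernel `exp (i κ |s - t|)` on `(0, ∞)`. -/
def expRight (κ : ℂ) (f : ℝ → ℂ) (s : ℝ) : ℂ := expI (-κ) s * ∫ t in Ioi s, expI κ t * f t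

section

variable {κ : ℂ} {f : ℝ → ℂ}

theorem expLeft_zero : expLeft κ f 0 = 0 := by simp [expLeft]

theorem expRight_zero : expRight κ f 0 = ∫ t in Ioi (0 : ℝ), expI κ t * f t := by
  rw [expRight, expI_zero, one_mul]

theorem integrableOn_expI_mul (hκ : 0 < κ.im) (hf : MemLp f 2 (volume.restrict (Ioi 0))) :
    IntegrableOn (fun t => expI κ t * f t) (Ioi 0) :=
  (memLp_expI hκ).integrable_mul hf

theorem isPrimitiveOn_expI (κ : ℂ) (a b : ℝ) :
    IsPrimitiveOn a b (expI κ) fun s => Complex.I * κ * expI κ s :=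
  .of_hasDerivAt (hasDerivAt_expI κ) (continuous_const.mul (continuous_expI κ))

theorem isPrimitiveOn_expLeft (hf : MemLp f 2 (volume.restrict (Ioi 0))) {b : ℝ} (hb : 0 ≤ b) :
    IsPrimitiveOn 0 b (expLeft κ f) fun s => Complex.I * κ * expLeft κ f s + f s := by
  refine ((isPrimitiveOn_expI κ 0 b).mul hb (.of_integrable
    ((intervalIntegrable_of_memLp_Ioi hf hb).continuousOn_mul
      (continuous_expI (-κ)).continuousOn))).congr hb (fun _ _ => rfl)
    (Eventually.of_forall fun t => ?_)
  simp only [expLeft]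
  linear_combination (-f t) * expI_neg_mul κ t

theorem isPrimitiveOn_expRight (hκ : 0 < κ.im) (hf : MemLp f 2 (volume.restrict (Ioi 0))) {b : ℝ}
    (hb : 0 ≤ b) :
    IsPrimitiveOn 0 b (expRight κ f) fun s => -(Complex.I * κ * expRight κ f s) - f s := by
  refine ((isPrimitiveOn_expI (-κ) 0 b).mul hb
    (isPrimitiveOn_integral_Ioi hb (integrableOn_expI_mul hκ hf))).congr hb (fun _ _ => rfl)
    (Eventually.of_forall fun t => ?_)
  simp only [expRight]
  linear_combination f t * expI_neg_mul κ t

theorem expLeft_eq_integral {s : ℝ} (hs : 0 ≤ s) :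
    expLeft κ f s = ∫ t in Ioc 0 s, expI κ |s - t| * f t := by
  rw [expLeft, intervalIntegral.integral_of_le hs, ← integral_const_mul]
  refine setIntegral_congr_fun measurableSet_Ioc fun t ht => ?_
  simp only [expI_abs_sub_of_le κ ht.2, mul_assoc]

theorem expRight_eq_integral (s : ℝ) :
    expRight κ f s = ∫ t in Ioi s, expI κ |s - t| * f t := by
  rw [expRight, ← integral_const_mul]
  refine setIntegral_congr_fun measurableSet_Ioi fun t ht => ?_
  simp only [abs_sub_comm s, expI_abs_sub_of_le κ (mem_Ioi.1 ht).le]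
  ring

theorem integrableOn_expI_abs_mul (hκ : 0 < κ.im) (hf : MemLp f 2 (volume.restrict (Ioi 0)))
    {s : ℝ} (hs : 0 ≤ s) : IntegrableOn (fun t => expI κ |s - t| * f t) (Ioi 0) := by
  rw [← Ioc_union_Ioi_eq_Ioi hs]
  refine IntegrableOn.union ?_ ?_
  · exact (intervalIntegrable_iff_integrableOn_Ioc_of_le hs).1
      ((intervalIntegrable_of_memLp_Ioi hf hs).continuousOn_mul
        ((continuous_expI κ).comp (by fun_prop)).continuousOn)
  · have hint : IntegrableOn (fun t => expI (-κ) s * (expI κ t * f t)) (Ioi s) :=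
      ((integrableOn_expI_mul hκ hf).mono_set (Ioi_subset_Ioi hs)).const_mul _
    refine hint.congr_fun (fun t ht => ?_) measurableSet_Ioi
    simp only [abs_sub_comm s, expI_abs_sub_of_le κ (mem_Ioi.1 ht).le]
    ring

theorem integral_expI_abs_mul (hκ : 0 < κ.im) (hf : MemLp f 2 (volume.restrict (Ioi 0))) {s : ℝ}
    (hs : 0 ≤ s) : ∫ t in Ioi (0 : ℝ), expI κ |s - t| * f t = expLeft κ f s + expRight κ f s := by
  have hint := integrableOn_expI_abs_mul hκ hf hs
  rw [expLeft_eq_integral hs, expRight_eq_integral, ← Ioc_union_Ioi_eq_Ioi hs,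
    setIntegral_union (Ioc_disjoint_Ioi le_rfl) measurableSet_Ioi
      (hint.mono_set Ioc_subset_Ioi_self) (hint.mono_set (Ioi_subset_Ioi hs))]

theorem enorm_integral_expI_abs_mul_le {I : Set ℝ} (hI : I ⊆ Ioi 0) (s : ℝ) :
    ‖∫ t in I, expI κ |s - t| * f t‖ₑ ≤
      ∫⁻ t in Ioi 0, ENNReal.ofReal (Real.exp (-(κ.im * |s - t|))) * ‖f t‖ₑ := by
  refine (enorm_integral_le_lintegral_enorm _).trans ((lintegral_mono_set hI).trans_eq ?_)
  simp only [enorm_mul, ← ofReal_norm (expI _ _), norm_expI]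

theorem memLp_expLeft (hκ : 0 < κ.im) (hf : MemLp f 2 (volume.restrict (Ioi 0))) :
    MemLp (expLeft κ f) 2 (volume.restrict (Ioi 0)) := by
  refine memLp_of_enorm_le_convolution hκ measurableSet_Ioi hf
    (aestronglyMeasurable_Ioi_of_isPrimitiveOn fun b hb => isPrimitiveOn_expLeft hf hb)
    fun s hs => ?_
  rw [expLeft_eq_integral (mem_Ioi.1 hs).le]
  exact enorm_integral_expI_abs_mul_le Ioc_subset_Ioi_self s

theorem memLp_expRight (hκ : 0 < κ.im) (hf : MemLp f 2 (volume.restrict (Ioi 0))) :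
    MemLp (expRight κ f) 2 (volume.restrict (Ioi 0)) := by
  refine memLp_of_enorm_le_convolution hκ measurableSet_Ioi hf
    (aestronglyMeasurable_Ioi_of_isPrimitiveOn fun b hb => isPrimitiveOn_expRight hκ hf hb)
    fun s hs => ?_
  rw [expRight_eq_integral]
  exact enorm_integral_expI_abs_mul_le (Ioi_subset_Ioi (mem_Ioi.1 hs).le) s

end

/-- `F` belongs to `H²((0, ∞))` with first derivative `F₁` and second derivative `G`, and `F`, `F₁`
are the continuous representatives on `[0, ∞)`. -/
structure HalfLineH2 (F F₁ G : ℝ → ℂ) : Prop where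
  memLp : MemLp F 2 (volume.restrict (Ioi 0))
  memLp_deriv : MemLp F₁ 2 (volume.restrict (Ioi 0))
  memLp_deriv2 : MemLp G 2 (volume.restrict (Ioi 0))
  isPrimitiveOn : ∀ b, 0 ≤ b → IsPrimitiveOn 0 b F F₁
  isPrimitiveOn_deriv : ∀ b, 0 ≤ b → IsPrimitiveOn 0 b F₁ G

theorem HalfLineH2.hasDerivWithinAt_zero {F F₁ G : ℝ → ℂ} (h : HalfLineH2 F F₁ G) :
    HasDerivWithinAt F (F₁ 0) (Ici 0) 0 := by
  have hcont : ContinuousWithinAt F₁ (Ioi 0) 0 :=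
    ((h.isPrimitiveOn_deriv 1 zero_le_one).continuousOn 0 (by norm_num)).mono_of_mem_nhdsWithin
      (mem_of_superset (Ioo_mem_nhdsGT one_pos) Ioo_subset_Icc_self)
  refine ((intervalIntegral.integral_hasDerivWithinAt_right (a := 0) (s := Ici 0) (t := Ioi 0)
    IntervalIntegrable.refl ⟨Ioi 0, self_mem_nhdsWithin, h.memLp_deriv.1⟩ hcont).const_add
      (F 0)).congr_of_eventuallyEq ?_ (by simp)
  filter_upwards [Icc_mem_nhdsGE (one_pos : (0 : ℝ) < 1)] with s hs
    using (h.isPrimitiveOn 1 zero_le_one).eq_add_integral s hs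

/-- The solutions in `L²((0, ∞))` of `-F'' = κ² F + f` for `Im κ > 0`; they differ by multiples `c`
of `exp (i κ s)`. -/
def halfLineSolution (κ : ℂ) (f : ℝ → ℂ) (c : ℂ) (s : ℝ) : ℂ :=
  Complex.I / (2 * κ) * (expLeft κ f s + expRight κ f s) + c * expI κ s

/-- The derivative of `halfLineSolution`. -/
def halfLineSolutionDeriv (κ : ℂ) (f : ℝ → ℂ) (c : ℂ) (s : ℝ) : ℂ :=
  -(1 / 2) * (expLeft κ f s - expRight κ f s) + c * (Complex.I * κ * expI κ s)

theorem halfLineH2_halfLineSolution {κ : ℂ} (hκ : 0 < κ.im) {f : ℝ → ℂ}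
    (hf : MemLp f 2 (volume.restrict (Ioi 0))) (c : ℂ) :
    HalfLineH2 (halfLineSolution κ f c) (halfLineSolutionDeriv κ f c)
      fun s => -(κ ^ 2 * halfLineSolution κ f c s) - f s := by
  have hκ0 : κ ≠ 0 := fun h => by simp [h] at hκ
  have hmem : MemLp (halfLineSolution κ f c) 2 (volume.restrict (Ioi 0)) :=
    (((memLp_expLeft hκ hf).add (memLp_expRight hκ hf)).const_mul _).add
      ((memLp_expI hκ).const_mul c)
  refine ⟨hmem, (((memLp_expLeft hκ hf).sub (memLp_expRight hκ hf)).const_mul _).add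
    (((memLp_expI hκ).const_mul _).const_mul c), (hmem.const_mul (κ ^ 2)).neg.sub hf,
    fun b hb => ?_, fun b hb => ?_⟩
  · refine ((((isPrimitiveOn_expLeft hf hb).add (isPrimitiveOn_expRight hκ hf hb)).const_mul
      (Complex.I / (2 * κ))).add ((isPrimitiveOn_expI κ 0 b).const_mul c)).congr hb
      (fun _ _ => rfl) (Eventually.of_forall fun s => ?_)
    simp only [halfLineSolutionDeriv]
    field_simp
    linear_combination κ * (expRight κ f s - expLeft κ f s) * Complex.I_sq
  · refine ((((isPrimitiveOn_expLeft hf hb).sub (isPrimitiveOn_expRight hκ hf hb)).const_mul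
      (-(1 / 2))).add (((isPrimitiveOn_expI κ 0 b).const_mul (Complex.I * κ)).const_mul c)).congr
      hb (fun _ _ => rfl) (Eventually.of_forall fun s => ?_)
    simp only [halfLineSolution]
    field_simp
    linear_combination (-2 * c * κ ^ 2 * expI κ s) * Complex.I_sq

theorem HalfLineH2.congr {F F₁ G F' G' : ℝ → ℂ} (h : HalfLineH2 F F₁ G) (hF : EqOn F' F (Ici 0))
    (hG : EqOn G' G (Ici 0)) : HalfLineH2 F' F₁ G' := by
  have hae : ∀ {u v : ℝ → ℂ} {I : Set ℝ}, MeasurableSet I → I ⊆ Ici 0 → EqOn u v (Ici 0) →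
      u =ᵐ[volume.restrict I] v := fun hI hsub huv => by
    filter_upwards [ae_restrict_mem hI] with s hs using huv (hsub hs)
  exact ⟨(memLp_congr_ae (hae measurableSet_Ioi Ioi_subset_Ici_self hF)).2 h.memLp, h.memLp_deriv,
    (memLp_congr_ae (hae measurableSet_Ioi Ioi_subset_Ici_self hG)).2 h.memLp_deriv2,
    fun b hb => (h.isPrimitiveOn b hb).congr hb (hF.mono Icc_subset_Ici_self) (ae_eq_refl _),
    fun b hb => (h.isPrimitiveOn_deriv b hb).congr hb (eqOn_refl _ _)
      (hae measurableSet_Ioo (Ioo_subset_Icc_self.trans Icc_subset_Ici_self) hG)⟩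

section

variable {z : ℂ} {f : ℝ → ℂ}

theorem r0_add_mul_expI (hz : z.im ≠ 0) (hf : MemLp f 2 (volume.restrict (Ioi 0))) (q : ℂ) {s : ℝ}
    (hs : 0 ≤ s) : r0 z f s + q * expI (sqrtUp z) s = halfLineSolution (sqrtUp z) f
      (q - Complex.I / (2 * sqrtUp z) * expRight (sqrtUp z) f 0) s := by
  have hκ := sqrtUp_im_pos hz
  have hr0 : r0 z f s = Complex.I / (2 * sqrtUp z) *
      ((∫ t in Ioi (0 : ℝ), expI (sqrtUp z) |s - t| * f t) -
        (∫ t in Ioi (0 : ℝ), expI (sqrtUp z) t * f t) * expI (sqrtUp z) s) := by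
    rw [← integral_mul_const, ← integral_sub (integrableOn_expI_abs_mul hκ hf hs)
      ((integrableOn_expI_mul hκ hf).mul_const _), ← integral_const_mul, r0]
    refine integral_congr_ae (Eventually.of_forall fun t => ?_)
    simp only [expI]; ring
  rw [hr0, integral_expI_abs_mul hκ hf hs, halfLineSolution, expRight_zero]
  ring

theorem r0_zero : r0 z f 0 = 0 := by
  refine setIntegral_eq_zero_of_forall_eq_zero fun t ht => ?_
  simp [abs_of_pos (mem_Ioi.1 ht)]

theorem pConst_eq (hz : z.im ≠ 0) (hf : MemLp f 2 (volume.restrict (Ioi 0))) :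
    pConst z f = ∫ t in Ioi (0 : ℝ), expI (sqrtUp z) t * f t := by
  have hκ0 : sqrtUp z ≠ 0 := fun h => by simpa [h] using sqrtUp_im_pos hz
  have hderiv := (halfLineH2_halfLineSolution (sqrtUp_im_pos hz) hf
    (0 - Complex.I / (2 * sqrtUp z) * expRight (sqrtUp z) f 0)).hasDerivWithinAt_zero
  have hr0 : ∀ s ∈ Ici (0 : ℝ), r0 z f s = halfLineSolution (sqrtUp z) f
      (0 - Complex.I / (2 * sqrtUp z) * expRight (sqrtUp z) f 0) s := fun s hs => by
    simpa using r0_add_mul_expI hz hf 0 hs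
  rw [pConst, (hderiv.congr hr0 (hr0 0 self_mem_Ici)).derivWithin (uniqueDiffWithinAt_Ici 0),
    halfLineSolutionDeriv, expLeft_zero, expI_zero, ← expRight_zero]
  field_simp
  linear_combination (-expRight (sqrtUp z) f 0) * Complex.I_sq

theorem exists_halfLineH2_r0_add (hz : z.im ≠ 0) (hf : MemLp f 2 (volume.restrict (Ioi 0)))
    (q : ℂ) : ∃ F₁ : ℝ → ℂ, F₁ 0 = xiConst z f q ∧
      HalfLineH2 (fun s => r0 z f s + q * expI (sqrtUp z) s) F₁
        fun s => -(z * (r0 z f s + q * expI (sqrtUp z) s)) - f s := by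
  have hκ0 : sqrtUp z ≠ 0 := fun h => by simpa [h] using sqrtUp_im_pos hz
  refine ⟨_, ?_, (halfLineH2_halfLineSolution (sqrtUp_im_pos hz) hf _).congr
    (fun s hs => r0_add_mul_expI hz hf q hs) fun s hs => ?_⟩
  · rw [halfLineSolutionDeriv, expLeft_zero, expI_zero, xiConst, pConst_eq hz hf, ← expRight_zero]
    field_simp
    linear_combination (-expRight (sqrtUp z) f 0) * Complex.I_sq
  · simp only [r0_add_mul_expI hz hf q hs, sqrtUp_sq]

theorem enorm_pConst_le (hz : z.im ≠ 0) (hf : MemLp f 2 (volume.restrict (Ioi 0))) :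
    ‖pConst z f‖ₑ ≤ eLpNorm (expI (sqrtUp z)) 2 (volume.restrict (Ioi 0)) *
      eLpNorm f 2 (volume.restrict (Ioi 0)) := by
  rw [pConst_eq hz hf]
  refine (enorm_integral_le_lintegral_enorm _).trans ?_
  rw [← eLpNorm_one_eq_lintegral_enorm]
  have hholder := eLpNorm_smul_le_mul_eLpNorm (p := 2) (q := 2) (r := 1) hf.1
    (memLp_expI (sqrtUp_im_pos hz)).1
  exact hholder

end

/-! ### Products `F(s) χ(u)` on rectangles -/

/-- The function `F(s) χ(u)`. All the functions on the edges and on the vertex region are of this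
form. -/
def tensor (F χ : ℝ → ℂ) (x : ℝ × ℝ) : ℂ := F x.1 * χ x.2

theorem volume_restrict_prod (I J : Set ℝ) : (volume : Measure (ℝ × ℝ)).restrict (I ×ˢ J) =
    (volume.restrict I).prod (volume.restrict J) := by
  rw [Measure.prod_restrict, Measure.volume_eq_prod]

theorem eLpNorm_tensor {I J : Set ℝ} {F χ : ℝ → ℂ}
    (hF : AEStronglyMeasurable F (volume.restrict I))
    (hχ : AEStronglyMeasurable χ (volume.restrict J)) :
    eLpNorm (tensor F χ) 2 (volume.restrict (I ×ˢ J)) =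
      eLpNorm F 2 (volume.restrict I) * eLpNorm χ 2 (volume.restrict J) := by
  refine (ENNReal.pow_right_strictMono two_ne_zero).injective ?_
  simp only [mul_pow, eLpNorm_two_sq]
  rw [volume_restrict_prod, ← lintegral_prod_mul (hF.enorm.pow_const 2) (hχ.enorm.pow_const 2)]
  simp only [tensor, enorm_mul, mul_pow]

theorem memLp_tensor {I J : Set ℝ} {F χ : ℝ → ℂ} (hF : MemLp F 2 (volume.restrict I))
    (hχ : MemLp χ 2 (volume.restrict J)) : MemLp (tensor F χ) 2 (volume.restrict (I ×ˢ J)) := by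
  refine ⟨?_, (eLpNorm_tensor hF.1 hχ.1).trans_lt (ENNReal.mul_lt_top hF.2 hχ.2)⟩
  rw [volume_restrict_prod]
  exact hF.1.comp_fst.mul hχ.1.comp_snd

theorem HasWeakDeriv.congr_left {d : ℝ × ℝ} {Ω : Set (ℝ × ℝ)} {ψ ψ' p : ℝ × ℝ → ℂ}
    (h : HasWeakDeriv d Ω ψ p) (hψ : ψ' =ᵐ[volume.restrict Ω] ψ) : HasWeakDeriv d Ω ψ' p where
  memLp := (memLp_congr_ae hψ).2 h.memLp
  memLp_deriv := h.memLp_deriv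
  integral_eq := fun φ hφ hc hs => by
    rw [← h.integral_eq φ hφ hc hs]
    exact integral_congr_ae (hψ.mono fun x hx => by simp only [hx])

theorem HasWeakDeriv.weakDeriv_ae_eq {d : ℝ × ℝ} {Ω : Set (ℝ × ℝ)} (hΩ : IsOpen Ω)
    {ψ p : ℝ × ℝ → ℂ} (h : HasWeakDeriv d Ω ψ p) : weakDeriv d Ω ψ =ᵐ[volume.restrict Ω] p := by
  have hex : ∃ p, HasWeakDeriv d Ω ψ p := ⟨p, h⟩
  rw [weakDeriv, dif_pos hex]
  exact hex.choose_spec.ae_eq hΩ h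

theorem integrable_smul_of_hasCompactSupport {Ω : Set (ℝ × ℝ)} {ψ : ℝ × ℝ → ℂ}
    (hψ : MemLp ψ 2 (volume.restrict Ω)) {g : ℝ × ℝ → ℝ} (hg : Continuous g)
    (hc : HasCompactSupport g) : Integrable (fun x => g x • ψ x) (volume.restrict Ω) :=
  (hψ.locallyIntegrable (by norm_num)).integrable_smul_left_of_hasCompactSupport hg hc

theorem integrable_fderiv_smul {Ω : Set (ℝ × ℝ)} {ψ : ℝ × ℝ → ℂ}
    (hψ : MemLp ψ 2 (volume.restrict Ω)) {φ : ℝ × ℝ → ℝ} (hφ : ContDiff ℝ 1 φ)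
    (hc : HasCompactSupport φ) (d : ℝ × ℝ) :
    Integrable (fun x => fderiv ℝ φ x d • ψ x) (volume.restrict Ω) :=
  integrable_smul_of_hasCompactSupport hψ ((hφ.continuous_fderiv one_ne_zero).clm_apply
    continuous_const) ((hc.fderiv ℝ).comp_left (g := fun A : ℝ × ℝ →L[ℝ] ℝ => A d) (by simp))

theorem HasWeakDerivLine.integral_slice {K : Set ℝ} {F F' : ℝ → ℂ} (h : HasWeakDerivLine K F F')
    {φ : ℝ × ℝ → ℝ} (hφ : ContDiff ℝ ∞ φ) (hc : HasCompactSupport φ) {ι : ℝ → ℝ × ℝ} {d : ℝ × ℝ}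
    (hι : IsClosedEmbedding ι) (hcd : ContDiff ℝ ∞ ι) (hd : ∀ t, HasDerivAt ι d t)
    (hK : ι ⁻¹' tsupport φ ⊆ K) :
    ∫ t in K, fderiv ℝ φ (ι t) d • F t = -∫ t in K, φ (ι t) • F' t := by
  have hderiv : ∀ t, deriv (φ ∘ ι) t = fderiv ℝ φ (ι t) d := fun t =>
    ((hφ.differentiable (by norm_num) (ι t)).hasFDerivAt.comp_hasDerivAt t (hd t)).deriv
  have hparts := h (φ ∘ ι) (hφ.comp hcd) (hc.comp_isClosedEmbedding hι)
    ((tsupport_comp_subset_preimage φ hι.continuous).trans hK)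
  simp only [hderiv] at hparts
  exact hparts

theorem hasWeakDeriv_tensor_fst {I J : Set ℝ} {F F' χ : ℝ → ℂ} (hF : MemLp F 2 (volume.restrict I))
    (hF' : MemLp F' 2 (volume.restrict I)) (h : HasWeakDerivLine I F F')
    (hχ : MemLp χ 2 (volume.restrict J)) :
    HasWeakDeriv (1, 0) (I ×ˢ J) (tensor F χ) (tensor F' χ) where
  memLp := memLp_tensor hF hχ
  memLp_deriv := memLp_tensor hF' hχ
  integral_eq := fun φ hφ hc hs => by
    have hint := integrable_fderiv_smul (memLp_tensor hF hχ) (hφ.of_le (by norm_num)) hc (1, 0)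
    have hint' := integrable_smul_of_hasCompactSupport (memLp_tensor hF' hχ) hφ.continuous hc
    rw [volume_restrict_prod] at hint hint' ⊢
    rw [integral_prod_symm _ hint, integral_prod_symm _ hint', ← integral_neg]
    refine integral_congr_ae (Eventually.of_forall fun u => ?_)
    have hslice := h.integral_slice hφ hc (ι := fun s => (s, u)) (d := (1, 0))
      (Function.LeftInverse.isClosedEmbedding (f := Prod.fst) (fun _ => rfl) (by fun_prop)
        (by fun_prop)) (by fun_prop)
      (fun s => (hasDerivAt_id s).prodMk (hasDerivAt_const s u)) fun s ht => (hs ht).1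
    simp only [tensor, ← smul_mul_assoc]
    rw [integral_mul_const, integral_mul_const, hslice, neg_mul]

theorem hasWeakDeriv_tensor_snd {I J : Set ℝ} {F χ χ' : ℝ → ℂ} (hF : MemLp F 2 (volume.restrict I))
    (hχ : MemLp χ 2 (volume.restrict J)) (hχ' : MemLp χ' 2 (volume.restrict J))
    (h : HasWeakDerivLine J χ χ') :
    HasWeakDeriv (0, 1) (I ×ˢ J) (tensor F χ) (tensor F χ') where
  memLp := memLp_tensor hF hχ
  memLp_deriv := memLp_tensor hF hχ'
  integral_eq := fun φ hφ hc hs => by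
    have hint := integrable_fderiv_smul (memLp_tensor hF hχ) (hφ.of_le (by norm_num)) hc (0, 1)
    have hint' := integrable_smul_of_hasCompactSupport (memLp_tensor hF hχ') hφ.continuous hc
    rw [volume_restrict_prod] at hint hint' ⊢
    rw [integral_prod _ hint, integral_prod _ hint', ← integral_neg]
    refine integral_congr_ae (Eventually.of_forall fun s => ?_)
    have hslice := h.integral_slice hφ hc (ι := fun u => (s, u)) (d := (0, 1))
      (Function.LeftInverse.isClosedEmbedding (f := Prod.snd) (fun _ => rfl) (by fun_prop)
        (by fun_prop)) (by fun_prop)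
      (fun u => (hasDerivAt_const u s).prodMk (hasDerivAt_id u)) fun u ht => (hs ht).2
    simp only [tensor, ← mul_smul_comm]
    rw [integral_const_mul, integral_const_mul, hslice, mul_neg]

/-- `F` belongs to `H²(I)`, with weak derivatives `F' = F₁` and `F'' = F₂`. -/
structure LineH2 (I : Set ℝ) (F F₁ F₂ : ℝ → ℂ) : Prop where
  memLp : MemLp F 2 (volume.restrict I)
  memLp_deriv : MemLp F₁ 2 (volume.restrict I)
  memLp_deriv2 : MemLp F₂ 2 (volume.restrict I)
  hasWeakDerivLine : HasWeakDerivLine I F F₁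
  hasWeakDerivLine_deriv : HasWeakDerivLine I F₁ F₂

theorem HalfLineH2.lineH2 {F F₁ F₂ : ℝ → ℂ} (h : HalfLineH2 F F₁ F₂) : LineH2 (Ioi 0) F F₁ F₂ :=
  ⟨h.memLp, h.memLp_deriv, h.memLp_deriv2, hasWeakDerivLine_Ioi h.isPrimitiveOn,
    hasWeakDerivLine_Ioi h.isPrimitiveOn_deriv⟩

theorem lineH2_of_hasDerivAt {a b : ℝ} (hab : a ≤ b) {F F₁ F₂ : ℝ → ℂ}
    (hF : ∀ t, HasDerivAt F (F₁ t) t) (hF₁ : ∀ t, HasDerivAt F₁ (F₂ t) t) (hc : Continuous F₂) :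
    LineH2 (Ioo a b) F F₁ F₂ := by
  have hF_cont : Continuous F := continuous_iff_continuousAt.2 fun t => (hF t).continuousAt
  have hF₁_cont : Continuous F₁ := continuous_iff_continuousAt.2 fun t => (hF₁ t).continuousAt
  exact ⟨memLp_Ioo_of_continuousOn hF_cont.continuousOn 2,
    memLp_Ioo_of_continuousOn hF₁_cont.continuousOn 2, memLp_Ioo_of_continuousOn hc.continuousOn 2,
    (IsPrimitiveOn.of_hasDerivAt hF hF₁_cont).hasWeakDerivLine hab,
    (IsPrimitiveOn.of_hasDerivAt hF₁ hc).hasWeakDerivLine hab⟩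

namespace LineH2

variable {I J : Set ℝ} {F F₁ F₂ χ χ₁ χ₂ : ℝ → ℂ} {ψ : ℝ × ℝ → ℂ}

theorem hasWeakDeriv_fst (hF : LineH2 I F F₁ F₂) (hχ : LineH2 J χ χ₁ χ₂)
    (hψ : ψ =ᵐ[volume.restrict (I ×ˢ J)] tensor F χ) :
    HasWeakDeriv (1, 0) (I ×ˢ J) ψ (tensor F₁ χ) :=
  (hasWeakDeriv_tensor_fst hF.memLp hF.memLp_deriv hF.hasWeakDerivLine hχ.memLp).congr_left hψ

theorem hasWeakDeriv_snd (hF : LineH2 I F F₁ F₂) (hχ : LineH2 J χ χ₁ χ₂)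
    (hψ : ψ =ᵐ[volume.restrict (I ×ˢ J)] tensor F χ) :
    HasWeakDeriv (0, 1) (I ×ˢ J) ψ (tensor F χ₁) :=
  (hasWeakDeriv_tensor_snd hF.memLp hχ.memLp hχ.memLp_deriv hχ.hasWeakDerivLine).congr_left hψ

theorem dS_ae_eq (hF : LineH2 I F F₁ F₂) (hχ : LineH2 J χ χ₁ χ₂) (hI : IsOpen I)
    (hJ : IsOpen J) (hψ : ψ =ᵐ[volume.restrict (I ×ˢ J)] tensor F χ) :
    dS (I ×ˢ J) ψ =ᵐ[volume.restrict (I ×ˢ J)] tensor F₁ χ :=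
  (hF.hasWeakDeriv_fst hχ hψ).weakDeriv_ae_eq (hI.prod hJ)

theorem dU_ae_eq (hF : LineH2 I F F₁ F₂) (hχ : LineH2 J χ χ₁ χ₂) (hI : IsOpen I)
    (hJ : IsOpen J) (hψ : ψ =ᵐ[volume.restrict (I ×ˢ J)] tensor F χ) :
    dU (I ×ˢ J) ψ =ᵐ[volume.restrict (I ×ˢ J)] tensor F χ₁ :=
  (hF.hasWeakDeriv_snd hχ hψ).weakDeriv_ae_eq (hI.prod hJ)

theorem hasWeakDeriv_dS (hF : LineH2 I F F₁ F₂) (hχ : LineH2 J χ χ₁ χ₂) (hI : IsOpen I)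
    (hJ : IsOpen J) (hψ : ψ =ᵐ[volume.restrict (I ×ˢ J)] tensor F χ) :
    HasWeakDeriv (1, 0) (I ×ˢ J) (dS (I ×ˢ J) ψ) (tensor F₂ χ) :=
  (hasWeakDeriv_tensor_fst hF.memLp_deriv hF.memLp_deriv2 hF.hasWeakDerivLine_deriv
    hχ.memLp).congr_left (hF.dS_ae_eq hχ hI hJ hψ)

theorem hasWeakDeriv_dU (hF : LineH2 I F F₁ F₂) (hχ : LineH2 J χ χ₁ χ₂) (hI : IsOpen I)
    (hJ : IsOpen J) (hψ : ψ =ᵐ[volume.restrict (I ×ˢ J)] tensor F χ) :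
    HasWeakDeriv (0, 1) (I ×ˢ J) (dU (I ×ˢ J) ψ) (tensor F χ₂) :=
  (hasWeakDeriv_tensor_snd hF.memLp hχ.memLp_deriv hχ.memLp_deriv2
    hχ.hasWeakDerivLine_deriv).congr_left (hF.dU_ae_eq hχ hI hJ hψ)

theorem dS_dS_ae_eq (hF : LineH2 I F F₁ F₂) (hχ : LineH2 J χ χ₁ χ₂) (hI : IsOpen I)
    (hJ : IsOpen J) (hψ : ψ =ᵐ[volume.restrict (I ×ˢ J)] tensor F χ) :
    dS (I ×ˢ J) (dS (I ×ˢ J) ψ) =ᵐ[volume.restrict (I ×ˢ J)] tensor F₂ χ :=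
  (hF.hasWeakDeriv_dS hχ hI hJ hψ).weakDeriv_ae_eq (hI.prod hJ)

theorem dU_dU_ae_eq (hF : LineH2 I F F₁ F₂) (hχ : LineH2 J χ χ₁ χ₂) (hI : IsOpen I)
    (hJ : IsOpen J) (hψ : ψ =ᵐ[volume.restrict (I ×ˢ J)] tensor F χ) :
    dU (I ×ˢ J) (dU (I ×ˢ J) ψ) =ᵐ[volume.restrict (I ×ˢ J)] tensor F χ₂ :=
  (hF.hasWeakDeriv_dU hχ hI hJ hψ).weakDeriv_ae_eq (hI.prod hJ)

theorem memH2 (hF : LineH2 I F F₁ F₂) (hχ : LineH2 J χ χ₁ χ₂) (hI : IsOpen I)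
    (hJ : IsOpen J) (hψ : ψ =ᵐ[volume.restrict (I ×ˢ J)] tensor F χ) : MemH2 (I ×ˢ J) ψ :=
  ⟨⟨_, hF.hasWeakDeriv_fst hχ hψ⟩, ⟨_, hF.hasWeakDeriv_snd hχ hψ⟩,
    ⟨_, hF.hasWeakDeriv_dS hχ hI hJ hψ⟩, ⟨_, hF.hasWeakDeriv_dU hχ hI hJ hψ⟩⟩

end LineH2

theorem tendsto_average_zero {G g : ℝ → ℝ≥0∞} {h₀ : ℝ} (hh₀ : 0 < h₀)
    (hG : ∀ᵐ t ∂(volume.restrict (Ioo 0 h₀)), G t ≤ g t) (hg : Tendsto g (𝓝[>] 0) (𝓝 0)) :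
    Tendsto (fun h : ℝ => (ENNReal.ofReal h)⁻¹ * ∫⁻ t in Ioo 0 h, G t) (𝓝[>] 0) (𝓝 0) := by
  rw [ENNReal.tendsto_nhds_zero] at hg ⊢
  intro ε hε
  obtain ⟨h₁, hh₁, hsub⟩ := mem_nhdsGT_iff_exists_Ioo_subset.1 (hg ε hε)
  filter_upwards [Ioo_mem_nhdsGT (lt_min hh₀ hh₁)] with h hh
  have hle : ∀ᵐ t ∂(volume.restrict (Ioo 0 h)), G t ≤ ε := by
    filter_upwards [ae_restrict_of_ae_restrict_of_subset
      (Ioo_subset_Ioo_right (hh.2.le.trans (min_le_left _ _))) hG,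
      ae_restrict_mem measurableSet_Ioo] with t hGt ht
    exact hGt.trans (hsub ⟨ht.1, ht.2.trans (hh.2.trans_le (min_le_right _ _))⟩)
  calc (ENNReal.ofReal h)⁻¹ * ∫⁻ t in Ioo 0 h, G t
      ≤ (ENNReal.ofReal h)⁻¹ * ∫⁻ _ in Ioo 0 h, ε :=
        mul_le_mul_right (lintegral_mono_ae hle) _
    _ = ε := by
        rw [setLIntegral_const, Real.volume_Ioo, sub_zero, mul_comm ε, ← mul_assoc,
          ENNReal.inv_mul_cancel (ENNReal.ofReal_pos.2 hh.1).ne' ENNReal.ofReal_ne_top, one_mul]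

theorem ae_ae_eq_tensor {I J : Set ℝ} (hI : MeasurableSet I) {F χ : ℝ → ℂ} {ψ : ℝ × ℝ → ℂ}
    (hψ : ψ =ᵐ[volume.restrict (I ×ˢ J)] tensor F χ) (a : ℝ) {σ : ℝ} (hσ : σ ≠ 0) :
    ∀ᵐ t : ℝ, a + σ * t ∈ I →
      ∀ᵐ u ∂(volume.restrict J), ψ (a + σ * t, u) = F (a + σ * t) * χ u := by
  rw [Filter.EventuallyEq, volume_restrict_prod] at hψ
  have hscale : Measure.QuasiMeasurePreserving (fun t : ℝ => σ * t) volume volume := by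
    refine ⟨by fun_prop, ?_⟩
    rw [Real.map_volume_mul_left hσ]
    exact Measure.smul_absolutelyContinuous
  exact ((measurePreserving_add_left volume a).quasiMeasurePreserving.comp hscale).ae
    ((ae_restrict_iff' hI).1 (Measure.ae_ae_of_ae_prod hψ))

theorem hasTraceS_of_ae_eq_tensor {I : Set ℝ} {F χ : ℝ → ℂ} {ψ : ℝ × ℝ → ℂ} {a σ h₀ : ℝ} {c : ℂ}
    (hσ : σ ≠ 0) (hχ : MemLp χ 2 (volume.restrict (Ioo 0 1))) (hI : MeasurableSet I)
    (hψ : ψ =ᵐ[volume.restrict (I ×ˢ Ioo 0 1)] tensor F χ) (hh₀ : 0 < h₀)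
    (hsub : ∀ t ∈ Ioo 0 h₀, a + σ * t ∈ I)
    (hF : Tendsto (fun t => F (a + σ * t)) (𝓝[>] 0) (𝓝 c)) :
    HasTraceS a σ ψ fun u => c * χ u := by
  have hχ_sq : ∫⁻ u in Ioo (0 : ℝ) 1, ‖χ u‖ₑ ^ 2 ≠ ⊤ :=
    eLpNorm_two_sq _ χ ▸ ENNReal.pow_ne_top hχ.2.ne
  refine ⟨hχ.const_mul c, tendsto_average_zero hh₀
    (g := fun t => ‖F (a + σ * t) - c‖ₑ ^ 2 * ∫⁻ u in Ioo (0 : ℝ) 1, ‖χ u‖ₑ ^ 2) ?_ ?_⟩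
  · rw [ae_restrict_iff' measurableSet_Ioo]
    filter_upwards [ae_ae_eq_tensor hI hψ a hσ] with t ht htm
    rw [← lintegral_const_mul' _ _ (by finiteness)]
    refine (lintegral_congr_ae ((ht (hsub t htm)).mono fun u hu => ?_)).le
    simp only [hu, ← mul_pow, ← enorm_mul, sub_mul]
  · simpa using ENNReal.Tendsto.mul_const
      (ENNReal.Tendsto.pow (n := 2) (hF.sub_const c).enorm) (Or.inr hχ_sq)

theorem hasTraceU_zero_of_eq_tensor {I : Set ℝ} {F χ : ℝ → ℂ} {ψ : ℝ × ℝ → ℂ} {b : ℝ} (σ : ℝ)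
    (hF : MemLp F 2 (volume.restrict I)) (hI : MeasurableSet I) (hχ : Continuous χ) (hb : χ b = 0)
    (hψ : ∀ s ∈ I, ∀ u, ψ (s, u) = F s * χ u) : HasTraceU I b σ ψ 0 := by
  have hF_sq : ∫⁻ s in I, ‖F s‖ₑ ^ 2 ≠ ⊤ := eLpNorm_two_sq _ F ▸ ENNReal.pow_ne_top hF.2.ne
  refine ⟨MemLp.zero, tendsto_average_zero one_pos
    (g := fun t => (∫⁻ s in I, ‖F s‖ₑ ^ 2) * ‖χ (b + σ * t)‖ₑ ^ 2)
    (Eventually.of_forall fun t => ?_) ?_⟩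
  · rw [← lintegral_mul_const' _ _ (by finiteness)]
    refine (setLIntegral_congr_fun hI fun s hs => ?_).le
    simp only [hψ s hs, Pi.zero_apply, sub_zero, enorm_mul, mul_pow]
  · have hlim : Tendsto (fun t : ℝ => χ (b + σ * t)) (𝓝[>] 0) (𝓝 (χ (b + σ * 0))) :=
      (Continuous.tendsto (by fun_prop) 0).mono_left nhdsWithin_le_nhds
    rw [mul_zero, add_zero, hb] at hlim
    simpa using ENNReal.Tendsto.const_mul (ENNReal.Tendsto.pow (n := 2) hlim.enorm) (Or.inr hF_sq)

theorem continuous_chi (n : ℕ) : Continuous (chi n) := by unfold chi; fun_prop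

theorem chi_zero (n : ℕ) : chi n 0 = 0 := by simp [chi]

theorem chi_one (n : ℕ) : chi n 1 = 0 := by simp [chi, Real.sin_nat_mul_pi]

theorem norm_chi_le (n : ℕ) (u : ℝ) : ‖chi n u‖ ≤ √2 := by
  rw [chi, Complex.norm_real, norm_mul, Real.norm_of_nonneg (Real.sqrt_nonneg 2)]
  exact mul_le_of_le_one_right (Real.sqrt_nonneg 2) (Real.abs_sin_le_one _)

theorem lineH2_chi (n : ℕ) : LineH2 (Ioo 0 1) (chi n)
    (fun u => ((√2 * (Real.cos (n * Real.pi * u) * (n * Real.pi)) : ℝ) : ℂ))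
    (fun u => -((n ^ 2 * Real.pi ^ 2 : ℝ) : ℂ) * chi n u) := by
  have harg : ∀ t : ℝ, HasDerivAt (fun u : ℝ => n * Real.pi * u) (n * Real.pi) t := fun t => by
    simpa using (hasDerivAt_id t).const_mul (n * Real.pi)
  refine lineH2_of_hasDerivAt zero_le_one (fun t => ((harg t).sin.const_mul √2).ofReal_comp)
    (fun t => ?_) (continuous_const.mul (continuous_chi n))
  refine (((harg t).cos.mul_const (n * Real.pi)).const_mul √2).ofReal_comp.congr_deriv ?_
  rw [chi]; push_cast; ring

theorem eLpNorm_chi {n : ℕ} (hn : 1 ≤ n) : eLpNorm (chi n) 2 (volume.restrict (Ioo 0 1)) = 1 := by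
  have hfreq : (n : ℝ) * Real.pi ≠ 0 := by positivity
  have hsq : ∀ u, ‖chi n u‖ ^ 2 = 2 * Real.sin (n * Real.pi * u) ^ 2 := fun u => by
    rw [chi, Complex.norm_real, Real.norm_eq_abs, sq_abs, mul_pow, Real.sq_sqrt (by norm_num)]
  have hintegral : ∫ u in Ioo (0 : ℝ) 1, ‖chi n u‖ ^ 2 = 1 := by
    simp only [hsq]
    rw [← integral_Ioc_eq_integral_Ioo, ← intervalIntegral.integral_of_le zero_le_one,
      intervalIntegral.integral_const_mul,
      intervalIntegral.integral_comp_mul_left (fun x => Real.sin x ^ 2) hfreq, integral_sin_sq]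
    simp only [mul_zero, Real.sin_zero, mul_one, Real.sin_nat_mul_pi, smul_eq_mul]
    field_simp
    ring
  rw [(lineH2_chi n).memLp.eLpNorm_eq_integral_rpow_norm two_ne_zero ENNReal.ofNat_ne_top]
  simp [hintegral]

/-! ### The coupling constants -/

theorem im_ofReal_sq_mul (ε : ℝ) (z : ℂ) : ((ε : ℂ) ^ 2 * z).im = ε ^ 2 * z.im := by
  rw [← Complex.ofReal_pow, Complex.im_ofReal_mul]

theorem not_isNeumannEigenvalue_sq_mul {γ : ℝ → ℝ} (hγ : Continuous γ) {z : ℂ} (hz : z.im ≠ 0)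
    {ε : ℝ} (hε : ε ≠ 0) : ¬ IsNeumannEigenvalue γ ((ε : ℂ) ^ 2 * z) :=
  not_isNeumannEigenvalue_of_im_ne_zero hγ <| by
    rw [im_ofReal_sq_mul]; exact mul_ne_zero (pow_ne_zero 2 hε) hz

theorem im_eq_two_mul_sqrtUp (z : ℂ) : z.im = 2 * (sqrtUp z).re * (sqrtUp z).im := by
  conv_lhs => rw [← sqrtUp_sq z, sq, Complex.mul_im]
  ring

theorem sqrtUp_re_ne_zero {z : ℂ} (hz : z.im ≠ 0) : (sqrtUp z).re ≠ 0 := fun h =>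
  hz (by rw [im_eq_two_mul_sqrtUp, h, mul_zero, zero_mul])

/-- `y` is a solution of `h_v y = ε² z y` on the vertex whose fluxes at `s = ∓1` match those of
half-line functions with boundary values `y (∓1)` and boundary derivatives `pⱼ + i √z y (∓1)`. -/
structure VertexProfile (γ : ℝ → ℝ) (z : ℂ) (ε : ℝ) (p₁ p₂ : ℂ) (y y₁ : ℝ → ℂ) : Prop where
  solves : SolvesODE (shiftedPot γ ((ε : ℂ) ^ 2 * z)) y y₁
  deriv_left : y₁ (-1) = -(ε * (p₁ + Complex.I * sqrtUp z * y (-1)))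
  deriv_right : y₁ 1 = ε * (p₂ + Complex.I * sqrtUp z * y 1)

theorem im_flux (ε : ℝ) (κ p q : ℂ) : (ε * (p + Complex.I * κ * q) * starRingEnd ℂ q).im =
    ε * ((p * starRingEnd ℂ q).im + κ.re * ‖q‖ ^ 2) := by
  rw [← Complex.normSq_eq_norm_sq, Complex.normSq_apply]
  simp only [Complex.mul_im, Complex.mul_re, Complex.add_re, Complex.add_im, Complex.ofReal_re,
    Complex.ofReal_im, Complex.I_re, Complex.I_im, Complex.conj_re, Complex.conj_im]
  ring

theorem neg_mul_im_mul_conj_le (a : ℝ) (p q : ℂ) :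
    -(a * (p * starRingEnd ℂ q).im) ≤ |a| * (‖p‖ * ‖q‖) := by
  refine (neg_le_abs _).trans ?_
  rw [abs_mul, ← RCLike.norm_conj q, ← norm_mul]
  gcongr
  exact Complex.abs_im_le_norm _

theorem mul_add_le_of_mul_sq_add_sq_le {a x₁ x₂ c₁ c₂ : ℝ} (ha : 0 ≤ a) (hx₁ : 0 ≤ x₁)
    (hx₂ : 0 ≤ x₂) (hc₁ : 0 ≤ c₁) (hc₂ : 0 ≤ c₂) (h : a * (x₁ ^ 2 + x₂ ^ 2) ≤ c₁ * x₁ + c₂ * x₂) :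
    a * (x₁ + x₂) ≤ 2 * (c₁ + c₂) := by
  rcases (add_nonneg hx₁ hx₂).eq_or_lt with hsum | hsum
  · rw [← hsum, mul_zero]; positivity
  · refine le_of_mul_le_mul_right ?_ hsum
    nlinarith [mul_nonneg ha (sq_nonneg (x₁ - x₂)), mul_nonneg hc₁ hx₁, mul_nonneg hc₂ hx₂,
      mul_nonneg hc₁ hx₂, mul_nonneg hc₂ hx₁]

/-- The flux `Im (y' ȳ)` is monotone, while an outgoing wave `q e^{i √z s}` carries the flux
`Re √z |q|²`. -/
theorem VertexProfile.norm_boundary_le {γ : ℝ → ℝ} {z : ℂ} {ε : ℝ} {p₁ p₂ : ℂ} {y y₁ : ℝ → ℂ}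
    (h : VertexProfile γ z ε p₁ p₂ y y₁) (hz : z.im ≠ 0) (hε : 0 < ε) :
    |(sqrtUp z).re| * (‖y (-1)‖ + ‖y 1‖) ≤ 2 * (‖p₁‖ + ‖p₂‖) := by
  set κ := sqrtUp z with hκ
  have him := sqrtUp_im_pos hz
  have hpos : 0 < |κ.re| := abs_pos.2 (sqrtUp_re_ne_zero hz)
  have hsign : ∀ t, 0 ≤ κ.re * (shiftedPot γ ((ε : ℂ) ^ 2 * z) t).im := fun t => by
    rw [shiftedPot_im, im_ofReal_sq_mul, im_eq_two_mul_sqrtUp, ← hκ,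
      show κ.re * (ε ^ 2 * (2 * κ.re * κ.im)) = 2 * (ε * κ.re) ^ 2 * κ.im by ring]
    positivity
  have hflux : κ.re * (y₁ 1 * starRingEnd ℂ (y 1)).im ≤
      κ.re * (y₁ (-1) * starRingEnd ℂ (y (-1))).im :=
    h.solves.im_deriv_mul_conj_antitone hsign (by norm_num)
  rw [h.deriv_left, h.deriv_right, neg_mul, Complex.neg_im, im_flux, im_flux] at hflux
  have hquad : κ.re ^ 2 * (‖y (-1)‖ ^ 2 + ‖y 1‖ ^ 2) ≤
      -(κ.re * (p₁ * starRingEnd ℂ (y (-1))).im) - κ.re * (p₂ * starRingEnd ℂ (y 1)).im :=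
    le_of_mul_le_mul_left (by linarith) hε
  rw [← sq_abs] at hquad
  refine mul_add_le_of_mul_sq_add_sq_le hpos.le (norm_nonneg _) (norm_nonneg _) (norm_nonneg _)
    (norm_nonneg _) (le_of_mul_le_mul_left ?_ hpos)
  linarith [neg_mul_im_mul_conj_le κ.re p₁ (y (-1)), neg_mul_im_mul_conj_le κ.re p₂ (y 1)]

/-- The boundary values `(y (-1), y 1)` of the function `y = ξ₁ r_v(w; ·, -1) + ξ₂ r_v(w; ·, 1)`,
as a linear function of `ξ`: the Neumann-to-Dirichlet map of `h_v - w`. -/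
def neumannToDirichlet (γ : ℝ → ℝ) (w : ℂ) : ℂ × ℂ →ₗ[ℂ] ℂ × ℂ :=
  (rV γ w (-1) (-1) • LinearMap.fst ℂ ℂ ℂ + rV γ w (-1) 1 • LinearMap.snd ℂ ℂ ℂ).prod
    (rV γ w 1 (-1) • LinearMap.fst ℂ ℂ ℂ + rV γ w 1 1 • LinearMap.snd ℂ ℂ ℂ)

theorem neumannToDirichlet_apply (γ : ℝ → ℝ) (w : ℂ) (ξ : ℂ × ℂ) : neumannToDirichlet γ w ξ =
    (rV γ w (-1) (-1) * ξ.1 + rV γ w (-1) 1 * ξ.2, rV γ w 1 (-1) * ξ.1 + rV γ w 1 1 * ξ.2) := rfl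

section Coupling

variable {γ : ℝ → ℝ} {z : ℂ} {ε : ℝ} {f₁ f₂ : ℝ → ℂ} {q : ℂ × ℂ}

theorem isCoupling_iff : IsCoupling γ ε z f₁ f₂ q ↔ q = (ε : ℂ) • neumannToDirichlet γ (ε ^ 2 * z)
    ((pConst z f₁, pConst z f₂) + (Complex.I * sqrtUp z) • q) := by
  rw [IsCoupling, Prod.ext_iff]
  simp only [neumannToDirichlet_apply, xiConst, Prod.fst_add, Prod.snd_add, Prod.smul_fst,
    Prod.smul_snd, smul_eq_mul, mul_add, mul_assoc]

theorem exists_vertexProfile (hγ : Continuous γ) (hz : z.im ≠ 0) (hε : ε ≠ 0) {p : ℂ × ℂ}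
    (hq : q = (ε : ℂ) • neumannToDirichlet γ (ε ^ 2 * z) (p + (Complex.I * sqrtUp z) • q)) :
    ∃ y y₁, VertexProfile γ z ε p.1 p.2 y y₁ ∧ y (-1) = q.1 ∧ y 1 = q.2 ∧
      ∀ s ∈ Icc (-1 : ℝ) 1, y s =
        ε * ((p.1 + Complex.I * sqrtUp z * q.1) * rV γ (ε ^ 2 * z) s (-1) +
          (p.2 + Complex.I * sqrtUp z * q.2) * rV γ (ε ^ 2 * z) s 1) := by
  obtain ⟨y, y₁, hy, hyr, hleft, hright⟩ := exists_solvesODE_rV hγ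
    (not_isNeumannEigenvalue_sq_mul hγ hz hε) (ε * (p.1 + Complex.I * sqrtUp z * q.1))
    (ε * (p.2 + Complex.I * sqrtUp z * q.2))
  rw [neumannToDirichlet_apply, Prod.ext_iff] at hq
  simp only [Prod.fst_add, Prod.snd_add, Prod.smul_fst, Prod.smul_snd, smul_eq_mul] at hq
  have hq₁ : y (-1) = q.1 := by rw [hyr (-1) (by norm_num)]; linear_combination -hq.1
  have hq₂ : y 1 = q.2 := by rw [hyr 1 (by norm_num)]; linear_combination -hq.2
  exact ⟨y, y₁, ⟨hy, by rw [hq₁, hleft], by rw [hq₂, hright]⟩, hq₁, hq₂, fun s hs => by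
    rw [hyr s hs]; ring⟩

theorem existsUnique_isCoupling (hγ : Continuous γ) (hz : z.im ≠ 0) (hε : 0 < ε)
    (f₁ f₂ : ℝ → ℂ) : ∃! q : ℂ × ℂ, IsCoupling γ ε z f₁ f₂ q := by
  set R := neumannToDirichlet γ (ε ^ 2 * z)
  set p : ℂ × ℂ := (pConst z f₁, pConst z f₂)
  let T : ℂ × ℂ →ₗ[ℂ] ℂ × ℂ := LinearMap.id - ((ε : ℂ) * (Complex.I * sqrtUp z)) • R
  have hT : ∀ q p : ℂ × ℂ, T q = (ε : ℂ) • R p ↔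
      q = (ε : ℂ) • R (p + (Complex.I * sqrtUp z) • q) := fun q p => by
    simp only [T, LinearMap.sub_apply, LinearMap.id_apply, LinearMap.smul_apply, sub_eq_iff_eq_add,
      map_add, map_smul, smul_add, smul_smul]
  have hinj : Function.Injective T := (injective_iff_map_eq_zero T).2 fun q hq => by
    obtain ⟨y, y₁, hy, hq₁, hq₂, -⟩ := exists_vertexProfile hγ hz hε.ne' (p := 0)
      ((hT q 0).1 (by rw [hq, map_zero, smul_zero]))
    have hle := hy.norm_boundary_le hz hε
    simp only [hq₁, hq₂, Prod.fst_zero, Prod.snd_zero, norm_zero, add_zero, mul_zero] at hle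
    have hsum := nonpos_of_mul_nonpos_right hle (abs_pos.2 (sqrtUp_re_ne_zero hz))
    exact Prod.ext (norm_le_zero_iff.1 (by linarith [norm_nonneg q.2]))
      (norm_le_zero_iff.1 (by linarith [norm_nonneg q.1]))
  have hbij : Function.Bijective T := ⟨hinj, LinearMap.injective_iff_surjective.1 hinj⟩
  simpa only [isCoupling_iff, hT] using hbij.existsUnique ((ε : ℂ) • R p)

end Coupling

/-! ### The domain of the Hamiltonian -/

/-- The longitudinal part of the approximate solution on an edge. -/
def edgeProfile (z : ℂ) (f : ℝ → ℂ) (q : ℂ) (s : ℝ) : ℂ := r0 z f s + q * expI (sqrtUp z) s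

theorem edgeProfile_zero (z : ℂ) (f : ℝ → ℂ) (q : ℂ) : edgeProfile z f q 0 = q := by
  rw [edgeProfile, r0_zero, expI_zero, zero_add, mul_one]

theorem SolvesODE.lineH2 {q y y₁ : ℝ → ℂ} (hq : Continuous q) (hy : SolvesODE q y y₁) :
    LineH2 (Ioo (-1) 1) y y₁ (fun t => -(q t * y t)) :=
  lineH2_of_hasDerivAt (by norm_num) hy.deriv_fst hy.deriv_snd (hq.mul hy.continuous_fst).neg

theorem ae_eq_tensor_of_forall {I J : Set ℝ} (hI : MeasurableSet I) (hJ : MeasurableSet J)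
    {F χ : ℝ → ℂ} {ψ : ℝ × ℝ → ℂ} (h : ∀ s ∈ I, ∀ u, ψ (s, u) = F s * χ u) :
    ψ =ᵐ[volume.restrict (I ×ˢ J)] tensor F χ := by
  filter_upwards [ae_restrict_mem (hI.prod hJ)] with x hx using h x.1 hx.1 x.2

theorem dirichlet_of_eq_tensor_chi {I : Set ℝ} (hI : MeasurableSet I) {F : ℝ → ℂ}
    (hF : MemLp F 2 (volume.restrict I)) {n : ℕ} {ψ : ℝ × ℝ → ℂ}
    (hψ : ∀ s ∈ I, ∀ u, ψ (s, u) = F s * chi n u) :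
    HasTraceU I 0 1 ψ 0 ∧ HasTraceU I 1 (-1) ψ 0 :=
  ⟨hasTraceU_zero_of_eq_tensor 1 hF hI (continuous_chi n) (chi_zero n) hψ,
    hasTraceU_zero_of_eq_tensor (-1) hF hI (continuous_chi n) (chi_one n) hψ⟩

section Traces

variable {F F₁ F₂ χ : ℝ → ℂ} {ψ : ℝ × ℝ → ℂ}

theorem hasTraceS_zero_of_isPrimitiveOn (hF : IsPrimitiveOn 0 1 F F₁)
    (hχ : MemLp χ 2 (volume.restrict (Ioo 0 1))) (hψ : ψ =ᵐ[volume.restrict E] tensor F χ) :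
    HasTraceS 0 1 ψ fun u => F 0 * χ u := by
  refine hasTraceS_of_ae_eq_tensor one_ne_zero hχ measurableSet_Ioi hψ one_pos
    (fun t ht => by simpa using ht.1) ?_
  simp only [zero_add, one_mul]
  exact (hF.continuousOn.continuousWithinAt ⟨le_rfl, zero_le_one⟩).mono_of_mem_nhdsWithin
    (mem_of_superset (Ioo_mem_nhdsGT one_pos) Ioo_subset_Icc_self)

theorem tendsto_side_of_continuous (hF : Continuous F) (a σ : ℝ) :
    Tendsto (fun t => F (a + σ * t)) (𝓝[>] 0) (𝓝 (F a)) := by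
  have hlim : Tendsto (fun t => F (a + σ * t)) (𝓝 0) (𝓝 (F (a + σ * 0))) :=
    Continuous.tendsto (by fun_prop) 0
  rw [mul_zero, add_zero] at hlim
  exact hlim.mono_left nhdsWithin_le_nhds

theorem hasTraceS_left_of_continuous (hF : Continuous F)
    (hχ : MemLp χ 2 (volume.restrict (Ioo 0 1))) (hψ : ψ =ᵐ[volume.restrict V] tensor F χ) :
    HasTraceS (-1) 1 ψ fun u => F (-1) * χ u :=
  hasTraceS_of_ae_eq_tensor one_ne_zero hχ measurableSet_Ioo hψ one_pos
    (fun t ht => ⟨by linarith [ht.1], by linarith [ht.2]⟩) (tendsto_side_of_continuous hF _ _)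

theorem hasTraceS_right_of_continuous (hF : Continuous F)
    (hχ : MemLp χ 2 (volume.restrict (Ioo 0 1))) (hψ : ψ =ᵐ[volume.restrict V] tensor F χ) :
    HasTraceS 1 (-1) ψ fun u => F 1 * χ u :=
  hasTraceS_of_ae_eq_tensor (neg_ne_zero.2 one_ne_zero) hχ measurableSet_Ioo hψ one_pos
    (fun t ht => ⟨by linarith [ht.2], by linarith [ht.1]⟩) (tendsto_side_of_continuous hF _ _)

end Traces

section Edge

variable {z : ℂ} {f : ℝ → ℂ}

theorem exists_halfLineH2_edgeProfile (hz : z.im ≠ 0) (hf : MemLp f 2 (volume.restrict (Ioi 0)))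
    (q : ℂ) : ∃ F₁, F₁ 0 = xiConst z f q ∧ HalfLineH2 (edgeProfile z f q) F₁
      (fun s => -(z * edgeProfile z f q s) - f s) :=
  exists_halfLineH2_r0_add hz hf q

theorem memH2_edge (hz : z.im ≠ 0) (hf : MemLp f 2 (volume.restrict (Ioi 0))) (q : ℂ) (n : ℕ) :
    MemH2 E (tensor (edgeProfile z f q) (chi n)) := by
  obtain ⟨F₁, -, hF⟩ := exists_halfLineH2_edgeProfile hz hf q
  exact hF.lineH2.memH2 (lineH2_chi n) isOpen_Ioi isOpen_Ioo ae_eq_rfl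

theorem dirichlet_edge (hz : z.im ≠ 0) (hf : MemLp f 2 (volume.restrict (Ioi 0))) (q : ℂ) (n : ℕ) :
    HasTraceU (Ioi 0) 0 1 (tensor (edgeProfile z f q) (chi n)) 0 ∧
      HasTraceU (Ioi 0) 1 (-1) (tensor (edgeProfile z f q) (chi n)) 0 := by
  obtain ⟨F₁, -, hF⟩ := exists_halfLineH2_edgeProfile hz hf q
  exact dirichlet_of_eq_tensor_chi measurableSet_Ioi hF.memLp fun _ _ _ => rfl

theorem hasTraceS_edge (hz : z.im ≠ 0) (hf : MemLp f 2 (volume.restrict (Ioi 0))) (q : ℂ) (n : ℕ) :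
    HasTraceS 0 1 (tensor (edgeProfile z f q) (chi n)) fun u => q * chi n u := by
  obtain ⟨F₁, -, hF⟩ := exists_halfLineH2_edgeProfile hz hf q
  simpa only [edgeProfile_zero] using hasTraceS_zero_of_isPrimitiveOn
    (hF.isPrimitiveOn 1 zero_le_one) (lineH2_chi n).memLp ae_eq_rfl

theorem hasTraceS_dS_edge (hz : z.im ≠ 0) (hf : MemLp f 2 (volume.restrict (Ioi 0))) (q : ℂ)
    (n : ℕ) : HasTraceS 0 1 (dS E (tensor (edgeProfile z f q) (chi n)))
      fun u => xiConst z f q * chi n u := by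
  obtain ⟨F₁, hF₁, hF⟩ := exists_halfLineH2_edgeProfile hz hf q
  rw [← hF₁]
  exact hasTraceS_zero_of_isPrimitiveOn (hF.isPrimitiveOn_deriv 1 zero_le_one) (lineH2_chi n).memLp
    (hF.lineH2.dS_ae_eq (lineH2_chi n) isOpen_Ioi isOpen_Ioo ae_eq_rfl)

end Edge

section Domain

variable {γ : ℝ → ℝ} {z : ℂ} {ε : ℝ} {f₁ f₂ : ℝ → ℂ} {q : ℂ × ℂ}

theorem IsCoupling.exists_vertexProfile (hq : IsCoupling γ ε z f₁ f₂ q) (hγ : Continuous γ)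
    (hz : z.im ≠ 0) (hε : ε ≠ 0) (n : ℕ) :
    ∃ y y₁, VertexProfile γ z ε (pConst z f₁) (pConst z f₂) y y₁ ∧ y (-1) = q.1 ∧ y 1 = q.2 ∧
      ∀ s ∈ Icc (-1 : ℝ) 1, ∀ u, (hatPsi γ ε z n f₁ f₂ q).2.2 (s, u) = y s * chi n u := by
  obtain ⟨y, y₁, hy, hq₁, hq₂, hyr⟩ := Waveguide.exists_vertexProfile hγ hz hε (isCoupling_iff.1 hq)
  exact ⟨y, y₁, hy, hq₁, hq₂, fun s hs u => by rw [hyr s hs]; rfl⟩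

theorem hatPsi_memDomain (hγ : Continuous γ) (hz : z.im ≠ 0) (hε : ε ≠ 0) (n : ℕ)
    (hf₁ : MemLp f₁ 2 (volume.restrict (Ioi 0))) (hf₂ : MemLp f₂ 2 (volume.restrict (Ioi 0)))
    (hq : IsCoupling γ ε z f₁ f₂ q) : MemDomain ε (hatPsi γ ε z n f₁ f₂ q) := by
  obtain ⟨y, y₁, hy, hq₁, hq₂, hyψ⟩ := hq.exists_vertexProfile hγ hz hε n
  have hψ : ∀ s ∈ Ioo (-1 : ℝ) 1, ∀ u, (hatPsi γ ε z n f₁ f₂ q).2.2 (s, u) = y s * chi n u :=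
    fun s hs => hyψ s (Ioo_subset_Icc_self hs)
  have hψ_ae := ae_eq_tensor_of_forall (J := Ioo 0 1) measurableSet_Ioo measurableSet_Ioo hψ
  have hχ := lineH2_chi n
  have hyH2 := hy.solves.lineH2 (continuous_shiftedPot hγ _)
  have hdψ_ae := hyH2.dS_ae_eq hχ isOpen_Ioo isOpen_Ioo hψ_ae
  have hε_ne : (ε : ℂ) ≠ 0 := Complex.ofReal_ne_zero.2 hε
  have hflux_left : (fun u => xiConst z f₁ q.1 * chi n u) =
      fun u => -(1 / (ε : ℂ)) * (y₁ (-1) * chi n u) := by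
    funext u; rw [hy.deriv_left, hq₁, xiConst]; field_simp
  have hflux_right : (fun u => xiConst z f₂ q.2 * chi n u) =
      fun u => 1 / (ε : ℂ) * (y₁ 1 * chi n u) := by
    funext u; rw [hy.deriv_right, hq₂, xiConst]; field_simp
  exact
    { memH2_one := memH2_edge hz hf₁ q.1 n
      memH2_two := memH2_edge hz hf₂ q.2 n
      memH2_vertex := hyH2.memH2 hχ isOpen_Ioo isOpen_Ioo hψ_ae
      dirichlet_one := dirichlet_edge hz hf₁ q.1 n
      dirichlet_two := dirichlet_edge hz hf₂ q.2 n
      dirichlet_vertex := dirichlet_of_eq_tensor_chi measurableSet_Ioo hyH2.memLp hψ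
      match_one := ⟨fun u => q.1 * chi n u, hasTraceS_edge hz hf₁ q.1 n,
        hq₁ ▸ hasTraceS_left_of_continuous hy.solves.continuous_fst hχ.memLp hψ_ae⟩
      match_two := ⟨fun u => q.2 * chi n u, hasTraceS_edge hz hf₂ q.2 n,
        hq₂ ▸ hasTraceS_right_of_continuous hy.solves.continuous_fst hχ.memLp hψ_ae⟩
      match_deriv_one :=
        ⟨_, hasTraceS_left_of_continuous hy.solves.continuous_snd hχ.memLp hdψ_ae,
          hflux_left ▸ hasTraceS_dS_edge hz hf₁ q.1 n⟩
      match_deriv_two :=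
        ⟨_, hasTraceS_right_of_continuous hy.solves.continuous_snd hχ.memLp hdψ_ae,
          hflux_right ▸ hasTraceS_dS_edge hz hf₂ q.2 n⟩ }

end Domain

/-! ### Bounds for the vertex profile -/

/-- `M` bounds the solution `y` of `y'' = -q y`, its derivative `y₁` and its second derivative on
`[-1,1]`. -/
structure SolutionBound (q y y₁ : ℝ → ℂ) (M : ℝ) : Prop where
  fst_le : ∀ s ∈ Icc (-1 : ℝ) 1, ‖y s‖ ≤ M
  snd_le : ∀ s ∈ Icc (-1 : ℝ) 1, ‖y₁ s‖ ≤ M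
  mul_le : ∀ s ∈ Icc (-1 : ℝ) 1, ‖q s * y s‖ ≤ M

theorem SolvesODE.solutionBound {q y y₁ : ℝ → ℂ} {K M : ℝ} (h : SolvesODE q y y₁) (hK : 1 ≤ K)
    (hq : ∀ s ∈ Icc (-1 : ℝ) 1, ‖q s‖ ≤ K) (h0 : ‖y (-1)‖ ≤ M) (h1 : ‖y₁ (-1)‖ ≤ M) :
    SolutionBound q y y₁ (K * Real.exp (K * 2) * M) := by
  have hM : 0 ≤ M := (norm_nonneg _).trans h0
  have hgronwall : ∀ s ∈ Icc (-1 : ℝ) 1,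
      ‖y s‖ ≤ Real.exp (K * 2) * M ∧ ‖y₁ s‖ ≤ Real.exp (K * 2) * M := fun s hs => by
    have hle := norm_le_of_cauchyData (g := fun _ => 0) (G := 0) h.deriv_fst
      (fun t => by simpa using h.deriv_snd t) hK hq (fun _ _ => norm_zero.le) h0 h1 hs
    rwa [add_zero, show (1 : ℝ) - -1 = 2 by norm_num, mul_comm M] at hle
  have hle : Real.exp (K * 2) * M ≤ K * Real.exp (K * 2) * M := by
    rw [mul_assoc]; exact le_mul_of_one_le_left (by positivity) hK
  refine ⟨fun s hs => (hgronwall s hs).1.trans hle, fun s hs => (hgronwall s hs).2.trans hle,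
    fun s hs => ?_⟩
  rw [norm_mul, mul_assoc]
  exact mul_le_mul (hq s hs) (hgronwall s hs).1 (norm_nonneg _) (zero_le_one.trans hK)

section VertexBounds

variable {γ : ℝ → ℝ} {z : ℂ}

theorem exists_norm_shiftedPot_le (hγ : ContinuousOn γ (Icc (-1) 1)) (R : ℝ) :
    ∃ K, 1 ≤ K ∧ ∀ w : ℂ, ‖w‖ ≤ R → ∀ s ∈ Icc (-1 : ℝ) 1, ‖shiftedPot γ w s‖ ≤ K := by
  obtain ⟨B, hB⟩ := isCompact_Icc.exists_bound_of_continuousOn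
    (Complex.continuous_ofReal.comp_continuousOn ((hγ.pow 2).div_const 4))
  refine ⟨max 1 (B + R), le_max_left _ _, fun w hw s hs => le_max_of_le_right ?_⟩
  exact (norm_add_le _ _).trans (add_le_add (hB s hs) hw)

theorem norm_sq_mul_le {ε : ℝ} (hε : 0 < ε) (hε1 : ε ≤ 1) (z : ℂ) :
    ‖(ε : ℂ) ^ 2 * z‖ ≤ ε * ‖z‖ := by
  rw [norm_mul, norm_pow, Complex.norm_real, Real.norm_of_nonneg hε.le]
  gcongr
  exact pow_le_of_le_one hε.le hε1 two_ne_zero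

theorem norm_sq_mul_le_norm {ε : ℝ} (hε : 0 < ε) (hε1 : ε ≤ 1) (z : ℂ) :
    ‖(ε : ℂ) ^ 2 * z‖ ≤ ‖z‖ :=
  (norm_sq_mul_le hε hε1 z).trans (mul_le_of_le_one_left (norm_nonneg z) hε1)

theorem norm_flux_le {ε Q P : ℝ} (hε : 0 ≤ ε) (κ : ℂ) {p q : ℂ} (hp : ‖p‖ ≤ P) (hq : ‖q‖ ≤ Q) :
    ‖(ε : ℂ) * (p + Complex.I * κ * q)‖ ≤ ε * (P + ‖κ‖ * Q) := by
  rw [norm_mul, Complex.norm_real, Real.norm_of_nonneg hε]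
  gcongr
  refine (norm_add_le _ _).trans ?_
  rw [norm_mul, norm_mul, Complex.norm_I, one_mul]
  gcongr

theorem exists_cauchyData_bound (hz : z.im ≠ 0) :
    ∃ C, 0 < C ∧ ∀ (γ : ℝ → ℝ) (ε : ℝ) (p₁ p₂ : ℂ) (y y₁ : ℝ → ℂ), 0 < ε →
      VertexProfile γ z ε p₁ p₂ y y₁ → ‖y (-1)‖ ≤ C * (‖p₁‖ + ‖p₂‖) ∧
        ‖y₁ (-1)‖ ≤ C * (ε * (‖p₁‖ + ‖p₂‖)) ∧ ‖y₁ 1‖ ≤ C * (ε * (‖p₁‖ + ‖p₂‖)) := by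
  set κ := sqrtUp z
  have hre : 0 < |κ.re| := abs_pos.2 (sqrtUp_re_ne_zero hz)
  refine ⟨max (2 / |κ.re|) (1 + ‖κ‖ * (2 / |κ.re|)), by positivity,
    fun γ ε p₁ p₂ y y₁ hε h => ?_⟩
  set P := ‖p₁‖ + ‖p₂‖
  have hsum : ‖y (-1)‖ + ‖y 1‖ ≤ 2 / |κ.re| * P := by
    rw [div_mul_eq_mul_div, le_div_iff₀ hre, mul_comm _ |κ.re|]
    exact h.norm_boundary_le hz hε
  have hflux : ∀ p q : ℂ, ‖p‖ ≤ P → ‖q‖ ≤ 2 / |κ.re| * P →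
      ‖(ε : ℂ) * (p + Complex.I * κ * q)‖ ≤
        max (2 / |κ.re|) (1 + ‖κ‖ * (2 / |κ.re|)) * (ε * P) := fun p q hp hq =>
    calc ‖(ε : ℂ) * (p + Complex.I * κ * q)‖
      _ ≤ ε * (P + ‖κ‖ * (2 / |κ.re| * P)) := norm_flux_le hε.le κ hp hq
      _ = (1 + ‖κ‖ * (2 / |κ.re|)) * (ε * P) := by ring
      _ ≤ _ := by gcongr; exact le_max_right _ _
  refine ⟨?_, ?_, ?_⟩
  · calc ‖y (-1)‖ ≤ 2 / |κ.re| * P := (le_add_of_nonneg_right (norm_nonneg _)).trans hsum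
      _ ≤ _ := by gcongr; exact le_max_left _ _
  · rw [h.deriv_left, norm_neg]
    exact hflux _ _ (le_add_of_nonneg_right (norm_nonneg _))
      ((le_add_of_nonneg_right (norm_nonneg _)).trans hsum)
  · rw [h.deriv_right]
    exact hflux _ _ (le_add_of_nonneg_left (norm_nonneg _))
      ((le_add_of_nonneg_left (norm_nonneg _)).trans hsum)

theorem exists_vertexProfile_bound (hγ : ContinuousOn γ (Icc (-1) 1)) (hz : z.im ≠ 0) :
    ∃ C, 0 < C ∧ ∀ (ε : ℝ) (p₁ p₂ : ℂ) (y y₁ : ℝ → ℂ), 0 < ε → ε ≤ 1 →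
      VertexProfile γ z ε p₁ p₂ y y₁ →
        SolutionBound (shiftedPot γ (ε ^ 2 * z)) y y₁ (C * (‖p₁‖ + ‖p₂‖)) := by
  obtain ⟨C, hC, hbound⟩ := exists_cauchyData_bound hz
  obtain ⟨K, hK, hpot⟩ := exists_norm_shiftedPot_le hγ ‖z‖
  refine ⟨K * Real.exp (K * 2) * C, by positivity, fun ε p₁ p₂ y y₁ hε hε1 h => ?_⟩
  obtain ⟨h0, h1, -⟩ := hbound γ ε p₁ p₂ y y₁ hε h
  rw [mul_assoc _ C]
  refine h.solves.solutionBound hK (hpot _ (norm_sq_mul_le_norm hε hε1 z)) h0 (h1.trans ?_)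
  gcongr
  exact mul_le_of_le_one_left (by positivity) hε1

theorem norm_deriv_sub_le {w : ℂ} {a a₁ y y₁ : ℝ → ℂ} {K M G : ℝ}
    (ha : SolvesODE (shiftedPot γ 0) a a₁) (ha0 : a (-1) = 1) (ha1 : a₁ (-1) = 0)
    (hy : SolvesODE (shiftedPot γ w) y y₁) (hK : 1 ≤ K)
    (hpot : ∀ s ∈ Icc (-1 : ℝ) 1, ‖shiftedPot γ 0 s‖ ≤ K)
    (hG : ∀ s ∈ Icc (-1 : ℝ) 1, ‖w * y s‖ ≤ G) (h1 : ‖y₁ (-1)‖ ≤ M) :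
    ‖y₁ 1 - y (-1) * a₁ 1‖ ≤ (M + G) * Real.exp (K * 2) := by
  have hM : 0 ≤ M := (norm_nonneg _).trans h1
  have hdiff := norm_le_of_cauchyData (y := fun t => y t - y (-1) * a t)
    (y₁ := fun t => y₁ t - y (-1) * a₁ t) (q := shiftedPot γ 0) (g := fun t => -(w * y t))
    (fun t => (hy.deriv_fst t).sub ((ha.deriv_fst t).const_mul _))
    (fun t => ((hy.deriv_snd t).sub ((ha.deriv_snd t).const_mul _)).congr_deriv (by
      simp only [shiftedPot]; ring)) hK hpot (fun t ht => by rw [norm_neg]; exact hG t ht)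
    (by simpa only [ha0, mul_one, sub_self, norm_zero] using hM)
    (by simpa only [ha1, mul_zero, sub_zero] using h1) (right_mem_Icc.2 (by norm_num))
  rw [show (1 : ℝ) - -1 = 2 by norm_num] at hdiff
  exact hdiff.2

theorem exists_norm_left_le (hγ : Continuous γ) (hz : z.im ≠ 0)
    (hne : ¬ IsNeumannEigenvalue γ 0) :
    ∃ C, 0 < C ∧ ∀ (ε : ℝ) (p₁ p₂ : ℂ) (y y₁ : ℝ → ℂ), 0 < ε → ε ≤ 1 →
      VertexProfile γ z ε p₁ p₂ y y₁ → ‖y (-1)‖ ≤ C * (ε * (‖p₁‖ + ‖p₂‖)) := by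
  obtain ⟨a, a₁, b, b₁, ha⟩ := exists_neumannPair hγ 0
  have ha1 : 0 < ‖a₁ 1‖ := norm_pos_iff.2 (ha.deriv_ne_zero hγ hne)
  obtain ⟨C, hC, hdata⟩ := exists_cauchyData_bound hz
  obtain ⟨D, hD, hbound⟩ := exists_vertexProfile_bound hγ.continuousOn hz
  obtain ⟨K, hK, hpot⟩ := exists_norm_shiftedPot_le hγ.continuousOn 0
  set X := (C + ‖z‖ * D) * Real.exp (K * 2) with hX
  refine ⟨(C + X) / ‖a₁ 1‖, by positivity, fun ε p₁ p₂ y y₁ hε hε1 h => ?_⟩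
  obtain ⟨-, hleft, hright⟩ := hdata γ ε p₁ p₂ y y₁ hε h
  have hsmall := (hbound ε p₁ p₂ y y₁ hε hε1 h).fst_le
  set P := ‖p₁‖ + ‖p₂‖
  have hdiff : ‖y₁ 1 - y (-1) * a₁ 1‖ ≤ X * (ε * P) := by
    refine (norm_deriv_sub_le (G := ε * ‖z‖ * (D * P)) ha.left ha.left_val ha.left_deriv h.solves hK
      (hpot 0 norm_zero.le) (fun t ht => ?_) hleft).trans_eq (by rw [hX]; ring)
    rw [norm_mul]
    exact mul_le_mul (norm_sq_mul_le hε hε1 z) (hsmall t ht) (norm_nonneg _) (by positivity)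
  rw [div_mul_eq_mul_div, le_div_iff₀ ha1, ← norm_mul]
  calc ‖y (-1) * a₁ 1‖ = ‖y₁ 1 - (y₁ 1 - y (-1) * a₁ 1)‖ := by rw [sub_sub_cancel]
    _ ≤ ‖y₁ 1‖ + ‖y₁ 1 - y (-1) * a₁ 1‖ := norm_sub_le _ _
    _ ≤ (C + X) * (ε * P) := by rw [add_mul]; exact add_le_add hright hdiff

theorem exists_vertexProfile_bound_of_not_isNeumannEigenvalue (hγ : Continuous γ) (hz : z.im ≠ 0)
    (hne : ¬ IsNeumannEigenvalue γ 0) :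
    ∃ C, 0 < C ∧ ∀ (ε : ℝ) (p₁ p₂ : ℂ) (y y₁ : ℝ → ℂ), 0 < ε → ε ≤ 1 →
      VertexProfile γ z ε p₁ p₂ y y₁ →
        SolutionBound (shiftedPot γ (ε ^ 2 * z)) y y₁ (C * (ε * (‖p₁‖ + ‖p₂‖))) := by
  obtain ⟨C, -, hdata⟩ := exists_cauchyData_bound hz
  obtain ⟨D, hD, hleft⟩ := exists_norm_left_le hγ hz hne
  obtain ⟨K, hK, hpot⟩ := exists_norm_shiftedPot_le hγ.continuousOn ‖z‖
  refine ⟨K * Real.exp (K * 2) * max D C, by positivity, fun ε p₁ p₂ y y₁ hε hε1 h => ?_⟩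
  rw [mul_assoc _ (max D C)]
  refine h.solves.solutionBound hK (hpot _ (norm_sq_mul_le_norm hε hε1 z))
    ((hleft ε p₁ p₂ y y₁ hε hε1 h).trans ?_) ((hdata γ ε p₁ p₂ y y₁ hε h).2.1.trans ?_)
  · gcongr; exact le_max_left _ _
  · gcongr; exact le_max_right _ _

end VertexBounds

/-! ### The coefficients on the vertex region -/

/-- On `V`, the coefficients `1/g_β`, `∂ₛ(1/g_β)` and `W_β` of `L_β` differ by at most `M` from
their values `1`, `0` and `-γ²/4` at `β = 0`. -/
structure CoefficientBound (γ : ℝ → ℝ) (β M : ℝ) : Prop where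
  inv_metricG_le : ∀ x ∈ V, |1 - 1 / metricG γ β x| ≤ M
  deriv_inv_metricG_le : ∀ x ∈ V, |deriv (fun t => 1 / metricG γ β (t, x.2)) x.1| ≤ M
  potW_le : ∀ x ∈ V, |potW γ β x + γ x.1 ^ 2 / 4| ≤ M

theorem hasDerivAt_inv_metricG {γ : ℝ → ℝ} {β s u : ℝ} (hγ : DifferentiableAt ℝ γ s)
    (h : 1 + u * β * γ s ≠ 0) : HasDerivAt (fun t => 1 / metricG γ β (t, u))
      (-2 * (u * β * deriv γ s) / (1 + u * β * γ s) ^ 3) s := by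
  have hinv := (((hγ.hasDerivAt.const_mul (u * β)).const_add 1).pow 2).inv (pow_ne_zero 2 h)
  simp only [metricG, one_div]
  refine hinv.congr_deriv ?_
  simp only [Pi.pow_apply, Nat.cast_ofNat]
  field_simp
  ring

theorem abs_one_sub_one_div_sq_le {k β t : ℝ} (hk : 0 < k) (hkt : |t| ≤ 1 - k) (htβ : |t| ≤ β) :
    |1 - 1 / (1 + t) ^ 2| ≤ 3 / k ^ 2 * β := by
  have hkt' : k ≤ 1 + t := by linarith [neg_abs_le t]
  have hpos : 0 < 1 + t := hk.trans_le hkt'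
  have heq : 1 - 1 / (1 + t) ^ 2 = t * (2 + t) / (1 + t) ^ 2 := by field_simp; ring
  have hnum : |2 + t| ≤ 3 := abs_le.2 ⟨by linarith, by linarith [le_abs_self t]⟩
  have hβ : 0 ≤ β := (abs_nonneg t).trans htβ
  rw [heq, abs_div, abs_mul, abs_of_pos (pow_pos hpos 2)]
  calc |t| * |2 + t| / (1 + t) ^ 2 ≤ β * 3 / k ^ 2 := by gcongr
    _ = 3 / k ^ 2 * β := by ring

theorem abs_mul_div_pow_le {k v β A a τ : ℝ} (hk : 0 < k) (hkv : k ≤ v) (hτ : 0 ≤ τ)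
    (hτβ : τ ≤ β) (ha : |a| ≤ A) (m : ℕ) : |τ * a / v ^ m| ≤ A / k ^ m * β := by
  have hv : 0 < v := hk.trans_le hkv
  have hA : 0 ≤ A := (abs_nonneg a).trans ha
  have hβ : 0 ≤ β := hτ.trans hτβ
  rw [abs_div, abs_mul, abs_of_nonneg hτ, abs_of_pos (pow_pos hv m)]
  calc τ * |a| / v ^ m ≤ β * A / k ^ m := by gcongr
    _ = A / k ^ m * β := by ring

section Coefficients

variable {γ : ℝ → ℝ} {β k A s u : ℝ}

theorem abs_deriv_inv_metricG_le (hγ : DifferentiableAt ℝ γ s) (hk : 0 < k)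
    (hkv : k ≤ 1 + u * β * γ s) (hτ : 0 ≤ u * β) (hτβ : u * β ≤ β) (hA : |deriv γ s| ≤ A) :
    |deriv (fun t => 1 / metricG γ β (t, u)) s| ≤ 2 * A / k ^ 3 * β := by
  rw [(hasDerivAt_inv_metricG hγ (hk.trans_le hkv).ne').deriv, mul_left_comm]
  refine abs_mul_div_pow_le hk hkv hτ hτβ ?_ 3
  rw [abs_mul, abs_neg, abs_two]
  gcongr

theorem abs_potW_add_le (hk : 0 < k) (hkτ : |u * β * γ s| ≤ 1 - k) (hτγ : |u * β * γ s| ≤ β)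
    (hτ : 0 ≤ u * β) (hτβ : u * β ≤ β) (hβ1 : β ≤ 1) (hγ1 : |γ s| ≤ 1)
    (hA₁ : |deriv γ s| ≤ A) (hA₂ : |deriv (deriv γ) s| ≤ A) :
    |potW γ β (s, u) + γ s ^ 2 / 4| ≤ (3 / k ^ 2 + A / k ^ 3 + 5 / 4 * (A ^ 2 / k ^ 4)) * β := by
  set v := 1 + u * β * γ s with hv
  have hkv : k ≤ v := by linarith [neg_abs_le (u * β * γ s)]
  have hβ : 0 ≤ β := hτ.trans hτβ
  have : 0 ≤ A := (abs_nonneg _).trans hA₁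
  have hcurv : |γ s ^ 2 / 4 * (1 - 1 / v ^ 2)| ≤ 3 / k ^ 2 * β := by
    rw [abs_mul, abs_of_nonneg (by positivity)]
    refine (mul_le_of_le_one_left (abs_nonneg _) ?_).trans (abs_one_sub_one_div_sq_le hk hkτ hτγ)
    linarith [(sq_le_one_iff_abs_le_one (γ s)).2 hγ1]
  have hsecond : |1 / 2 * (u * β * deriv (deriv γ) s / v ^ 3)| ≤ A / k ^ 3 * β := by
    rw [abs_mul, abs_of_pos one_half_pos]
    exact (mul_le_of_le_one_left (abs_nonneg _) one_half_lt_one.le).trans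
      (abs_mul_div_pow_le hk hkv hτ hτβ hA₂ 3)
  have hfirst : |5 / 4 * ((u * β * deriv γ s) ^ 2 / v ^ 4)| ≤ 5 / 4 * (A ^ 2 / k ^ 4) * β := by
    have hsq : (u * β * deriv γ s) ^ 2 / v ^ 4 = (u * β * deriv γ s / v ^ 2) ^ 2 := by
      rw [div_pow, ← pow_mul]
    rw [hsq, abs_mul, abs_pow, abs_of_pos (by norm_num : (0 : ℝ) < 5 / 4)]
    calc 5 / 4 * |u * β * deriv γ s / v ^ 2| ^ 2
      _ ≤ 5 / 4 * (A / k ^ 2 * β) ^ 2 := by gcongr; exact abs_mul_div_pow_le hk hkv hτ hτβ hA₁ 2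
      _ = 5 / 4 * (A ^ 2 / k ^ 4) * β ^ 2 := by ring
      _ ≤ 5 / 4 * (A ^ 2 / k ^ 4) * β := by gcongr; exact pow_le_of_le_one hβ hβ1 two_ne_zero
  have hsplit : potW γ β (s, u) + γ s ^ 2 / 4 = γ s ^ 2 / 4 * (1 - 1 / v ^ 2)
      + 1 / 2 * (u * β * deriv (deriv γ) s / v ^ 3)
      - 5 / 4 * ((u * β * deriv γ s) ^ 2 / v ^ 4) := by
    simp only [potW, ← hv]; ring
  rw [hsplit, add_mul, add_mul]
  exact (abs_sub _ _).trans (add_le_add ((abs_add_le _ _).trans (add_le_add hcurv hsecond)) hfirst)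

end Coefficients

theorem exists_pos_forall_abs_le_one_sub {γ : ℝ → ℝ} {a b : ℝ} (hγ : ContinuousOn γ (Icc a b))
    (hγ1 : ∀ s ∈ Icc a b, |γ s| < 1) : ∃ k, 0 < k ∧ ∀ s ∈ Icc a b, |γ s| ≤ 1 - k := by
  rcases (Icc a b).eq_empty_or_nonempty with hempty | hne
  · exact ⟨1, one_pos, by simp [hempty]⟩
  · obtain ⟨s₀, hs₀, hmax⟩ := isCompact_Icc.exists_isMaxOn hne hγ.abs
    exact ⟨1 - |γ s₀|, sub_pos.2 (hγ1 s₀ hs₀), fun s hs => by rw [sub_sub_cancel]; exact hmax hs⟩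

theorem exists_coefficientBound {γ : ℝ → ℝ} (hγ : ContDiff ℝ 2 γ)
    (hγ1 : ∀ s ∈ Icc (-1) 1, |γ s| < 1) :
    ∃ C, 0 < C ∧ ∀ β, 0 ≤ β → β ≤ 1 → CoefficientBound γ β (C * β) := by
  obtain ⟨k, hk, hkγ⟩ := exists_pos_forall_abs_le_one_sub hγ.continuous.continuousOn hγ1
  have hγ' : ContDiff ℝ 1 (deriv γ) := hγ.iterate_deriv' 1 1
  obtain ⟨A₁, hA₁⟩ := isCompact_Icc.exists_bound_of_continuousOn (s := Icc (-1 : ℝ) 1)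
    hγ'.continuous.continuousOn
  obtain ⟨A₂, hA₂⟩ := isCompact_Icc.exists_bound_of_continuousOn (s := Icc (-1 : ℝ) 1)
    (hγ'.continuous_deriv le_rfl).continuousOn
  set A := max A₁ A₂
  replace hA₁ : ∀ s ∈ Icc (-1) 1, |deriv γ s| ≤ A := fun s hs => (hA₁ s hs).trans (le_max_left _ _)
  replace hA₂ : ∀ s ∈ Icc (-1) 1, |deriv (deriv γ) s| ≤ A :=
    fun s hs => (hA₂ s hs).trans (le_max_right _ _)
  have hA : 0 ≤ A := (abs_nonneg _).trans (hA₁ 0 (by norm_num))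
  refine ⟨3 / k ^ 2 + 2 * A / k ^ 3 + 5 / 4 * (A ^ 2 / k ^ 4), by positivity,
    fun β hβ hβ1 => ?_⟩
  have hstrip : ∀ x ∈ V, x.1 ∈ Icc (-1 : ℝ) 1 ∧ 0 ≤ x.2 * β ∧ x.2 * β ≤ β ∧
      |x.2 * β * γ x.1| ≤ 1 - k ∧ |x.2 * β * γ x.1| ≤ β := fun x hx => by
    have hs := Ioo_subset_Icc_self hx.1
    have hτ : 0 ≤ x.2 * β := mul_nonneg hx.2.1.le hβ
    have hτβ : x.2 * β ≤ β := mul_le_of_le_one_left hβ hx.2.2.le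
    rw [abs_mul, abs_of_nonneg hτ]
    exact ⟨hs, hτ, hτβ, (mul_le_of_le_one_left (abs_nonneg _) (hτβ.trans hβ1)).trans (hkγ _ hs),
      (mul_le_of_le_one_right hτ (hγ1 _ hs).le).trans hτβ⟩
  constructor <;> rintro ⟨s, u⟩ hx <;> obtain ⟨hs, hτ, hτβ, hkτ, hτγ⟩ := hstrip _ hx
  · refine (abs_one_sub_one_div_sq_le hk hkτ hτγ).trans (mul_le_mul_of_nonneg_right ?_ hβ)
    rw [add_assoc]
    exact le_add_of_nonneg_right (by positivity)
  · refine (abs_deriv_inv_metricG_le (hγ.differentiable two_ne_zero s) hk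
      (by linarith [neg_abs_le (u * β * γ s)]) hτ hτβ (hA₁ s hs)).trans
      (mul_le_mul_of_nonneg_right ?_ hβ)
    rw [add_right_comm]
    exact le_add_of_nonneg_left (by positivity)
  · refine (abs_potW_add_le hk hkτ hτγ hτ hτβ hβ1 (hγ1 s hs).le (hA₁ s hs)
      (hA₂ s hs)).trans (mul_le_mul_of_nonneg_right ?_ hβ)
    gcongr
    linarith

/-! ### The error of the approximate solution -/

theorem edge_error_ae_eq_zero {z : ℂ} (hz : z.im ≠ 0) {f : ℝ → ℂ}
    (hf : MemLp f 2 (volume.restrict (Ioi 0))) (δ : ℝ) (n : ℕ) (q : ℂ) :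
    (fun x => -dS E (dS E (tensor (edgeProfile z f q) (chi n))) x
      - (1 / (δ : ℂ) ^ 2) * dU E (dU E (tensor (edgeProfile z f q) (chi n))) x
      - (((n ^ 2 * Real.pi ^ 2 / δ ^ 2 : ℝ) : ℂ) + z) * tensor (edgeProfile z f q) (chi n) x
      - tensor f (chi n) x) =ᵐ[volume.restrict E] 0 := by
  obtain ⟨F₁, -, hF⟩ := exists_halfLineH2_edgeProfile hz hf q
  have hss := hF.lineH2.dS_dS_ae_eq (lineH2_chi n) isOpen_Ioi isOpen_Ioo ae_eq_rfl
  have huu := hF.lineH2.dU_dU_ae_eq (lineH2_chi n) isOpen_Ioi isOpen_Ioo ae_eq_rfl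
  filter_upwards [hss, huu] with x hxss hxuu
  rw [← E] at hxss hxuu
  simp only [hxss, hxuu, tensor, Pi.zero_apply]
  push_cast; ring

/-- Since `h_v y = ε² z y`, only the deviations of the coefficients of `L_β` from those at `β = 0`
survive. -/
theorem vertex_error_ae_eq {γ : ℝ → ℝ} (hγ : Continuous γ) {z : ℂ} {δ ε : ℝ} (hδ : δ ≠ 0)
    (hε : ε ≠ 0) {n : ℕ} {y y₁ : ℝ → ℂ} (hy : SolvesODE (shiftedPot γ ((ε : ℂ) ^ 2 * z)) y y₁)
    {ψ : ℝ × ℝ → ℂ} (hψ : ∀ s ∈ Ioo (-1 : ℝ) 1, ∀ u, ψ (s, u) = y s * chi n u) :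
    (fun x => (1 / (ε : ℂ) ^ 2) * opL γ (δ / ε) ψ x
      - (((n ^ 2 * Real.pi ^ 2 / δ ^ 2 : ℝ) : ℂ) + z) * ψ x)
      =ᵐ[volume.restrict V] fun x => 1 / (ε : ℂ) ^ 2 *
        (((1 - 1 / metricG γ (δ / ε) x : ℝ) : ℂ) * -(shiftedPot γ ((ε : ℂ) ^ 2 * z) x.1 * y x.1)
        - ((deriv (fun t => 1 / metricG γ (δ / ε) (t, x.2)) x.1 : ℝ) : ℂ) * y₁ x.1
        + ((potW γ (δ / ε) x + γ x.1 ^ 2 / 4 : ℝ) : ℂ) * y x.1) * chi n x.2 := by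
  have hyH2 := hy.lineH2 (continuous_shiftedPot hγ _)
  have hψ_ae := ae_eq_tensor_of_forall (J := Ioo 0 1) measurableSet_Ioo measurableSet_Ioo hψ
  have hs := hyH2.dS_ae_eq (lineH2_chi n) isOpen_Ioo isOpen_Ioo hψ_ae
  have hss := hyH2.dS_dS_ae_eq (lineH2_chi n) isOpen_Ioo isOpen_Ioo hψ_ae
  have huu := hyH2.dU_dU_ae_eq (lineH2_chi n) isOpen_Ioo isOpen_Ioo hψ_ae
  rw [← V] at hψ_ae hs hss huu
  have hε_ne : (ε : ℂ) ≠ 0 := Complex.ofReal_ne_zero.2 hε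
  have hδ_ne : (δ : ℂ) ≠ 0 := Complex.ofReal_ne_zero.2 hδ
  have hβ : ((1 / (δ / ε) ^ 2 : ℝ) : ℂ) = (ε : ℂ) ^ 2 / (δ : ℂ) ^ 2 := by
    push_cast; field_simp
  filter_upwards [hψ_ae, hs, hss, huu] with x hxψ hxs hxss hxuu
  simp only [opL, hxψ, hxs, hxss, hxuu, tensor, hβ]
  generalize metricG γ (δ / ε) x = g
  generalize potW γ (δ / ε) x = W
  generalize deriv (fun t => 1 / metricG γ (δ / ε) (t, x.2)) x.1 = D
  simp only [shiftedPot]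
  push_cast
  field_simp
  ring

theorem eLpNorm_fst_le_normH (ε : ℝ) (Φ : Vec) :
    eLpNorm Φ.1 2 (volume.restrict E) ≤ normH ε Φ := by
  rw [normH, one_div, ENNReal.le_rpow_inv_iff two_pos, ENNReal.rpow_two]
  exact le_add_right le_self_add

theorem eLpNorm_snd_le_normH (ε : ℝ) (Φ : Vec) :
    eLpNorm Φ.2.1 2 (volume.restrict E) ≤ normH ε Φ := by
  rw [normH, one_div, ENNReal.le_rpow_inv_iff two_pos, ENNReal.rpow_two]
  exact le_add_right le_add_self

theorem normH_of_edges_ae_eq_zero {ε : ℝ} (hε : 0 ≤ ε) {Φ : Vec}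
    (h₁ : Φ.1 =ᵐ[volume.restrict E] 0) (h₂ : Φ.2.1 =ᵐ[volume.restrict E] 0) :
    normH ε Φ = ENNReal.ofReal √ε * eLpNorm Φ.2.2 2 (volume.restrict V) := by
  have hsqrt : ENNReal.ofReal ε = ENNReal.ofReal √ε ^ 2 := by
    rw [← ENNReal.ofReal_pow (Real.sqrt_nonneg ε), Real.sq_sqrt hε]
  rw [normH, eLpNorm_congr_ae h₁, eLpNorm_congr_ae h₂, eLpNorm_zero, zero_pow two_ne_zero,
    zero_add, zero_add, hsqrt, ← mul_pow, ← ENNReal.rpow_two, ← ENNReal.rpow_mul,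
    mul_one_div_cancel two_ne_zero, ENNReal.rpow_one]

theorem volume_V : volume V = 2 := by
  rw [V, Measure.volume_eq_prod, Measure.prod_prod, Real.volume_Ioo, Real.volume_Ioo]
  norm_num

theorem eLpNorm_V_le {ψ : ℝ × ℝ → ℂ} {B : ℝ} (h : ∀ᵐ x ∂volume.restrict V, ‖ψ x‖ ≤ B) :
    eLpNorm ψ 2 (volume.restrict V) ≤ ENNReal.ofReal √2 * ENNReal.ofReal B := by
  have hsqrt : (2 : ℝ≥0∞) ^ (2⁻¹ : ℝ) = ENNReal.ofReal √2 := by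
    rw [Real.sqrt_eq_rpow, one_div, ← ENNReal.ofReal_rpow_of_pos two_pos, ENNReal.ofReal_ofNat]
  have hle := eLpNorm_le_of_ae_bound (p := 2) h
  rwa [Measure.restrict_apply_univ, volume_V, ENNReal.toReal_ofNat, hsqrt] at hle

section ResolventError

variable {γ : ℝ → ℝ} {z : ℂ} {δ ε : ℝ} {n : ℕ} {f₁ f₂ : ℝ → ℂ} {q : ℂ × ℂ} {y y₁ : ℝ → ℂ} {M B : ℝ}

theorem ae_norm_resolventError_vertex_le (hγ : Continuous γ) (hδ : δ ≠ 0) (hε : ε ≠ 0)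
    (hy : SolvesODE (shiftedPot γ ((ε : ℂ) ^ 2 * z)) y y₁)
    (hψ : ∀ s ∈ Ioo (-1 : ℝ) 1, ∀ u, (hatPsi γ ε z n f₁ f₂ q).2.2 (s, u) = y s * chi n u)
    (hM : CoefficientBound γ (δ / ε) M) (hB : SolutionBound (shiftedPot γ (ε ^ 2 * z)) y y₁ B) :
    ∀ᵐ x ∂volume.restrict V,
      ‖(resolventError γ δ ε z n f₁ f₂ q).2.2 x‖ ≤ 1 / ε ^ 2 * (3 * (M * B)) * √2 := by
  filter_upwards [vertex_error_ae_eq hγ hδ hε hy hψ,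
    ae_restrict_mem (measurableSet_Ioo.prod measurableSet_Ioo)] with x hx hxV
  have hs := Ioo_subset_Icc_self hxV.1
  have herror : (resolventError γ δ ε z n f₁ f₂ q).2.2 x =
      (1 / (ε : ℂ) ^ 2) * opL γ (δ / ε) (hatPsi γ ε z n f₁ f₂ q).2.2 x
        - (((n ^ 2 * Real.pi ^ 2 / δ ^ 2 : ℝ) : ℂ) + z) * (hatPsi γ ε z n f₁ f₂ q).2.2 x := by
    simp [resolventError, hamiltonian, dataXi]
  have hB0 : 0 ≤ B := (norm_nonneg _).trans (hB.fst_le x.1 hs)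
  have hM0 : 0 ≤ M := (abs_nonneg _).trans (hM.potW_le x hxV)
  have hterm : ∀ (c : ℝ) (w : ℂ), |c| ≤ M → ‖w‖ ≤ B → ‖(c : ℂ) * w‖ ≤ M * B := fun c w hc hw => by
    rw [norm_mul, Complex.norm_real]
    exact mul_le_mul hc hw (norm_nonneg _) ((abs_nonneg _).trans hc)
  rw [herror.trans hx, norm_mul, norm_mul, norm_div, norm_one, norm_pow, Complex.norm_real,
    Real.norm_eq_abs, sq_abs]
  refine mul_le_mul (mul_le_mul_of_nonneg_left ?_ (by positivity)) (norm_chi_le n x.2)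
    (norm_nonneg _) (by positivity)
  refine (norm_add_le _ _).trans ((add_le_add_left (norm_sub_le _ _) _).trans ?_)
  linarith [hterm _ _ (hM.inv_metricG_le x hxV) ((norm_neg _).trans_le (hB.mul_le x.1 hs)),
    hterm _ _ (hM.deriv_inv_metricG_le x hxV) (hB.snd_le x.1 hs),
    hterm _ _ (hM.potW_le x hxV) (hB.fst_le x.1 hs)]

theorem normH_resolventError_le (hγ : Continuous γ) (hz : z.im ≠ 0) (hδ : δ ≠ 0) (hε : 0 < ε)
    (hf₁ : MemLp f₁ 2 (volume.restrict (Ioi 0))) (hf₂ : MemLp f₂ 2 (volume.restrict (Ioi 0)))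
    (hy : SolvesODE (shiftedPot γ ((ε : ℂ) ^ 2 * z)) y y₁)
    (hψ : ∀ s ∈ Ioo (-1 : ℝ) 1, ∀ u, (hatPsi γ ε z n f₁ f₂ q).2.2 (s, u) = y s * chi n u)
    (hM : CoefficientBound γ (δ / ε) M) (hB : SolutionBound (shiftedPot γ (ε ^ 2 * z)) y y₁ B) :
    normH ε (resolventError γ δ ε z n f₁ f₂ q) ≤
      ENNReal.ofReal (6 * (M * B) / ε ^ (3 / 2 : ℝ)) := by
  have hpow : ε ^ 2 = √ε * ε ^ (3 / 2 : ℝ) := by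
    rw [Real.sqrt_eq_rpow, ← Real.rpow_add hε]; norm_num
  have hsqrt : 0 < √ε := Real.sqrt_pos.2 hε
  rw [normH_of_edges_ae_eq_zero hε.le (edge_error_ae_eq_zero hz hf₁ δ n q.1)
    (edge_error_ae_eq_zero hz hf₂ δ n q.2)]
  calc ENNReal.ofReal √ε * eLpNorm (resolventError γ δ ε z n f₁ f₂ q).2.2 2 (volume.restrict V)
    _ ≤ ENNReal.ofReal √ε * (ENNReal.ofReal √2 *
          ENNReal.ofReal (1 / ε ^ 2 * (3 * (M * B)) * √2)) := by
      gcongr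
      exact eLpNorm_V_le (ae_norm_resolventError_vertex_le hγ hδ hε.ne' hy hψ hM hB)
    _ = ENNReal.ofReal (√ε * (√2 * (1 / ε ^ 2 * (3 * (M * B)) * √2))) := by
      rw [← ENNReal.ofReal_mul (Real.sqrt_nonneg 2), ← ENNReal.ofReal_mul hsqrt.le]
    _ = ENNReal.ofReal (6 * (M * B) / ε ^ (3 / 2 : ℝ)) := by
      congr 1
      rw [hpow]
      field_simp
      rw [Real.sq_sqrt two_pos.le]
      ring

theorem eLpNorm_tensor_chi {f : ℝ → ℂ} (hf : MemLp f 2 (volume.restrict (Ioi 0))) (hn : 1 ≤ n) :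
    eLpNorm (tensor f (chi n)) 2 (volume.restrict E) = eLpNorm f 2 (volume.restrict (Ioi 0)) := by
  rw [E, eLpNorm_tensor hf.1 (lineH2_chi n).memLp.1, eLpNorm_chi hn, mul_one]

theorem exists_pConst_bound (hz : z.im ≠ 0) : ∃ N, 0 < N ∧
    ∀ (ε : ℝ) (n : ℕ) (f₁ f₂ : ℝ → ℂ), 1 ≤ n → MemLp f₁ 2 (volume.restrict (Ioi 0)) →
      MemLp f₂ 2 (volume.restrict (Ioi 0)) → ENNReal.ofReal (‖pConst z f₁‖ + ‖pConst z f₂‖) ≤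
        ENNReal.ofReal N * normH ε (dataXi n f₁ f₂) := by
  obtain ⟨N, hN, hexp⟩ : ∃ N : ℝ, 0 < N ∧
      eLpNorm (expI (sqrtUp z)) 2 (volume.restrict (Ioi 0)) ≤ ENNReal.ofReal N :=
    ⟨_, lt_add_of_nonneg_of_lt ENNReal.toReal_nonneg one_pos, (ENNReal.le_ofReal_iff_toReal_le
      (memLp_expI (sqrtUp_im_pos hz)).2.ne (by positivity)).2 (lt_add_one _).le⟩
  refine ⟨2 * N, by positivity, fun ε n f₁ f₂ hn hf₁ hf₂ => ?_⟩
  have hp : ∀ f, MemLp f 2 (volume.restrict (Ioi 0)) →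
      eLpNorm (tensor f (chi n)) 2 (volume.restrict E) ≤ normH ε (dataXi n f₁ f₂) →
      ENNReal.ofReal ‖pConst z f‖ ≤ ENNReal.ofReal N * normH ε (dataXi n f₁ f₂) :=
    fun f hf hle => by
      rw [ofReal_norm]
      exact (enorm_pConst_le hz hf).trans
        (mul_le_mul' hexp ((eLpNorm_tensor_chi hf hn).symm.trans_le hle))
  have h₁ := hp f₁ hf₁ (eLpNorm_fst_le_normH ε (dataXi n f₁ f₂))
  have h₂ := hp f₂ hf₂ (eLpNorm_snd_le_normH ε (dataXi n f₁ f₂))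
  rw [ENNReal.ofReal_add (norm_nonneg _) (norm_nonneg _), ENNReal.ofReal_mul two_pos.le,
    ENNReal.ofReal_ofNat, mul_assoc, two_mul]
  exact add_le_add h₁ h₂

theorem rpow_five_halves {x : ℝ} (hx : 0 ≤ x) : x ^ (5 / 2 : ℝ) = x * x ^ (3 / 2 : ℝ) := by
  rw [← Real.rpow_one_add' hx (by norm_num)]; norm_num

/-- `ρ ε` is the order of magnitude of the vertex profile relative to the data: `1` if `0` is an
eigenvalue of `h_v`, and `ε` otherwise. -/
theorem exists_normH_resolventError_le (hγ : ContDiff ℝ 2 γ) (hγ1 : ∀ s ∈ Icc (-1) 1, |γ s| < 1)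
    (hz : z.im ≠ 0) {ρ : ℝ → ℝ} (hρ : ∃ D, 0 < D ∧ ∀ (ε : ℝ) (p₁ p₂ : ℂ) (y y₁ : ℝ → ℂ),
      0 < ε → ε ≤ 1 → VertexProfile γ z ε p₁ p₂ y y₁ →
        SolutionBound (shiftedPot γ (ε ^ 2 * z)) y y₁ (D * (ρ ε * (‖p₁‖ + ‖p₂‖)))) :
    ∃ c, 0 < c ∧ ∀ ε δ : ℝ, 0 < ε → ε ≤ 1 → 0 < δ → δ ≤ ε → ∀ n : ℕ, 1 ≤ n → ∀ f₁ f₂ : ℝ → ℂ,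
      MemLp f₁ 2 (volume.restrict (Ioi 0)) → MemLp f₂ 2 (volume.restrict (Ioi 0)) →
      ∀ q : ℂ × ℂ, IsCoupling γ ε z f₁ f₂ q → normH ε (resolventError γ δ ε z n f₁ f₂ q) ≤
        ENNReal.ofReal (c * (ρ ε * (δ / ε ^ (5 / 2 : ℝ)))) * normH ε (dataXi n f₁ f₂) := by
  obtain ⟨D, hD, hprofile⟩ := hρ
  obtain ⟨C, hC, hcoeff⟩ := exists_coefficientBound hγ hγ1
  obtain ⟨N, hN, hdata⟩ := exists_pConst_bound hz
  refine ⟨6 * C * D * N, by positivity, fun ε δ hε hε1 hδ hδε n hn f₁ f₂ hf₁ hf₂ q hq => ?_⟩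
  obtain ⟨y, y₁, hy, -, -, hψ⟩ := hq.exists_vertexProfile hγ.continuous hz hε.ne' n
  set P := ‖pConst z f₁‖ + ‖pConst z f₂‖
  calc normH ε (resolventError γ δ ε z n f₁ f₂ q)
    _ ≤ ENNReal.ofReal (6 * (C * (δ / ε) * (D * (ρ ε * P))) / ε ^ (3 / 2 : ℝ)) :=
      normH_resolventError_le hγ.continuous hz hδ.ne' hε hf₁ hf₂ hy.solves
        (fun s hs => hψ s (Ioo_subset_Icc_self hs))
        (hcoeff _ (div_pos hδ hε).le ((div_le_one hε).2 hδε)) (hprofile ε _ _ y y₁ hε hε1 hy)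
    _ = ENNReal.ofReal (6 * C * D * (ρ ε * (δ / ε ^ (5 / 2 : ℝ))) * P) := by
      congr 1; rw [rpow_five_halves hε.le]; field_simp
    _ = ENNReal.ofReal (6 * C * D * (ρ ε * (δ / ε ^ (5 / 2 : ℝ)))) * ENNReal.ofReal P :=
      ENNReal.ofReal_mul' (by positivity)
    _ ≤ ENNReal.ofReal (6 * C * D * (ρ ε * (δ / ε ^ (5 / 2 : ℝ)))) *
          (ENNReal.ofReal N * normH ε (dataXi n f₁ f₂)) := by
      gcongr; exact hdata ε n f₁ f₂ hn hf₁ hf₂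
    _ = ENNReal.ofReal (6 * C * D * N * (ρ ε * (δ / ε ^ (5 / 2 : ℝ)))) *
          normH ε (dataXi n f₁ f₂) := by
      rw [← mul_assoc, ← ENNReal.ofReal_mul' hN.le]
      congr 2; ring

end ResolventError

end Waveguide

end

theorem theorem3p1_general (γ : ℝ → ℝ) (hγ : ContDiff ℝ 2 γ)
    (hγbound : ∀ s ∈ Set.Icc (-1) 1, |γ s| < 1) :
    (∀ z : ℂ, z.im ≠ 0 → ∀ ε δ : ℝ, 0 < δ → δ ≤ ε → ∀ n : ℕ, 1 ≤ n → ∀ f₁ f₂ : ℝ → ℂ,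
      MemLp f₁ 2 (volume.restrict (Set.Ioi 0)) → MemLp f₂ 2 (volume.restrict (Set.Ioi 0)) →
      (∃! q : ℂ × ℂ, IsCoupling γ ε z f₁ f₂ q) ∧
      ∀ q : ℂ × ℂ, IsCoupling γ ε z f₁ f₂ q → MemDomain ε (hatPsi γ ε z n f₁ f₂ q)) ∧
    (∀ z : ℂ, z.im ≠ 0 → ∃ ε₀ : ℝ, 0 < ε₀ ∧ ∃ c : ℝ, 0 < c ∧
      ∀ ε δ : ℝ, 0 < ε → ε < ε₀ → 0 < δ → δ ≤ ε → ∀ n : ℕ, 1 ≤ n → ∀ f₁ f₂ : ℝ → ℂ,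
      MemLp f₁ 2 (volume.restrict (Set.Ioi 0)) → MemLp f₂ 2 (volume.restrict (Set.Ioi 0)) →
      ∀ q : ℂ × ℂ, IsCoupling γ ε z f₁ f₂ q →
        (¬ IsNeumannEigenvalue γ 0 →
          normH ε (resolventError γ δ ε z n f₁ f₂ q) ≤
            ENNReal.ofReal (c * (δ / ε ^ (3 / 2 : ℝ))) * normH ε (dataXi n f₁ f₂)) ∧
        (IsNeumannEigenvalue γ 0 →
          normH ε (resolventError γ δ ε z n f₁ f₂ q) ≤
            ENNReal.ofReal (c * (δ / ε ^ (3 / 2 : ℝ) + δ / ε ^ (5 / 2 : ℝ))) *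
              normH ε (dataXi n f₁ f₂))) := by
  refine ⟨fun z hz ε δ hδ hδε n _ f₁ f₂ hf₁ hf₂ => ?_, fun z hz => ?_⟩
  · have hε : 0 < ε := hδ.trans_le hδε
    exact ⟨existsUnique_isCoupling hγ.continuous hz hε f₁ f₂,
      fun q => hatPsi_memDomain hγ.continuous hz hε.ne' n hf₁ hf₂⟩
  by_cases hev : IsNeumannEigenvalue γ 0
  · obtain ⟨c, hc, herror⟩ := exists_normH_resolventError_le hγ hγbound hz (ρ := fun _ => 1)
      (by simpa only [one_mul] using exists_vertexProfile_bound hγ.continuous.continuousOn hz)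
    refine ⟨1, one_pos, c, hc, fun ε δ hε hε1 hδ hδε n hn f₁ f₂ hf₁ hf₂ q hq =>
      ⟨fun h => absurd hev h, fun _ =>
        (herror ε δ hε hε1.le hδ hδε n hn f₁ f₂ hf₁ hf₂ q hq).trans ?_⟩⟩
    gcongr
    rw [one_mul]
    exact le_add_of_nonneg_left (by positivity)
  · obtain ⟨c, hc, herror⟩ := exists_normH_resolventError_le hγ hγbound hz (ρ := id)
      (exists_vertexProfile_bound_of_not_isNeumannEigenvalue hγ.continuous hz hev)
    refine ⟨1, one_pos, c, hc, fun ε δ hε hε1 hδ hδε n hn f₁ f₂ hf₁ hf₂ q hq =>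
      ⟨fun _ => ?_, fun h => absurd h hev⟩⟩
    have hrate : ε * (δ / ε ^ (5 / 2 : ℝ)) = δ / ε ^ (3 / 2 : ℝ) := by
      rw [rpow_five_halves hε.le]
      field_simp
    rw [← hrate]
    exact herror ε δ hε hε1.le hδ hδε n hn f₁ f₂ hf₁ hf₂ q hq

theorem theorem3p1 (γ : ℝ → ℝ) (hγ : ContDiff ℝ ∞ γ) (hγsupp : tsupport γ ⊆ Set.Ioo (-1) 1)
    (hγbound : ∀ s, |γ s| < 1) :
    -- the constants are well defined, and the approximate solution lies in the domain
    (∀ z : ℂ, z.im ≠ 0 → ∀ ε δ : ℝ, 0 < δ → δ ≤ ε → ∀ n : ℕ, 1 ≤ n → ∀ f₁ f₂ : ℝ → ℂ,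
      MemLp f₁ 2 (volume.restrict (Set.Ioi 0)) → MemLp f₂ 2 (volume.restrict (Set.Ioi 0)) →
      (∃! q : ℂ × ℂ, IsCoupling γ ε z f₁ f₂ q) ∧
      ∀ q : ℂ × ℂ, IsCoupling γ ε z f₁ f₂ q → MemDomain ε (hatPsi γ ε z n f₁ f₂ q)) ∧
    -- the estimates; `c` and `ε₀` depend on `γ` and `z` only
    (∀ z : ℂ, z.im ≠ 0 → ∃ ε₀ : ℝ, 0 < ε₀ ∧ ∃ c : ℝ, 0 < c ∧
      ∀ ε δ : ℝ, 0 < ε → ε < ε₀ → 0 < δ → δ ≤ ε → ∀ n : ℕ, 1 ≤ n → ∀ f₁ f₂ : ℝ → ℂ,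
      MemLp f₁ 2 (volume.restrict (Set.Ioi 0)) → MemLp f₂ 2 (volume.restrict (Set.Ioi 0)) →
      ∀ q : ℂ × ℂ, IsCoupling γ ε z f₁ f₂ q →
        (¬ IsNeumannEigenvalue γ 0 →
          normH ε (resolventError γ δ ε z n f₁ f₂ q) ≤
            ENNReal.ofReal (c * (δ / ε ^ (3 / 2 : ℝ))) * normH ε (dataXi n f₁ f₂)) ∧
        (IsNeumannEigenvalue γ 0 →
          normH ε (resolventError γ δ ε z n f₁ f₂ q) ≤
            ENNReal.ofReal (c * (δ / ε ^ (3 / 2 : ℝ) + δ / ε ^ (5 / 2 : ℝ))) *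
              normH ε (dataXi n f₁ f₂))) := by
  exact theorem3p1_general γ (contDiff_infty.1 hγ 2) fun s _ => hγbound s
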